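/- Let $L^2(0,1)$ be the space of complex-valued square-integrable functions with $\langle f,g\rangle=\int_0^1 f\bar g$ and unit sphere $\mathcal S$. For $j\in\mathbb N^*$ let $\varphi_j=\sqrt2\sin(j\pi\cdot)$, $\lambda_j=(j\pi)^2$, the eigenfunctions and eigenvalues of $A=-\frac{d^2}{dx^2}$ with Dirichlet conditions; let $e^{-iAt}\varphi=\sum_j e^{-i\lambda_jt}\langle\varphi,\varphi_j\rangle\varphi_j$ and $\psi_1(t)=e^{-i\lambda_1t}\varphi_1$. Let $H^s_{(0)}=D(A^{s/2})$ be the space of $\varphi\in L^2(0,1)$ with $\|\varphi\|_{H^s_{(0)}}:=\big(\sum_{j\ge1}|j^s\langle\varphi,\varphi_j\rangle|^2\big)^{1/2}<\infty$. For $J\subset\mathbb N^*$ let $\mathcal H_J$ be the closed complex span of $\{\varphi_j: j\in J\}$ in $L^2(0,1)$ and $\mathbb P_J$ the orthogonal projection on $\mathcal H_J$. For $\psi\in\mathcal S$ let $T_{\mathcal S}\psi=\{\xi\in L^2(0,1):\operatorname{Re}\langle\xi,\psi\rangle=0\}$ and $\Pi_\psi\xi=\xi-\operatorname{Re}\langle\xi,\psi\rangle\psi$.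 Let $H^k_0=H^k_0((0,T),\mathbb R)$ be the closure of $C_c^\infty(0,T)$ in $H^k((0,T),\mathbb R)$, with the $H^k$ norm. Let $T>0$, $p,k\in\mathbb N$, $J\subset\mathbb N^*$, and let $\mu\in H^{2(p+k)+3}((0,1),\mathbb R)$ satisfy $\mu^{(2n+1)}(0)=\mu^{(2n+1)}(1)=0$ for $n=0,\dots,p-1$. For a source $f$ and initial datum $\psi_0$, a (weak) solution of $$i\partial_t\psi=-\partial_x^2\psi-u(t)\mu(x)\psi-f(t,x),\qquad \psi(t,0)=\psi(t,1)=0,\qquad \psi(0)=\psi_0$$ is a function $\psi\in C^k([0,T],H^{2p+3}_{(0)})$ such that $\psi(t)=e^{-iAt}\psi_0+i\int_0^te^{-iA(t-\tau)}\big(u(\tau)\mu\psi(\tau)+f(\tau)\big)d\tau$ for all $t\in[0,T]$. Then for every $(\psi_0,u)\in H^{2(p+k)+3}_{(0)}\times H^k_0$ the equation with $f=0$ has a unique solution $\psi=\psi(\cdot;u,\psi_0)$, and $\psi(T)\in H^{2(p+k)+3}_{(0)}$. The end-point map $$\Theta_T:\ (\psi_0,u)\mapsto\big(\psi_0,\ \Pi_{\psi_1(T)}\mathbb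 P_J[\psi(T;u,\psi_0)]\big)$$ is well defined and $C^1$, as a map of real normed spaces, from $H^{2(p+k)+3}_{(0)}\times H^k_0$ to $H^{2(p+k)+3}_{(0)}\times\big[T_{\mathcal S}\psi_1(T)\cap\mathcal H_J\cap H^{2(p+k)+3}_{(0)}\big]$ (the second factor carrying the norm of $H^{2(p+k)+3}_{(0)}$), and it maps $(\mathcal S\cap H^{2(p+k)+3}_{(0)})\times H^k_0$ into $(\mathcal S\cap H^{2(p+k)+3}_{(0)})\times\big[T_{\mathcal S}\psi_1(T)\cap\mathcal H_J\cap H^{2(p+k)+3}_{(0)}\big]$. In particular its restriction to $(\mathcal S\cap H^{2(p+k)+3}_{(0)})\times H^k_0$ is $C^1$. Moreover, for all $(\psi_0,u)$ and $(\Psi_0,v)$ in $H^{2(p+k)+3}_{(0)}\times H^k_0$, $$d\Theta_T(\psi_0,u).(\Psi_0,v)=\big(\Psi_0,\ \Pi_{\psi_1(T)}\mathbb P_J[\Psi(T)]\big),$$ where $\Psi$ is the unique solution of the linearized equation $$i\partial_t\Psi=-\partial_x^2\Psi-u(t)\mu(x)\Psi-v(t)\mu(x)\psi(t;u,\psi_0),\qquad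 \Psi(t,0)=\Psi(t,1)=0,\qquad \Psi(0)=\Psi_0.$$ -/

import Mathlib

open Set MeasureTheory
open scoped ContDiff ENNReal Topology

namespace BilinearSchrodinger

noncomputable section

/-! ### The space `L²(0,1)` and the eigenfunctions of the Dirichlet Laplacian -/

/-- `L²((0,1), ℂ)`. Mathlib's inner product `inner ℂ f g = ∫ conj f * g` is linear in the second
argument, so `⟨f, g⟩` of the text (linear in the first argument) is `inner ℂ g f` here. -/
abbrev L2 : Type := Lp ℂ 2 (volume.restrict (Ioo (0 : ℝ) 1))

/-- The function `x ↦ √2 sin (j π x)`. -/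
def sinFun (j : ℕ+) (x : ℝ) : ℂ := ((√2 * Real.sin ((j : ℕ) * Real.pi * x) : ℝ) : ℂ)

theorem sinFun_memLp (j : ℕ+) : MemLp (sinFun j) 2 (volume.restrict (Ioo (0 : ℝ) 1)) := by
  refine MemLp.of_bound (C := √2) ?_ ?_
  · refine Continuous.aestronglyMeasurable ?_
    unfold sinFun
    fun_prop
  · refine Filter.Eventually.of_forall fun x => ?_
    simp only [sinFun, Complex.norm_real, Real.norm_eq_abs, abs_mul]
    rw [abs_of_nonneg (Real.sqrt_nonneg 2)]
    nlinarith [Real.abs_sin_le_one ((j : ℕ) * Real.pi * x), Real.sqrt_nonneg 2]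

/-- The eigenfunction `φ_j = √2 sin (j π ·)` of `A = -d²/dx²` with Dirichlet conditions. -/
def eigenfun (j : ℕ+) : L2 := (sinFun_memLp j).toLp (sinFun j)

/-- The eigenvalue `λ_j = (j π)²`. -/
def eigenval (j : ℕ+) : ℝ := ((j : ℕ) * Real.pi) ^ 2

theorem inner_eigenfun (j : ℕ+) (f : L2) :
    inner ℂ (eigenfun j) f
      = ∫ x in Ioo (0 : ℝ) 1, ((√2 * Real.sin ((j : ℕ) * Real.pi * x) : ℝ) : ℂ) * f x := by
  rw [L2.inner_def]
  refine integral_congr_ae ?_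
  filter_upwards [(sinFun_memLp j).coeFn_toLp] with x hx
  have hx' : (eigenfun j : ℝ → ℂ) x = sinFun j x := hx
  rw [hx', RCLike.inner_apply, sinFun, Complex.conj_ofReal, mul_comm]

/-- Completeness of the sine family, which makes the `H^s_(0)` norms below definite. -/
theorem eq_zero_of_inner_eigenfun (f : L2) (h : ∀ j, inner ℂ (eigenfun j) f = 0) : f = 0 := by
  set ν := volume.restrict (Ioo (0 : ℝ) 1) with hν
  have hfi : Integrable (fun x => f x) ν := (Lp.memLp f).integrable (by norm_num)
  have hint : ∀ c : ℝ → ℝ, Continuous c → Integrable (fun x => ((c x : ℝ) : ℂ) * f x) ν := by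
    intro c hc
    obtain ⟨C, hC⟩ := (isCompact_Icc (a := (0 : ℝ)) (b := 1)).exists_bound_of_continuousOn
      hc.continuousOn
    refine hfi.bdd_mul (c := C) (by fun_prop) ?_
    rw [hν]
    refine (ae_restrict_mem measurableSet_Ioo).mono fun x hx => ?_
    rw [Complex.norm_real]
    exact hC x (Ioo_subset_Icc_self hx)
  have h0 : ∀ j : ℕ, ∫ x, ((Real.sin (j * Real.pi * x) : ℝ) : ℂ) * f x ∂ν = 0 := by
    intro j
    rcases Nat.eq_zero_or_pos j with rfl | hj
    · simp
    · have := (inner_eigenfun ⟨j, hj⟩ f).symm.trans (h ⟨j, hj⟩)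
      have h2 : ∀ x, ((√2 * Real.sin ((((⟨j, hj⟩ : ℕ+) : ℕ) : ℝ) * Real.pi * x) : ℝ) : ℂ) * f x
          = ((√2 : ℝ) : ℂ) * (((Real.sin (j * Real.pi * x) : ℝ) : ℂ) * f x) := by
        intro x; push_cast [PNat.mk_coe]; ring
      have h2' := (integral_congr_ae (μ := ν) (Filter.Eventually.of_forall h2)).symm.trans this
      rw [integral_const_mul] at h2'
      rcases mul_eq_zero.1 h2' with h3 | h3
      · exact absurd h3 (by simp)
      · exact h3
  have h1 : ∀ n j : ℕ, ∫ x, ((Real.sin (j * Real.pi * x) * Real.cos (Real.pi * x) ^ n : ℝ) : ℂ)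
      * f x ∂ν = 0 := by
    intro n
    induction n with
    | zero => intro j; simpa using h0 j
    | succ n ih =>
      intro j
      rcases Nat.eq_zero_or_pos j with rfl | hj
      · simp
      · obtain ⟨m, rfl⟩ : ∃ m, j = m + 1 := ⟨j - 1, by omega⟩
        have e : ∀ x : ℝ, ((Real.sin (((m + 1 : ℕ) : ℝ) * Real.pi * x)
              * Real.cos (Real.pi * x) ^ (n + 1) : ℝ) : ℂ) * f x
            = (1 / 2 : ℂ) * (((Real.sin (((m + 2 : ℕ) : ℝ) * Real.pi * x)
                * Real.cos (Real.pi * x) ^ n : ℝ) : ℂ) * f x)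
              + (1 / 2 : ℂ) * (((Real.sin ((m : ℝ) * Real.pi * x)
                * Real.cos (Real.pi * x) ^ n : ℝ) : ℂ) * f x) := by
          intro x
          have e1 : Real.sin (((m + 1 : ℕ) : ℝ) * Real.pi * x) * Real.cos (Real.pi * x)
              = (1 / 2) * Real.sin (((m + 2 : ℕ) : ℝ) * Real.pi * x)
                + (1 / 2) * Real.sin ((m : ℝ) * Real.pi * x) := by
            have a1 : ((m + 2 : ℕ) : ℝ) * Real.pi * x
                = ((m + 1 : ℕ) : ℝ) * Real.pi * x + Real.pi * x := by push_cast; ring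
            have a2 : (m : ℝ) * Real.pi * x
                = ((m + 1 : ℕ) : ℝ) * Real.pi * x - Real.pi * x := by push_cast; ring
            rw [a1, a2, Real.sin_add, Real.sin_sub]; ring
          have e2 : Real.sin (((m + 1 : ℕ) : ℝ) * Real.pi * x) * Real.cos (Real.pi * x) ^ (n + 1)
              = (1 / 2) * (Real.sin (((m + 2 : ℕ) : ℝ) * Real.pi * x) * Real.cos (Real.pi * x) ^ n)
                + (1 / 2) * (Real.sin ((m : ℝ) * Real.pi * x) * Real.cos (Real.pi * x) ^ n) := by
            rw [pow_succ']
            linear_combination (Real.cos (Real.pi * x) ^ n) * e1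
          rw [e2]; push_cast; ring
        simp only [e]
        rw [integral_add, integral_const_mul, integral_const_mul, ih (m + 2), ih m]
        · simp
        · exact (hint _ (by fun_prop)).const_mul _
        · exact (hint _ (by fun_prop)).const_mul _
  have h2 : ∀ P : Polynomial ℝ,
      ∫ x, ((Real.sin (Real.pi * x) * P.eval (Real.cos (Real.pi * x)) : ℝ) : ℂ) * f x ∂ν = 0 := by
    intro P
    induction P using Polynomial.induction_on' with
    | add P Q hP hQ =>
      have e : ∀ x : ℝ, ((Real.sin (Real.pi * x) * (P + Q).eval (Real.cos (Real.pi * x)) : ℝ) : ℂ)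
          * f x = ((Real.sin (Real.pi * x) * P.eval (Real.cos (Real.pi * x)) : ℝ) : ℂ) * f x
            + ((Real.sin (Real.pi * x) * Q.eval (Real.cos (Real.pi * x)) : ℝ) : ℂ) * f x := by
        intro x; rw [Polynomial.eval_add]; push_cast; ring
      simp only [e]
      rw [integral_add, hP, hQ, add_zero]
      · exact hint _ (by fun_prop)
      · exact hint _ (by fun_prop)
    | monomial n a =>
      have e : ∀ x : ℝ, ((Real.sin (Real.pi * x)
          * (Polynomial.monomial n a).eval (Real.cos (Real.pi * x)) : ℝ) : ℂ) * f x
          = (a : ℂ) * (((Real.sin (((1 : ℕ) : ℝ) * Real.pi * x)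
              * Real.cos (Real.pi * x) ^ n : ℝ) : ℂ) * f x) := by
        intro x; rw [Polynomial.eval_monomial]; push_cast; ring_nf
      simp only [e]
      rw [integral_const_mul, h1 n 1, mul_zero]
  have h3 : ∀ c : ℝ → ℝ, Continuous c →
      ∫ x, ((c x : ℝ) : ℂ) * (((Real.sin (Real.pi * x) : ℝ) : ℂ) * f x) ∂ν = 0 := by
    intro c hc
    have hgi : Integrable (fun x => ((Real.sin (Real.pi * x) : ℝ) : ℂ) * f x) ν :=
      hint _ (by fun_prop)
    have hM : 0 ≤ ∫ x, ‖((Real.sin (Real.pi * x) : ℝ) : ℂ) * f x‖ ∂ν :=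
      integral_nonneg fun _ => norm_nonneg _
    set M := ∫ x, ‖((Real.sin (Real.pi * x) : ℝ) : ℂ) * f x‖ ∂ν with hMdef
    rw [← norm_le_zero_iff]
    refine le_of_forall_pos_le_add fun ε hε => ?_
    obtain ⟨P, hP⟩ := exists_polynomial_near_of_continuousOn (-1) 1
      (fun y => c (Real.arccos y / Real.pi))
      (by
        refine Continuous.continuousOn ?_
        exact hc.comp (Real.continuous_arccos.div_const _)) (ε / (M + 1)) (by positivity)
    have hi1 : Integrable (fun x => ((c x : ℝ) : ℂ)
        * (((Real.sin (Real.pi * x) : ℝ) : ℂ) * f x)) ν := by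
      have := hint (fun x => c x * Real.sin (Real.pi * x)) (by fun_prop)
      refine this.congr (Filter.Eventually.of_forall fun x => ?_)
      simp only; push_cast; ring
    have hi2 := hint (fun x => Real.sin (Real.pi * x) * P.eval (Real.cos (Real.pi * x)))
      (by fun_prop)
    have : ∫ x, ((c x : ℝ) : ℂ) * (((Real.sin (Real.pi * x) : ℝ) : ℂ) * f x) ∂ν
        = ∫ x, (((c x : ℝ) : ℂ) * (((Real.sin (Real.pi * x) : ℝ) : ℂ) * f x)
          - ((Real.sin (Real.pi * x) * P.eval (Real.cos (Real.pi * x)) : ℝ) : ℂ) * f x) ∂ν := by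
      rw [integral_sub hi1 hi2, h2 P, sub_zero]
    rw [this, zero_add]
    calc _ ≤ ∫ x, (ε / (M + 1)) * ‖((Real.sin (Real.pi * x) : ℝ) : ℂ) * f x‖ ∂ν := by
          refine norm_integral_le_of_norm_le (hgi.norm.const_mul _) ?_
          rw [hν]
          refine (ae_restrict_mem measurableSet_Ioo).mono fun x hx => ?_
          have hx1 : Real.arccos (Real.cos (Real.pi * x)) / Real.pi = x := by
            rw [Real.arccos_cos (by have := hx.1; positivity)
              (by nlinarith [hx.2, Real.pi_pos])]
            field_simp
          have hb := hP (Real.cos (Real.pi * x)) ⟨Real.neg_one_le_cos _, Real.cos_le_one _⟩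
          simp only [hx1] at hb
          have e : ((c x : ℝ) : ℂ) * (((Real.sin (Real.pi * x) : ℝ) : ℂ) * f x)
              - ((Real.sin (Real.pi * x) * P.eval (Real.cos (Real.pi * x)) : ℝ) : ℂ) * f x
              = ((c x - P.eval (Real.cos (Real.pi * x)) : ℝ) : ℂ)
                * (((Real.sin (Real.pi * x) : ℝ) : ℂ) * f x) := by push_cast; ring
          rw [e, norm_mul, Complex.norm_real, Real.norm_eq_abs, abs_sub_comm]
          exact mul_le_mul_of_nonneg_right hb.le (norm_nonneg _)
      _ = ε / (M + 1) * M := by rw [integral_const_mul]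
      _ ≤ ε := by
          rw [div_mul_eq_mul_div, div_le_iff₀ (by positivity)]
          nlinarith
  have hloc : LocallyIntegrableOn (fun x => ((Real.sin (Real.pi * x) : ℝ) : ℂ) * f x)
      (Ioo (0 : ℝ) 1) volume := by
    have : IntegrableOn (fun x => ((Real.sin (Real.pi * x) : ℝ) : ℂ) * f x)
      (Ioo (0 : ℝ) 1) volume := hint _ (by fun_prop)
    exact this.locallyIntegrableOn
  have h4 := isOpen_Ioo.ae_eq_zero_of_integral_contDiff_smul_eq_zero hloc (by
    intro g hg _ hgs
    have e : ∀ x, g x • (((Real.sin (Real.pi * x) : ℝ) : ℂ) * f x)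
        = ((g x : ℝ) : ℂ) * (((Real.sin (Real.pi * x) : ℝ) : ℂ) * f x) := fun x => by
      rw [Complex.real_smul]
    rw [← h3 g hg.continuous]
    simp only [e]
    rw [hν]
    symm
    refine setIntegral_eq_integral_of_forall_compl_eq_zero fun x hx => ?_
    rw [image_eq_zero_of_notMem_tsupport fun hxs => hx (hgs hxs)]
    simp)
  rw [Lp.eq_zero_iff_ae_eq_zero]
  filter_upwards [(ae_restrict_iff' measurableSet_Ioo).2 h4,
    ae_restrict_mem measurableSet_Ioo] with x hx hx1
  rcases mul_eq_zero.1 hx with h5 | h5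
  · exfalso
    have : 0 < Real.sin (Real.pi * x) := Real.sin_pos_of_pos_of_lt_pi
      (by have := hx1.1; positivity) (by nlinarith [hx1.2, Real.pi_pos])
    exact this.ne' (by exact_mod_cast h5)
  · exact h5

/-! ### The spaces `H^s_(0)(0,1) = D(A^{s/2})` -/

/-- The sequence `(j^s ⟨φ, φ_j⟩)_{j ≥ 1}`. -/
def weightedCoeff (s : ℕ) (φ : L2) : ℕ+ → ℂ :=
  fun j => (((j : ℕ) : ℂ) ^ s) * inner ℂ (eigenfun j) φ

/-- The elements `φ` of `L²(0,1)` with `∑_j |j^s ⟨φ, φ_j⟩|² < ∞`. -/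
def hZeroSubmodule (s : ℕ) : Submodule ℂ L2 where
  carrier := {φ | Memℓp (weightedCoeff s φ) 2}
  zero_mem' := by
    have : weightedCoeff s 0 = 0 := by funext j; simp [weightedCoeff]
    simp only [mem_ofPred_eq, this]
    exact zero_memℓp
  add_mem' := by
    intro a b ha hb
    have : weightedCoeff s (a + b) = weightedCoeff s a + weightedCoeff s b := by
      funext j; simp [weightedCoeff, inner_add_right, mul_add]
    simp only [mem_ofPred_eq, this] at *
    exact ha.add hb
  smul_mem' := by
    intro c a ha
    have : weightedCoeff s (c • a) = c • weightedCoeff s a := by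
      funext j; simp [weightedCoeff, inner_smul_right, mul_left_comm]
    simp only [mem_ofPred_eq, this] at *
    exact ha.const_smul c

/-- The space `H^s_(0)(0,1) = D(A^{s/2})`. It is a type of its own, because its norm is not the
`L²` norm. -/
def HZero (s : ℕ) : Type := hZeroSubmodule s

namespace HZero

variable {s : ℕ}

instance : AddCommGroup (HZero s) := inferInstanceAs (AddCommGroup (hZeroSubmodule s))

instance : Module ℂ (HZero s) := inferInstanceAs (Module ℂ (hZeroSubmodule s))

/-- The inclusion `H^s_(0) → L²`. -/
def incl (s : ℕ) : HZero s →ₗ[ℂ] L2 := (hZeroSubmodule s).subtype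

instance : CoeOut (HZero s) L2 := ⟨fun φ => incl s φ⟩

/-- The map `φ ↦ (j^s ⟨φ, φ_j⟩)_{j ≥ 1}` from `H^s_(0)` to `ℓ²`. -/
def toSeq (s : ℕ) : HZero s →ₗ[ℂ] lp (fun _ : ℕ+ => ℂ) 2 where
  toFun φ := ⟨weightedCoeff s (incl s φ), φ.2⟩
  map_add' a b := by
    ext j
    change weightedCoeff s (incl s (a + b)) j
      = weightedCoeff s (incl s a) j + weightedCoeff s (incl s b) j
    simp [weightedCoeff, inner_add_right, mul_add]
  map_smul' c a := by
    ext j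
    change weightedCoeff s (incl s (c • a)) j = c • weightedCoeff s (incl s a) j
    simp [weightedCoeff, inner_smul_right, mul_left_comm]

theorem toSeq_injective (s : ℕ) : Function.Injective (toSeq s) := by
  rw [← LinearMap.ker_eq_bot, LinearMap.ker_eq_bot']
  intro φ hφ
  have : (φ.1 : L2) = 0 := by
    refine eq_zero_of_inner_eigenfun _ fun j => ?_
    have h1 : (toSeq s φ : ℕ+ → ℂ) j = 0 := by rw [hφ]; rfl
    have h2 : (((j : ℕ) : ℂ) ^ s) * inner ℂ (eigenfun j) (φ.1 : L2) = 0 := h1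
    rcases mul_eq_zero.1 h2 with h3 | h3
    · exact absurd h3 (pow_ne_zero _ (by exact_mod_cast j.ne_zero))
    · exact h3
  exact Subtype.ext this

/-- The norm `‖φ‖ = (∑_j |j^s ⟨φ, φ_j⟩|²)^{1/2}`, see `norm_eq`. -/
instance : NormedAddCommGroup (HZero s) :=
  NormedAddCommGroup.induced (HZero s) (lp (fun _ : ℕ+ => ℂ) 2) (toSeq s) (toSeq_injective s)

instance : NormedSpace ℂ (HZero s) :=
  NormedSpace.induced ℂ (HZero s) (lp (fun _ : ℕ+ => ℂ) 2) (toSeq s)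

theorem norm_eq (φ : HZero s) :
    ‖φ‖ = √(∑' j : ℕ+, ‖(((j : ℕ) : ℂ) ^ s) * inner ℂ (eigenfun j) (φ : L2)‖ ^ 2) := by
  have h1 : ‖φ‖ = ‖toSeq s φ‖ := rfl
  have h2 : ∀ j, (toSeq s φ : ℕ+ → ℂ) j = (((j : ℕ) : ℂ) ^ s) * inner ℂ (eigenfun j) (φ : L2) :=
    fun _ => rfl
  rw [h1, lp.norm_eq_tsum_rpow (by norm_num), Real.sqrt_eq_rpow]
  simp [h2]

end HZero

/-! ### Sobolev regularity of the dipolar moment on `(0,1)` -/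

/-- Smooth real functions with compact support inside `(a,b)`. -/
def IsTestFun (a b : ℝ) (θ : ℝ → ℝ) : Prop :=
  ContDiff ℝ ∞ θ ∧ HasCompactSupport θ ∧ tsupport θ ⊆ Ioo a b

/-- `g` is the weak derivative of order `n` of `f` on `(0,1)`. It is used below for functions that
are integrable on `(0,1)`. -/
def IsWeakDeriv (n : ℕ) (f g : ℝ → ℝ) : Prop :=
  ∀ θ : ℝ → ℝ, IsTestFun 0 1 θ →
    ∫ x in Ioo (0 : ℝ) 1, f x * iteratedDeriv n θ x
      = (-1) ^ n * ∫ x in Ioo (0 : ℝ) 1, g x * θ x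

/-- `f ∈ H^m((0,1), ℝ)`: the weak derivatives of orders `0, …, m` exist in `L²(0,1)`. -/
def MemSobolev (m : ℕ) (f : ℝ → ℝ) : Prop :=
  MemLp f 2 (volume.restrict (Ioo (0 : ℝ) 1)) ∧
    ∀ n ≤ m, ∃ g : ℝ → ℝ, MemLp g 2 (volume.restrict (Ioo (0 : ℝ) 1)) ∧ IsWeakDeriv n f g

/-- `f^{(n)}(0) = f^{(n)}(1) = 0`: the weak derivative of order `n` has a representative that is
continuous on `[0,1]`, and this (unique) representative vanishes at `0` and `1`. -/
def DerivVanishesAtEnds (n : ℕ) (f : ℝ → ℝ) : Prop :=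
  ∃ g : ℝ → ℝ, ContinuousOn g (Icc 0 1) ∧ IsWeakDeriv n f g ∧ g 0 = 0 ∧ g 1 = 0

/-! ### The space of controls `H^k_0((0,T), ℝ)` -/

/-- `L²((0,T), ℝ)^{k+1}` with the Hilbert norm `(∑_{n ≤ k} ‖w_n‖²)^{1/2}`. A function `u` of
`H^k(0,T)` is identified with `(u, u', …, u^{(k)})`, so the norm is the usual `H^k` norm. -/
abbrev JetL2 (T : ℝ) (k : ℕ) : Type :=
  PiLp 2 (fun _ : Fin (k + 1) => Lp ℝ 2 (volume.restrict (Ioo (0 : ℝ) T)))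

/-- The elements `(θ, θ', …, θ^{(k)})` with `θ` in `C_c^∞(0,T)`. -/
def testJets (T : ℝ) (k : ℕ) : Submodule ℝ (JetL2 T k) where
  carrier := {w | ∃ θ : ℝ → ℝ, IsTestFun 0 T θ ∧
    ∀ n : Fin (k + 1), w n =ᵐ[volume.restrict (Ioo (0 : ℝ) T)] iteratedDeriv n θ}
  zero_mem' := by
    refine ⟨0, ⟨contDiff_const, HasCompactSupport.zero, by simp [tsupport]⟩, fun n => ?_⟩
    have : iteratedDeriv (n : ℕ) (0 : ℝ → ℝ) = 0 := by
      funext x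
      simp
    rw [this]
    exact Lp.coeFn_zero _ _ _
  add_mem' := by
    rintro a b ⟨θ, ⟨h1, h2, h3⟩, h4⟩ ⟨η, ⟨k1, k2, k3⟩, k4⟩
    refine ⟨θ + η, ⟨h1.add k1, h2.add k2, (tsupport_add θ η).trans (union_subset h3 k3)⟩,
      fun n => ?_⟩
    have e : iteratedDeriv (n : ℕ) (θ + η) = iteratedDeriv n θ + iteratedDeriv n η := by
      funext x
      exact iteratedDeriv_add (h1.contDiffAt.of_le (by exact_mod_cast le_top))
        (k1.contDiffAt.of_le (by exact_mod_cast le_top))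
    rw [e]
    exact (Lp.coeFn_add (a n) (b n)).trans ((h4 n).add (k4 n))
  smul_mem' := by
    rintro c a ⟨θ, ⟨h1, h2, h3⟩, h4⟩
    refine ⟨c • θ, ⟨contDiff_const.smul h1, h2.smul_left (f := fun _ => c),
      (tsupport_smul_subset_right (fun _ => c) θ).trans h3⟩, fun n => ?_⟩
    have e : iteratedDeriv (n : ℕ) (c • θ) = c • iteratedDeriv n θ := by
      funext x
      exact iteratedDeriv_const_smul_field c θ
    rw [e]
    exact (Lp.coeFn_smul c (a n)).trans ((h4 n).const_smul c)

/-- `H^k_0((0,T), ℝ)`: the closure of `C_c^∞(0,T)` for the `H^k` norm. -/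
abbrev HkZero (T : ℝ) (k : ℕ) : Type := (testJets T k).topologicalClosure

/-- The real function on `(0,T)` underlying an element of `H^k_0(0,T)`. -/
def HkZero.toFun {T : ℝ} {k : ℕ} (u : HkZero T k) : ℝ → ℝ := ((u : JetL2 T k) 0 : ℝ → ℝ)

/-! ### The Schrödinger equation -/

/-- The group `e^{-iAt}` on `L²(0,1)`: `e^{-iAt} φ = ∑_j e^{-i λ_j t} ⟨φ, φ_j⟩ φ_j`. -/
def freeGroup (t : ℝ) (φ : L2) : L2 :=
  ∑' j : ℕ+, (Complex.exp (-(Complex.I * eigenval j * t)) * inner ℂ (eigenfun j) φ) • eigenfun j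

open Classical in
/-- The product `μ φ` in `L²(0,1)`; it is in `L²(0,1)` for every `φ` as soon as `μ` is essentially
bounded, in particular for `μ ∈ H^m(0,1)` with `m ≥ 1`. -/
def mulL2 (μ : ℝ → ℝ) (φ : L2) : L2 :=
  if h : MemLp (fun x => (μ x : ℂ) * φ x) 2 (volume.restrict (Ioo (0 : ℝ) 1)) then h.toLp _ else 0

/-- `ψ ∈ C^k([0,T], H^r_(0))` is a weak solution on `[0,T]` of
`i ∂_t ψ = -∂_x² ψ - u(t) μ(x) ψ - f(t,x)` with Dirichlet conditions and `ψ(0) = ψ₀`. The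
integral is a Bochner integral in `L²(0,1)`. -/
def IsWeakSolution (T : ℝ) (k r : ℕ) (μ u : ℝ → ℝ) (f : ℝ → L2) (ψ₀ : L2) (ψ : ℝ → HZero r) :
    Prop :=
  ContDiffOn ℝ k ψ (Icc 0 T) ∧
    ∀ t ∈ Icc 0 T, (ψ t : L2) = freeGroup t ψ₀ +
      Complex.I • ∫ τ in (0 : ℝ)..t, freeGroup (t - τ) ((u τ : ℂ) • mulL2 μ (ψ τ) + f τ)

/-- Weak solutions of `i ∂_t ψ = -∂_x² ψ - u μ ψ`, `ψ(0) = ψ₀`, in `C^k([0,T], H^{2p+3}_(0))`. -/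
def IsSolution (T : ℝ) (p k : ℕ) (μ : ℝ → ℝ) (ψ₀ : HZero (2 * (p + k) + 3)) (u : HkZero T k)
    (ψ : ℝ → HZero (2 * p + 3)) : Prop :=
  IsWeakSolution T k (2 * p + 3) μ u.toFun (fun _ => 0) ψ₀ ψ

/-- Weak solutions of the equation linearized along `(u, ψ)`:
`i ∂_t Ψ = -∂_x² Ψ - u μ Ψ - v μ ψ`, `Ψ(0) = Ψ₀`, in `C^k([0,T], H^{2p+3}_(0))`. -/
def IsLinearizedSolution (T : ℝ) (p k : ℕ) (μ : ℝ → ℝ) (u : HkZero T k)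
    (ψ : ℝ → HZero (2 * p + 3)) (Ψ₀ : HZero (2 * (p + k) + 3)) (v : HkZero T k)
    (Ψ : ℝ → HZero (2 * p + 3)) : Prop :=
  IsWeakSolution T k (2 * p + 3) μ u.toFun (fun t => (v.toFun t : ℂ) • mulL2 μ (ψ t)) Ψ₀ Ψ

/-! ### The projections and the end-point map -/

/-- The ground state `ψ₁(t) = e^{-i λ₁ t} φ₁`. -/
def groundState (t : ℝ) : L2 := Complex.exp (-(Complex.I * eigenval 1 * t)) • eigenfun 1

/-- `H_J`, the closed complex span of the `φ_j`, `j ∈ J`. -/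
def spanJ (J : Set ℕ+) : Submodule ℂ L2 := (Submodule.span ℂ (eigenfun '' J)).topologicalClosure

instance (J : Set ℕ+) : CompleteSpace (spanJ J) :=
  inferInstanceAs (CompleteSpace (Submodule.span ℂ (eigenfun '' J)).topologicalClosure)

/-- `P_J`, the orthogonal projection of `L²(0,1)` on `H_J`. -/
def projJ (J : Set ℕ+) : L2 →L[ℂ] L2 := (spanJ J).starProjection

/-- `Π_ψ ξ = ξ - Re ⟨ξ, ψ⟩ ψ`, the projection on the tangent space at `ψ` of the unit sphere. -/
def tangentProj (ψ ξ : L2) : L2 := ξ - (((inner ℂ ψ ξ).re : ℝ) : ℂ) • ψ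

/-- `S ∩ H^s_(0)`, with `S` the unit sphere of `L²(0,1)`. -/
def unitSphere (s : ℕ) : Set (HZero s) := {φ | ‖(φ : L2)‖ = 1}

/-- `T_S ψ₁(T) ∩ H_J ∩ H^s_(0)`, a real subspace of `H^s_(0)` (with the norm of `H^s_(0)`). -/
def targetSpace (T : ℝ) (J : Set ℕ+) (s : ℕ) : Submodule ℝ (HZero s) where
  carrier := {w | (inner ℂ (groundState T) (w : L2)).re = 0 ∧ (w : L2) ∈ spanJ J}
  zero_mem' := by simp
  add_mem' := by
    rintro a b ⟨h1, h2⟩ ⟨k1, k2⟩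
    refine ⟨?_, ?_⟩
    · rw [map_add, inner_add_right, Complex.add_re, h1, k1, add_zero]
    · rw [map_add]; exact add_mem h2 k2
  smul_mem' := by
    rintro c a ⟨h1, h2⟩
    have e : (HZero.incl s (c • a)) = (c : ℂ) • HZero.incl s a :=
      (HZero.incl s).map_smul (c : ℂ) a
    refine ⟨?_, ?_⟩
    · rw [e, inner_smul_right, Complex.re_ofReal_mul, h1, mul_zero]
    · rw [e]; exact (spanJ J).smul_mem _ h2

open Classical in
/-- The solution `ψ(·; u, ψ₀)` (and `0` if there were none). -/
def solution (T : ℝ) (p k : ℕ) (μ : ℝ → ℝ) (ψ₀ : HZero (2 * (p + k) + 3)) (u : HkZero T k) :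
    ℝ → HZero (2 * p + 3) :=
  if h : ∃ ψ, IsSolution T p k μ ψ₀ u ψ then h.choose else 0

open Classical in
/-- The projected end-point map `Θ_T : (ψ₀, u) ↦ (ψ₀, Π_{ψ₁(T)} P_J ψ(T; u, ψ₀))`, on the whole of
`H^{2(p+k)+3}_(0) × H^k_0`. The second component is the element of
`T_S ψ₁(T) ∩ H_J ∩ H^{2(p+k)+3}_(0)` whose underlying function is `Π_{ψ₁(T)} P_J ψ(T; u, ψ₀)` (and
`0` if there were none). -/
def endPointMap (T : ℝ) (p k : ℕ) (J : Set ℕ+) (μ : ℝ → ℝ)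
    (x : HZero (2 * (p + k) + 3) × HkZero T k) :
    HZero (2 * (p + k) + 3) × targetSpace T J (2 * (p + k) + 3) :=
  (x.1, if h : ∃ w : targetSpace T J (2 * (p + k) + 3),
      ((w : HZero (2 * (p + k) + 3)) : L2)
        = tangentProj (groundState T) (projJ J (solution T p k μ x.1 x.2 T))
    then h.choose else 0)

end

end BilinearSchrodinger

/-! Write `s = 2p+3`. The Cauchy problem is the fixed point equation `y = e^{-iAt} ψ₀ + K(u) y` with
`K(u) y (t) = i ∫₀ᵗ e^{-iA(t-τ)} u(τ) μ y(τ) dτ`. The proof makes it a linear equation in a space of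
jets in time, whose solution is an operator inverse applied to the data.

Smoothing. Multiplication by `μ` does not preserve `H^s_(0)`: the derivative of order `2p+1` of `μ`
need not vanish at the ends. Integration by parts shows that `j^s ⟨μφ, φ_j⟩` is a square summable
sequence plus `b(φ) + (-1)^j c(φ)`, where `b` and `c` are continuous functionals proportional to
`φ'(0)` and `φ'(1)` (`exists_mul_decomposition`). The time integral repairs this defect. The phases
`e^{iλ_jτ}` are orthogonal on intervals whose length is a multiple of `2/π`, so by Bessel's
inequality `∫ e^{iλ_jτ} u b(y) dτ` is square summable in `j` (`exists_bessel_phase`). Hence `K` is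
bounded bilinear from `L²(0,T) × C([0,T], H^s_(0))` to `C([0,T], H^s_(0))`, with a Volterra estimate
(`IsSmoothing.exists_duhamel`).

Jets. If `u` is a test function, `K(u) y` is differentiated by Leibniz' rule: its derivative is
`K(u') y + K(u) y'`. So the jet `(y, y', …, y^{(k)})` should solve `Y = S ψ₀ + A(U) Y`, where `S ψ₀`
is the jet of the free solution and `A(U)` is linear and bounded in `U = (u, …, u^{(k)})`. The
Volterra estimate gives `‖A(U)^N‖² ≤ R^N / N!`, so `1 - A(U)` is invertible for every `U`
(`jetOperator_isUnit`).

Compatibility. Jets with `y_n' = y_{n+1}` and `y_{n+1}(T) = -iA y_n(T)` form a closed subspace. It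
contains `S ψ₀` and is preserved by `A(U)` when `u` is a test function, because all derivatives of
`u` vanish at `0` and `T`; by density it is preserved for all `u` in `H^k_0` (`jetOperator_mem`).
The solution therefore lies in it, and its component of index `0` is `C^k`. Moreover `y_k(T) =
(-iA)^k y_0(T)` with `y_k(T)` in `H^s_(0)`, so `y_0(T) = (-iA)^{-k} y_k(T)` lies in `H^{s+2k}_(0)`
and depends continuously and linearly on the jet (`Evolution.final`).

Conclusion. The second component of `Θ_T` is a continuous linear map applied to `(1 - A(U))⁻¹ S ψ₀`,
which is `C¹` because inversion is smooth on units. Differentiating the fixed point equation gives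
`dY = S Ψ₀ + A(V) Y + A(U) dY`, the jet form of the linearized equation. -/

namespace BilinearSchrodinger

/-! ### The Hilbert basis of eigenfunctions -/

theorem integral_cos_int_mul_pi (n : ℤ) :
    ∫ x in (0 : ℝ)..1, Real.cos (n * Real.pi * x) = if n = 0 then 1 else 0 := by
  split_ifs with h
  · simp [h]
  · have hc : (n * Real.pi : ℝ) ≠ 0 := mul_ne_zero (by exact_mod_cast h) Real.pi_ne_zero
    rw [intervalIntegral.integral_comp_mul_left (fun y => Real.cos y) hc]
    simp [Real.sin_int_mul_pi]

theorem inner_eigenfun_eigenfun (i j : ℕ+) :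
    inner ℂ (eigenfun i) (eigenfun j) = if i = j then 1 else 0 := by
  rw [inner_eigenfun]
  have h1 : ∫ x in Ioo (0 : ℝ) 1,
      ((√2 * Real.sin ((i : ℕ) * Real.pi * x) : ℝ) : ℂ) * (eigenfun j : ℝ → ℂ) x
      = ∫ x in Ioo (0 : ℝ) 1, ((Real.cos (((i : ℤ) - (j : ℤ) : ℤ) * Real.pi * x)
        - Real.cos (((i : ℤ) + (j : ℤ) : ℤ) * Real.pi * x) : ℝ) : ℂ) := by
    refine integral_congr_ae ?_
    filter_upwards [(sinFun_memLp j).coeFn_toLp] with x hx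
    have hx' : (eigenfun j : ℝ → ℂ) x = sinFun j x := hx
    rw [hx', sinFun, ← Complex.ofReal_mul]
    congr 1
    have e1 : (((i : ℤ) - (j : ℤ) : ℤ) : ℝ) * Real.pi * x
        = (i : ℕ) * Real.pi * x - (j : ℕ) * Real.pi * x := by push_cast; ring
    have e2 : (((i : ℤ) + (j : ℤ) : ℤ) : ℝ) * Real.pi * x
        = (i : ℕ) * Real.pi * x + (j : ℕ) * Real.pi * x := by push_cast; ring
    rw [e1, e2, Real.cos_sub, Real.cos_add]
    have := Real.mul_self_sqrt (show (0 : ℝ) ≤ 2 by norm_num)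
    linear_combination (Real.sin ((i : ℕ) * Real.pi * x) * Real.sin ((j : ℕ) * Real.pi * x)) * this
  rw [h1, integral_complex_ofReal, ← integral_Ioc_eq_integral_Ioo,
    ← intervalIntegral.integral_of_le zero_le_one,
    intervalIntegral.integral_sub (Continuous.intervalIntegrable (by fun_prop) _ _)
      (Continuous.intervalIntegrable (by fun_prop) _ _),
    integral_cos_int_mul_pi, integral_cos_int_mul_pi]
  have hi := i.pos
  have hj := j.pos
  have e3 : ¬ ((i : ℤ) + (j : ℤ) = 0) := by omega
  have e4 : ((i : ℤ) - (j : ℤ) = 0) ↔ i = j := by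
    rw [sub_eq_zero]; exact_mod_cast Iff.rfl
  simp only [e3, e4, if_false, sub_zero]
  split_ifs <;> simp

theorem orthonormal_eigenfun : Orthonormal ℂ eigenfun := by
  rw [orthonormal_iff_ite]
  exact inner_eigenfun_eigenfun

theorem span_eigenfun_orthogonal : (Submodule.span ℂ (Set.range eigenfun))ᗮ = ⊥ := by
  rw [Submodule.eq_bot_iff]
  intro f hf
  refine eq_zero_of_inner_eigenfun f fun j => ?_
  exact (Submodule.mem_orthogonal _ _).1 hf _ (Submodule.subset_span ⟨j, rfl⟩)

/-- The eigenfunctions as a Hilbert basis of `L²(0,1)`. -/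
noncomputable def eigenbasis : HilbertBasis ℕ+ ℂ L2 :=
  HilbertBasis.mkOfOrthogonalEqBot orthonormal_eigenfun span_eigenfun_orthogonal

theorem coe_eigenbasis : ⇑eigenbasis = eigenfun :=
  HilbertBasis.coe_mkOfOrthogonalEqBot _ _

theorem eigenbasis_repr_apply (φ : L2) (j : ℕ+) :
    eigenbasis.repr φ j = inner ℂ (eigenfun j) φ := by
  rw [HilbertBasis.repr_apply_apply, coe_eigenbasis]

theorem L2.ext_inner {f g : L2} (h : ∀ j, inner ℂ (eigenfun j) f = inner ℂ (eigenfun j) g) :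
    f = g := by
  rw [← sub_eq_zero]
  refine eq_zero_of_inner_eigenfun _ fun j => ?_
  rw [inner_sub_right, h, sub_self]

theorem L2.sum_inner_sq_le (φ : L2) (F : Finset ℕ+) :
    ∑ j ∈ F, ‖inner ℂ (eigenfun j) φ‖ ^ 2 ≤ ‖φ‖ ^ 2 :=
  orthonormal_eigenfun.sum_inner_products_le φ

theorem lp_two_exists {c : ℕ+ → ℂ} {C : ℝ} (hC : 0 ≤ C)
    (h : ∀ F : Finset ℕ+, ∑ j ∈ F, ‖c j‖ ^ 2 ≤ C ^ 2) :
    ∃ a : lp (fun _ : ℕ+ => ℂ) 2, (∀ j, a j = c j) ∧ ‖a‖ ≤ C := by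
  have h2 : ∀ F : Finset ℕ+, ∑ j ∈ F, ‖c j‖ ^ (2 : ℝ≥0∞).toReal ≤ C ^ (2 : ℝ≥0∞).toReal := by
    simpa using h
  exact ⟨⟨c, memℓp_gen' h2⟩, fun _ => rfl, lp.norm_le_of_forall_sum_le (by norm_num) hC h2⟩

/-- Estimates are made on finite sums of squares of coefficients; a uniform bound then produces the
element and its norm bound together, without separate summability arguments. -/
theorem L2.exists_of_sum_le {c : ℕ+ → ℂ} {C : ℝ} (hC : 0 ≤ C)
    (h : ∀ F : Finset ℕ+, ∑ j ∈ F, ‖c j‖ ^ 2 ≤ C ^ 2) :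
    ∃ φ : L2, (∀ j, inner ℂ (eigenfun j) φ = c j) ∧ ‖φ‖ ≤ C := by
  obtain ⟨a, ha, hn⟩ := lp_two_exists hC h
  refine ⟨eigenbasis.repr.symm a, fun j => ?_, ?_⟩
  · rw [← eigenbasis_repr_apply, LinearIsometryEquiv.apply_symm_apply, ha]
  · rwa [LinearIsometryEquiv.norm_map]

theorem L2.norm_le_of_sum_le {φ : L2} {C : ℝ} (hC : 0 ≤ C)
    (h : ∀ F : Finset ℕ+, ∑ j ∈ F, ‖inner ℂ (eigenfun j) φ‖ ^ 2 ≤ C ^ 2) : ‖φ‖ ≤ C := by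
  obtain ⟨ψ, h1, h2⟩ := L2.exists_of_sum_le hC h
  rwa [← L2.ext_inner h1]

/-! ### Coefficients of elements of `H^s_(0)` -/

namespace HZero

variable {s r : ℕ}

theorem norm_eq_toSeq (φ : HZero s) : ‖φ‖ = ‖toSeq s φ‖ := rfl

theorem toSeq_apply (φ : HZero s) (j : ℕ+) :
    (toSeq s φ : ℕ+ → ℂ) j = (((j : ℕ) : ℂ) ^ s) * inner ℂ (eigenfun j) (φ : L2) := rfl

theorem norm_weight (j : ℕ+) (s : ℕ) (z : ℂ) :
    ‖(((j : ℕ) : ℂ) ^ s) * z‖ = ((j : ℕ) : ℝ) ^ s * ‖z‖ := by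
  rw [norm_mul, norm_pow, Complex.norm_natCast]

theorem one_le_weight (j : ℕ+) (s : ℕ) : (1 : ℝ) ≤ ((j : ℕ) : ℝ) ^ s :=
  one_le_pow₀ (by exact_mod_cast j.pos)

theorem sum_inner_sq_le (φ : HZero s) (F : Finset ℕ+) :
    ∑ j ∈ F, (((j : ℕ) : ℝ) ^ s * ‖inner ℂ (eigenfun j) (φ : L2)‖) ^ 2 ≤ ‖φ‖ ^ 2 := by
  have := lp.sum_rpow_le_norm_rpow (p := 2) (by norm_num) (toSeq s φ) F
  simpa [toSeq_apply, norm_weight, ← norm_eq_toSeq] using this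

theorem norm_incl_le (φ : HZero s) : ‖(φ : L2)‖ ≤ ‖φ‖ := by
  refine L2.norm_le_of_sum_le (norm_nonneg _) fun F => le_trans ?_ (sum_inner_sq_le φ F)
  refine Finset.sum_le_sum fun j _ => ?_
  gcongr
  exact le_mul_of_one_le_left (norm_nonneg _) (one_le_weight j s)

/-- The inclusion `H^s_(0) → L²` as a continuous map. -/
noncomputable def inclL (s : ℕ) : HZero s →L[ℂ] L2 :=
  (incl s).mkContinuous 1 fun φ => by rw [one_mul]; exact norm_incl_le φ

/-- The coefficient `φ ↦ ⟨φ, φ_j⟩`. -/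
noncomputable def coef (s : ℕ) (j : ℕ+) : HZero s →L[ℂ] ℂ := (innerSL ℂ (eigenfun j)).comp (inclL s)

theorem coef_apply (j : ℕ+) (φ : HZero s) : coef s j φ = inner ℂ (eigenfun j) (φ : L2) := rfl

theorem sum_coef_sq_le (φ : HZero s) (F : Finset ℕ+) :
    ∑ j ∈ F, (((j : ℕ) : ℝ) ^ s * ‖coef s j φ‖) ^ 2 ≤ ‖φ‖ ^ 2 := sum_inner_sq_le φ F

theorem incl_injective : Function.Injective (incl s) := Subtype.val_injective

theorem ext_coef {φ ψ : HZero s} (h : ∀ j, coef s j φ = coef s j ψ) : φ = ψ :=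
  incl_injective (L2.ext_inner h)

/-- The weights are at least `1`, so the coefficients already define an element of `L²`; the
weighted bound then places it in `H^s_(0)`. -/
theorem exists_of_sum_le {c : ℕ+ → ℂ} {C : ℝ} (hC : 0 ≤ C)
    (h : ∀ F : Finset ℕ+, ∑ j ∈ F, (((j : ℕ) : ℝ) ^ s * ‖c j‖) ^ 2 ≤ C ^ 2) :
    ∃ φ : HZero s, (∀ j, coef s j φ = c j) ∧ ‖φ‖ ≤ C := by
  obtain ⟨φ, h1, -⟩ := L2.exists_of_sum_le (c := c) hC fun F => le_trans
    (Finset.sum_le_sum fun j _ => by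
      gcongr
      exact le_mul_of_one_le_left (norm_nonneg _) (one_le_weight j s)) (h F)
  obtain ⟨a, ha, hn⟩ := lp_two_exists (c := fun j => (((j : ℕ) : ℂ) ^ s) * c j) hC
    fun F => by simpa only [norm_weight] using h F
  have h2 : weightedCoeff s φ = a := by
    funext j
    rw [ha, weightedCoeff, h1]
  have hm : φ ∈ hZeroSubmodule s := by
    change Memℓp (weightedCoeff s φ) 2
    rw [h2]
    exact lp.memℓp a
  let ψ : HZero s := (⟨φ, hm⟩ : hZeroSubmodule s)
  have h3 : toSeq s ψ = a := lp.ext h2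
  exact ⟨ψ, h1, (norm_eq_toSeq ψ).trans_le (h3 ▸ hn)⟩

theorem norm_le_of_sum_le {φ : HZero s} {C : ℝ} (hC : 0 ≤ C)
    (h : ∀ F : Finset ℕ+, ∑ j ∈ F, (((j : ℕ) : ℝ) ^ s * ‖coef s j φ‖) ^ 2 ≤ C ^ 2) :
    ‖φ‖ ≤ C := by
  obtain ⟨ψ, h1, h2⟩ := exists_of_sum_le hC h
  rwa [← ext_coef h1]

theorem toSeq_surjective : Function.Surjective (toSeq s) := by
  intro a
  have hw : ∀ j : ℕ+, (((j : ℕ) : ℂ) ^ s) ≠ 0 := fun j =>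
    pow_ne_zero _ (by exact_mod_cast j.ne_zero)
  obtain ⟨φ, h1, -⟩ := exists_of_sum_le (s := s) (c := fun j => (((j : ℕ) : ℂ) ^ s)⁻¹ * a j)
    (norm_nonneg a) fun F => by
      have := lp.sum_rpow_le_norm_rpow (p := 2) (by norm_num) a F
      simp only [← norm_weight, mul_inv_cancel_left₀ (hw _)]
      simpa using this
  refine ⟨φ, lp.ext (funext fun j => ?_)⟩
  rw [toSeq_apply, ← coef_apply, h1, mul_inv_cancel_left₀ (hw _)]

/-- Weighting the coefficients is an isometry onto `ℓ²`. Completeness is what makes Neumann series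
converge, and inversion smooth, for operators on paths. -/
instance : CompleteSpace (HZero s) := by
  let e : HZero s ≃ₗᵢ[ℂ] lp (fun _ : ℕ+ => ℂ) 2 :=
    { LinearEquiv.ofBijective (toSeq s) ⟨toSeq_injective s, toSeq_surjective⟩ with
      norm_map' := fun _ => rfl }
  exact (completeSpace_congr (e := e.toEquiv) e.isometry.isUniformInducing.isUniformEmbedding).2
    inferInstance

/-- A diagonal operator `φ ↦ ∑_j d_j ⟨φ, φ_j⟩ φ_j` from `H^s_(0)` to `H^r_(0)`. -/
theorem exists_diag (s r : ℕ) (d : ℕ+ → ℂ) (C : ℝ)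
    (hd : ∀ j : ℕ+, ((j : ℕ) : ℝ) ^ r * ‖d j‖ ≤ C * ((j : ℕ) : ℝ) ^ s) :
    ∃ D : HZero s →L[ℂ] HZero r, (∀ φ j, coef r j (D φ) = d j * coef s j φ) ∧
      ∀ φ, ‖D φ‖ ≤ C * ‖φ‖ := by
  have hC : 0 ≤ C := by
    have := hd 1
    simp only [PNat.one_coe, Nat.cast_one, one_pow, one_mul, mul_one] at this
    exact (norm_nonneg _).trans this
  have key : ∀ φ : HZero s, ∃ ψ : HZero r, (∀ j, coef r j ψ = d j * coef s j φ) ∧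
      ‖ψ‖ ≤ C * ‖φ‖ := fun φ => by
    refine exists_of_sum_le (by positivity) fun F => ?_
    rw [mul_pow]
    refine le_trans ?_ (mul_le_mul_of_nonneg_left (sum_coef_sq_le φ F) (sq_nonneg C))
    rw [Finset.mul_sum]
    refine Finset.sum_le_sum fun j _ => ?_
    rw [← mul_pow, norm_mul, ← mul_assoc, ← mul_assoc]
    have := mul_le_mul_of_nonneg_right (hd j) (norm_nonneg (coef s j φ))
    gcongr
  choose D h1 h2 using key
  refine ⟨LinearMap.mkContinuous
    { toFun := D
      map_add' := fun φ ψ => ext_coef fun j => by simp only [h1, map_add, mul_add]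
      map_smul' := fun c φ => ext_coef fun j => by
        simp only [h1, map_smul, smul_eq_mul, RingHom.id_apply]; ring } C h2, h1, h2⟩

end HZero

/-! ### The free Schrödinger group -/

/-- The phase `e^{-iλ_j t}`. -/
noncomputable def phase (t : ℝ) (j : ℕ+) : ℂ := Complex.exp (-(Complex.I * eigenval j * t))

theorem phase_eq (t : ℝ) (j : ℕ+) :
    phase t j = Complex.exp ((-(eigenval j * t) : ℝ) * Complex.I) := by
  rw [phase]; congr 1; push_cast; ring

theorem norm_phase (t : ℝ) (j : ℕ+) : ‖phase t j‖ = 1 := by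
  rw [phase_eq, Complex.norm_exp_ofReal_mul_I]

theorem phase_add (t s : ℝ) (j : ℕ+) : phase (t + s) j = phase t j * phase s j := by
  rw [phase, phase, phase, ← Complex.exp_add]; congr 1; push_cast; ring

theorem phase_zero (j : ℕ+) : phase 0 j = 1 := by simp [phase]

theorem continuous_phase (j : ℕ+) : Continuous fun t => phase t j := by
  unfold phase; fun_prop

theorem hasDerivAt_phase (j : ℕ+) (t : ℝ) :
    HasDerivAt (fun t => phase t j) (-(Complex.I * eigenval j) * phase t j) t := by
  have h1 : HasDerivAt (fun t : ℝ => -(Complex.I * eigenval j * (t : ℂ)))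
      (-(Complex.I * eigenval j)) t := by
    have := ((Complex.ofRealCLM.hasDerivAt (x := t)).const_mul
      (Complex.I * (eigenval j : ℂ))).neg
    simp only [Complex.ofRealCLM_apply, Complex.ofReal_one, mul_one] at this
    exact this
  have h2 := h1.cexp
  rwa [mul_comm (Complex.exp _)] at h2

/-- The vector with coefficients `e^{-iλ_j t} ⟨φ, φ_j⟩` exists because the phases have modulus one,
and the series defining `freeGroup` is its expansion in the Hilbert basis; in particular that series
converges. -/
theorem inner_freeGroup (t : ℝ) (φ : L2) (j : ℕ+) :
    inner ℂ (eigenfun j) (freeGroup t φ) = phase t j * inner ℂ (eigenfun j) φ := by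
  obtain ⟨ψ, h, -⟩ := L2.exists_of_sum_le (c := fun j => phase t j * inner ℂ (eigenfun j) φ)
    (norm_nonneg φ) fun F => by
      simpa only [norm_mul, norm_phase, one_mul] using L2.sum_inner_sq_le φ F
  have h1 := eigenbasis.hasSum_repr ψ
  simp only [eigenbasis_repr_apply, coe_eigenbasis, h] at h1
  rw [show freeGroup t φ = ψ from h1.tsum_eq, h]

theorem freeGroup_add (t : ℝ) (φ ψ : L2) : freeGroup t (φ + ψ) = freeGroup t φ + freeGroup t ψ :=
  L2.ext_inner fun j => by simp only [inner_freeGroup, inner_add_right, mul_add]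

theorem freeGroup_smul (t : ℝ) (c : ℂ) (φ : L2) : freeGroup t (c • φ) = c • freeGroup t φ :=
  L2.ext_inner fun j => by simp only [inner_freeGroup, inner_smul_right, mul_left_comm]

theorem norm_freeGroup_le (t : ℝ) (φ : L2) : ‖freeGroup t φ‖ ≤ ‖φ‖ :=
  L2.norm_le_of_sum_le (norm_nonneg φ) fun F => by
    simpa only [inner_freeGroup, norm_mul, norm_phase, one_mul] using L2.sum_inner_sq_le φ F

/-- `e^{-iAt}` as a continuous linear map. -/
noncomputable def freeGroupL (t : ℝ) : L2 →L[ℂ] L2 :=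
  LinearMap.mkContinuous ⟨⟨freeGroup t, freeGroup_add t⟩, freeGroup_smul t⟩ 1 fun φ => by
    rw [one_mul]; exact norm_freeGroup_le t φ

theorem freeGroupL_apply (t : ℝ) (φ : L2) : freeGroupL t φ = freeGroup t φ := rfl

/-- Dominated convergence, with `4 a_j²` as majorant. It gives the strong continuity of the group in
`L²` and, with weighted coefficients, in `H^s_(0)`. -/
theorem tendsto_tsum_phase {a : ℕ+ → ℝ} (ha : Summable fun j => a j ^ 2) (t₀ : ℝ) :
    Filter.Tendsto (fun t => ∑' j, (‖phase t j - phase t₀ j‖ * a j) ^ 2) (𝓝 t₀) (𝓝 0) := by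
  have := tendsto_tsum_of_dominated_convergence (𝓕 := 𝓝 t₀)
    (f := fun t j => (‖phase t j - phase t₀ j‖ * a j) ^ 2) (g := fun _ => 0)
    (bound := fun j => 4 * a j ^ 2) (ha.mul_left 4) (fun j => ?_) ?_
  · simpa using this
  · have : Continuous fun t => (‖phase t j - phase t₀ j‖ * a j) ^ 2 := by
      have := continuous_phase j
      fun_prop
    simpa using this.tendsto t₀
  · refine Filter.Eventually.of_forall fun t j => ?_
    rw [Real.norm_of_nonneg (by positivity), mul_pow]
    have : ‖phase t j - phase t₀ j‖ ≤ 2 := by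
      refine (norm_sub_le _ _).trans ?_
      rw [norm_phase, norm_phase]; norm_num
    have h2 : ‖phase t j - phase t₀ j‖ ^ 2 ≤ 4 := by
      nlinarith [norm_nonneg (phase t j - phase t₀ j)]
    gcongr

theorem L2.norm_sq_eq_tsum (φ : L2) : ‖φ‖ ^ 2 = ∑' j, ‖inner ℂ (eigenfun j) φ‖ ^ 2 := by
  have := lp.norm_rpow_eq_tsum (p := 2) (by norm_num) (eigenbasis.repr φ)
  simpa [eigenbasis_repr_apply] using this

theorem HZero.norm_sq_eq_tsum {s : ℕ} (φ : HZero s) :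
    ‖φ‖ ^ 2 = ∑' j : ℕ+, (((j : ℕ) : ℝ) ^ s * ‖coef s j φ‖) ^ 2 := by
  rw [norm_eq, Real.sq_sqrt (tsum_nonneg fun j => by positivity)]
  simp only [norm_weight, coef_apply]

theorem continuous_freeGroup (φ : L2) : Continuous fun t => freeGroup t φ := by
  refine continuous_iff_continuousAt.2 fun t₀ => tendsto_iff_norm_sub_tendsto_zero.2 ?_
  have h1 : Summable fun j => ‖inner ℂ (eigenfun j) φ‖ ^ 2 :=
    summable_of_sum_le (fun _ => by positivity) (L2.sum_inner_sq_le φ)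
  have h2 := (tendsto_tsum_phase h1 t₀).sqrt
  rw [Real.sqrt_zero] at h2
  refine h2.congr fun t => ?_
  rw [← Real.sqrt_sq (norm_nonneg (freeGroup t φ - freeGroup t₀ φ)), L2.norm_sq_eq_tsum]
  simp only [inner_sub_right, inner_freeGroup, ← sub_mul, norm_mul]

/-- The group is contractive, so joint continuity reduces to strong continuity. -/
theorem continuous_freeGroup_uncurry : Continuous fun q : ℝ × L2 => freeGroup q.1 q.2 := by
  refine continuous_iff_continuousAt.2 fun ⟨t, φ⟩ => tendsto_iff_norm_sub_tendsto_zero.2 ?_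
  have h1 : Filter.Tendsto (fun q : ℝ × L2 => ‖q.2 - φ‖ + ‖freeGroup q.1 φ - freeGroup t φ‖)
      (𝓝 (t, φ)) (𝓝 0) := by
    have : Continuous fun q : ℝ × L2 => ‖q.2 - φ‖ + ‖freeGroup q.1 φ - freeGroup t φ‖ := by
      have h := (continuous_freeGroup φ).comp (continuous_fst (X := ℝ) (Y := L2))
      exact (continuous_snd.sub continuous_const).norm.add (h.sub continuous_const).norm
    simpa using this.tendsto (t, φ)
  refine squeeze_zero (fun _ => norm_nonneg _) (fun q => ?_) h1
  have : freeGroup q.1 q.2 - freeGroup t φ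
      = freeGroup q.1 (q.2 - φ) + (freeGroup q.1 φ - freeGroup t φ) := by
    simp only [← freeGroupL_apply, map_sub]; abel
  rw [this]
  exact (norm_add_le _ _).trans (add_le_add (norm_freeGroup_le _ _) le_rfl)

namespace HZero

variable {s r : ℕ}

theorem exists_free (s : ℕ) (t : ℝ) : ∃ D : HZero s →L[ℂ] HZero s,
    (∀ φ j, coef s j (D φ) = phase t j * coef s j φ) ∧ ∀ φ, ‖D φ‖ ≤ 1 * ‖φ‖ :=
  exists_diag s s (phase t) 1 fun j => by rw [norm_phase, mul_one, one_mul]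

/-- The restriction of `e^{-iAt}` to `H^s_(0)`. -/
noncomputable def free (s : ℕ) (t : ℝ) : HZero s →L[ℂ] HZero s := (exists_free s t).choose

theorem coef_free (t : ℝ) (φ : HZero s) (j : ℕ+) :
    coef s j (free s t φ) = phase t j * coef s j φ := (exists_free s t).choose_spec.1 φ j

theorem norm_free_le (t : ℝ) (φ : HZero s) : ‖free s t φ‖ ≤ ‖φ‖ :=
  ((exists_free s t).choose_spec.2 φ).trans_eq (one_mul _)

theorem continuous_free_apply (φ : HZero s) : Continuous fun t => free s t φ := by
  refine continuous_iff_continuousAt.2 fun t₀ => tendsto_iff_norm_sub_tendsto_zero.2 ?_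
  have h1 : Summable fun j : ℕ+ => (((j : ℕ) : ℝ) ^ s * ‖coef s j φ‖) ^ 2 :=
    summable_of_sum_le (fun _ => by positivity) (sum_coef_sq_le φ)
  have h2 := (tendsto_tsum_phase h1 t₀).sqrt
  rw [Real.sqrt_zero] at h2
  refine h2.congr fun t => ?_
  rw [← Real.sqrt_sq (norm_nonneg (free s t φ - free s t₀ φ)), norm_sq_eq_tsum]
  simp only [map_sub, coef_free, ← sub_mul, norm_mul, mul_left_comm]

theorem continuous_free {f : ℝ → HZero s} (hf : Continuous f) (g : ℝ → ℝ) (hg : Continuous g) :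
    Continuous fun t => free s (g t) (f t) := by
  refine continuous_iff_continuousAt.2 fun t₀ => tendsto_iff_norm_sub_tendsto_zero.2 ?_
  have h1 : Filter.Tendsto (fun t => ‖f t - f t₀‖ + ‖free s (g t) (f t₀) - free s (g t₀) (f t₀)‖)
      (𝓝 t₀) (𝓝 0) := by
    have : Continuous fun t => ‖f t - f t₀‖ + ‖free s (g t) (f t₀) - free s (g t₀) (f t₀)‖ := by
      have h := (continuous_free_apply (f t₀)).comp hg
      exact (hf.sub continuous_const).norm.add (h.sub continuous_const).norm
    simpa using this.tendsto t₀
  refine squeeze_zero (fun _ => norm_nonneg _) (fun t => ?_) h1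
  have : free s (g t) (f t) - free s (g t₀) (f t₀)
      = free s (g t) (f t - f t₀) + (free s (g t) (f t₀) - free s (g t₀) (f t₀)) := by
    rw [map_sub]; abel
  rw [this]
  exact (norm_add_le _ _).trans (add_le_add (norm_free_le _ _) le_rfl)

end HZero

/-! ### Test functions and weak derivatives -/

namespace IsTestFun

variable {a b : ℝ} {θ η : ℝ → ℝ}

theorem eq_zero (h : IsTestFun a b θ) {x : ℝ} (hx : x ∉ Ioo a b) : θ x = 0 :=
  image_eq_zero_of_notMem_tsupport fun hs => hx (h.2.2 hs)

theorem deriv (h : IsTestFun a b θ) : IsTestFun a b (deriv θ) :=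
  ⟨(contDiff_infty_iff_deriv.1 h.1).2, h.2.1.deriv, tsupport_deriv_subset.trans h.2.2⟩

theorem iteratedDeriv (h : IsTestFun a b θ) (n : ℕ) : IsTestFun a b (iteratedDeriv n θ) := by
  induction n with
  | zero => simpa using h
  | succ n ih => rw [iteratedDeriv_succ]; exact ih.deriv

theorem differentiable (h : IsTestFun a b θ) : Differentiable ℝ θ :=
  (contDiff_infty_iff_deriv.1 h.1).1

theorem continuous (h : IsTestFun a b θ) : Continuous θ := h.1.continuous

theorem exists_Icc (h : IsTestFun a b θ) (hab : a < b) :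
    ∃ c d, a < c ∧ c ≤ d ∧ d < b ∧ ∀ x, x ∉ Icc c d → θ x = 0 := by
  rcases (tsupport θ).eq_empty_or_nonempty with h0 | h0
  · refine ⟨(a + b) / 2, (a + b) / 2, by linarith, le_rfl, by linarith, fun x _ => ?_⟩
    exact image_eq_zero_of_notMem_tsupport (by simp [h0])
  · obtain ⟨c, hc⟩ := h.2.1.exists_isLeast h0
    obtain ⟨d, hd⟩ := h.2.1.exists_isGreatest h0
    refine ⟨c, d, (h.2.2 hc.1).1, hc.2 hd.1, (h.2.2 hd.1).2, fun x hx => ?_⟩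
    exact image_eq_zero_of_notMem_tsupport fun hs => hx ⟨hc.2 hs, hd.2 hs⟩

/-- A test function of zero mean is the derivative of a test function. -/
theorem exists_primitive (h : IsTestFun 0 1 η) (h0 : ∫ x in (0 : ℝ)..1, η x = 0) :
    ∃ θ, IsTestFun 0 1 θ ∧ _root_.deriv θ = η := by
  obtain ⟨c, d, hc, hcd, hd, hz⟩ := h.exists_Icc one_pos
  have hi : ∀ x y, IntervalIntegrable η volume x y := fun x y => h.continuous.intervalIntegrable _ _
  have hder : ∀ x, HasDerivAt (fun x => ∫ t in (0 : ℝ)..x, η t) (η x) x := fun x =>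
    intervalIntegral.integral_hasDerivAt_right (hi _ _)
      h.continuous.stronglyMeasurable.stronglyMeasurableAtFilter h.continuous.continuousAt
  have hd' : _root_.deriv (fun x => ∫ t in (0 : ℝ)..x, η t) = η := funext fun x => (hder x).deriv
  have hsupp : ∀ x, x ∉ Icc c d → (∫ t in (0 : ℝ)..x, η t) = 0 := by
    intro x hx
    rcases lt_or_ge x c with h1 | h1
    · refine intervalIntegral.integral_zero_ae (Filter.Eventually.of_forall fun t ht => hz t ?_)
      intro h2
      rcases le_max_iff.1 ht.2 with h3 | h3 <;> linarith [h2.1]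
    · have h1' : d < x := by
        by_contra h4; exact hx ⟨h1, not_lt.1 h4⟩
      rw [← intervalIntegral.integral_add_adjacent_intervals (hi 0 1) (hi 1 x), h0, zero_add]
      refine intervalIntegral.integral_zero_ae (Filter.Eventually.of_forall fun t ht => hz t ?_)
      intro h2
      rcases min_lt_iff.1 ht.1 with h3 | h3 <;> linarith [h2.2]
  have hts : tsupport (fun x => ∫ t in (0 : ℝ)..x, η t) ⊆ Icc c d :=
    closure_minimal (fun x hx => by
      by_contra h1; exact hx (hsupp x h1)) isClosed_Icc
  refine ⟨fun x => ∫ t in (0 : ℝ)..x, η t, ⟨?_, ?_, ?_⟩, hd'⟩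
  · rw [contDiff_infty_iff_deriv, hd']
    exact ⟨fun x => (hder x).differentiableAt, h.1⟩
  · exact isCompact_Icc.of_isClosed_subset (isClosed_tsupport _) hts
  · exact hts.trans fun x hx => ⟨hc.trans_le hx.1, hx.2.trans_lt hd⟩

theorem setIntegral_mul_eq (g : ℝ → ℝ) (θ : ℝ → ℝ) :
    ∫ x in Ioo (0 : ℝ) 1, g x * θ x = ∫ x in (0 : ℝ)..1, g x * θ x := by
  rw [intervalIntegral.integral_of_le zero_le_one, integral_Ioc_eq_integral_Ioo]

theorem exists_integral_eq_one : ∃ θ, IsTestFun 0 1 θ ∧ ∫ x in (0 : ℝ)..1, θ x = 1 := by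
  let φ : ContDiffBump (1 / 2 : ℝ) := ⟨1 / 8, 1 / 4, by norm_num, by norm_num⟩
  have ht : tsupport (φ.normed volume) ⊆ Ioo 0 1 := by
    rw [φ.tsupport_normed_eq, Real.closedBall_eq_Icc]
    intro x hx
    have h1 : (1 / 2 : ℝ) - 1 / 4 ≤ x := hx.1
    have h2 : x ≤ (1 / 2 : ℝ) + 1 / 4 := hx.2
    constructor <;> linarith
  refine ⟨φ.normed volume, ⟨φ.contDiff_normed, φ.hasCompactSupport_normed, ht⟩, ?_⟩
  rw [intervalIntegral.integral_of_le zero_le_one, integral_Ioc_eq_integral_Ioo,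
    setIntegral_eq_integral_of_forall_compl_eq_zero, φ.integral_normed]
  exact fun x hx => image_eq_zero_of_notMem_tsupport fun hs => hx (ht hs)

end IsTestFun

/-- Integration by parts for a primitive of an integrable function. -/
theorem integral_primitive_mul_deriv {g h h' : ℝ → ℝ} {a b : ℝ} (c : ℝ)
    (hg : IntervalIntegrable g volume a b) (hh : ∀ x, HasDerivAt h (h' x) x) (hh' : Continuous h') :
    ∫ x in a..b, (c + ∫ t in a..x, g t) * h' x
      = (c + ∫ t in a..b, g t) * h b - c * h a - ∫ x in a..b, g x * h x := by
  have hd : deriv h = h' := funext fun x => (hh x).deriv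
  have hF : AbsolutelyContinuousOnInterval (fun x => c + ∫ t in a..x, g t) a b := by
    have h1 : AbsolutelyContinuousOnInterval (fun _ : ℝ => c) a b :=
      contDiffOn_const.absolutelyContinuousOnInterval
    exact h1.add (hg.absolutelyContinuousOnInterval_intervalIntegral left_mem_uIcc)
  have hh1 : ContDiff ℝ 1 h := contDiff_one_iff_deriv.2 ⟨fun x => (hh x).differentiableAt, hd ▸ hh'⟩
  have hH : AbsolutelyContinuousOnInterval h a b :=
    hh1.contDiffOn.absolutelyContinuousOnInterval
  have := hF.integral_mul_deriv_eq_deriv_mul hH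
  rw [hd] at this
  rw [this]
  have e : ∫ x in a..b, deriv (fun x => c + ∫ t in a..x, g t) x * h x = ∫ x in a..b, g x * h x := by
    refine intervalIntegral.integral_congr_ae ?_
    filter_upwards [hg.ae_hasDerivAt_integral] with x hx hx1
    rw [((hx (uIoc_subset_uIcc hx1) a left_mem_uIcc).const_add c).deriv]
  rw [e]
  simp

theorem IsTestFun.hasDerivAt {a b : ℝ} {θ : ℝ → ℝ} (h : IsTestFun a b θ) (x : ℝ) :
    HasDerivAt θ (_root_.deriv θ x) x := (h.differentiable x).hasDerivAt

/-- The lemma of du Bois-Reymond. -/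
theorem exists_eq_const_add_integral {f g : ℝ → ℝ} (hf : IntervalIntegrable f volume 0 1)
    (hg : IntervalIntegrable g volume 0 1)
    (h : ∀ θ, IsTestFun 0 1 θ →
      ∫ x in (0 : ℝ)..1, f x * deriv θ x = -∫ x in (0 : ℝ)..1, g x * θ x) :
    ∃ c : ℝ, ∀ᵐ x ∂volume.restrict (Ioo (0 : ℝ) 1), f x = c + ∫ t in (0 : ℝ)..x, g t := by
  set G : ℝ → ℝ := fun x => ∫ t in (0 : ℝ)..x, g t with hG
  have hGc : ContinuousOn G (uIcc 0 1) :=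
    (hg.absolutelyContinuousOnInterval_intervalIntegral left_mem_uIcc).continuousOn
  have hGi : IntervalIntegrable G volume 0 1 := hGc.intervalIntegrable
  have hi : ∀ θ : ℝ → ℝ, Continuous θ →
      IntervalIntegrable (fun x => (f x - G x) * θ x) volume 0 1 :=
    fun θ hθ => (hf.sub hGi).mul_continuousOn hθ.continuousOn
  have h1 : ∀ θ, IsTestFun 0 1 θ → ∫ x in (0 : ℝ)..1, (f x - G x) * deriv θ x = 0 := by
    intro θ hθ
    have h2 := integral_primitive_mul_deriv 0 hg hθ.hasDerivAt hθ.deriv.continuous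
    rw [hθ.eq_zero (x := 1) (by simp), hθ.eq_zero (x := 0) (by simp)] at h2
    simp only [zero_add, mul_zero, sub_self, zero_sub] at h2
    simp only [sub_mul]
    rw [intervalIntegral.integral_sub, h θ hθ, h2, sub_self]
    · exact hf.mul_continuousOn hθ.deriv.continuous.continuousOn
    · exact hGi.mul_continuousOn hθ.deriv.continuous.continuousOn
  obtain ⟨θ₀, hθ₀, hθ₀1⟩ := IsTestFun.exists_integral_eq_one
  set c := ∫ x in (0 : ℝ)..1, (f x - G x) * θ₀ x with hc
  refine ⟨c, ?_⟩
  -- Subtracting from `η` its mean times `θ₀` leaves a function of zero mean, hence the derivative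
  -- of a test function, against which `f - G` integrates to zero. The constant `c` collects the
  -- contribution of `θ₀`.
  have h2 : ∀ η, IsTestFun 0 1 η → ∫ x in (0 : ℝ)..1, (f x - G x - c) * η x = 0 := by
    intro η hη
    set m := ∫ x in (0 : ℝ)..1, η x with hm
    have ht : IsTestFun 0 1 (fun x => η x - m * θ₀ x) := by
      have e1 : tsupport (fun x => η x - m * θ₀ x) ⊆ tsupport η ∪ tsupport θ₀ := by
        refine closure_minimal (fun x hx => ?_)
          ((isClosed_tsupport η).union (isClosed_tsupport θ₀))
        by_contra h3
        rw [mem_union, not_or] at h3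
        refine hx ?_
        simp only [image_eq_zero_of_notMem_tsupport h3.1, image_eq_zero_of_notMem_tsupport h3.2]
        ring
      refine ⟨hη.1.sub (contDiff_const.mul hθ₀.1), ?_, e1.trans (union_subset hη.2.2 hθ₀.2.2)⟩
      exact (hη.2.1.union hθ₀.2.1).of_isClosed_subset (isClosed_tsupport _) e1
    obtain ⟨θ, hθ, hθ'⟩ := ht.exists_primitive (by
      rw [intervalIntegral.integral_sub (hη.continuous.intervalIntegrable _ _)
        ((hθ₀.continuous.intervalIntegrable _ _).const_mul _),
        intervalIntegral.integral_const_mul, hθ₀1, ← hm]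
      ring)
    have h3 := h1 θ hθ
    rw [hθ'] at h3
    have e : ∀ x, (f x - G x) * (η x - m * θ₀ x)
        = (f x - G x) * η x - m * ((f x - G x) * θ₀ x) := fun x => by ring
    simp only [e] at h3
    rw [intervalIntegral.integral_sub (hi _ hη.continuous) ((hi _ hθ₀.continuous).const_mul _),
      intervalIntegral.integral_const_mul, ← hc] at h3
    simp only [sub_mul _ c]
    rw [intervalIntegral.integral_sub (hi _ hη.continuous)
      ((hη.continuous.intervalIntegrable _ _).const_mul _), intervalIntegral.integral_const_mul,
      ← hm]
    linarith
  have hint : IntegrableOn (fun x => f x - G x - c) (Ioo 0 1) volume := by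
    have := (hf.sub hGi).sub (intervalIntegrable_const (c := c))
    exact ((intervalIntegrable_iff_integrableOn_Ioo_of_le zero_le_one).1 this)
  have h3 := isOpen_Ioo.ae_eq_zero_of_integral_contDiff_smul_eq_zero hint.locallyIntegrableOn (by
    intro η h4 h5 h6
    rw [← h2 η ⟨h4, h5, h6⟩, ← IsTestFun.setIntegral_mul_eq]
    symm
    simp only [smul_eq_mul, mul_comm (η _)]
    refine setIntegral_eq_integral_of_forall_compl_eq_zero fun x hx => ?_
    rw [IsTestFun.eq_zero ⟨h4, h5, h6⟩ hx, mul_zero])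
  rw [ae_restrict_iff' measurableSet_Ioo]
  filter_upwards [h3] with x hx hx1
  linarith [hx hx1]

/-- The weak derivatives of each order are defined relative to `f` only; testing with `θ'` relates
two consecutive orders to each other. -/
theorem IsWeakDeriv.succ {n : ℕ} {f g g' : ℝ → ℝ} (h : IsWeakDeriv n f g)
    (h' : IsWeakDeriv (n + 1) f g') (θ : ℝ → ℝ) (hθ : IsTestFun 0 1 θ) :
    ∫ x in (0 : ℝ)..1, g x * deriv θ x = -∫ x in (0 : ℝ)..1, g' x * θ x := by
  have h1 := h _ hθ.deriv
  have h2 := h' _ hθ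
  rw [iteratedDeriv_succ'] at h2
  rw [h1, IsTestFun.setIntegral_mul_eq, IsTestFun.setIntegral_mul_eq, pow_succ] at h2
  have h3 : ((-1 : ℝ) ^ n) ≠ 0 := pow_ne_zero _ (by norm_num)
  have h4 : ((-1 : ℝ) ^ n) * (∫ x in (0 : ℝ)..1, g x * deriv θ x)
      = ((-1 : ℝ) ^ n) * (-∫ x in (0 : ℝ)..1, g' x * θ x) := by rw [h2]; ring
  exact mul_left_cancel₀ h3 h4

theorem intervalIntegrable_of_memLp {g : ℝ → ℝ}
    (hg : MemLp g 2 (volume.restrict (Ioo (0 : ℝ) 1))) : IntervalIntegrable g volume 0 1 :=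
  (intervalIntegrable_iff_integrableOn_Ioo_of_le zero_le_one).2 (hg.integrable (by norm_num))

theorem integral_congr_of_ae_Ioo {E : Type*} [NormedAddCommGroup E] [NormedSpace ℝ E] {T : ℝ}
    {f g : ℝ → E} (h : f =ᵐ[volume.restrict (Ioo (0 : ℝ) T)] g) {x : ℝ} (hx : x ∈ Icc (0 : ℝ) T) :
    ∫ t in (0 : ℝ)..x, f t = ∫ t in (0 : ℝ)..x, g t := by
  rw [intervalIntegral.integral_of_le hx.1, intervalIntegral.integral_of_le hx.1,
    integral_Ioc_eq_integral_Ioo, integral_Ioc_eq_integral_Ioo]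
  exact integral_congr_ae (ae_restrict_of_ae_restrict_of_subset (Ioo_subset_Ioo le_rfl hx.2) h)

/-- The weak derivatives of a Sobolev function, represented by successive primitives. -/
theorem MemSobolev.exists_jet {m : ℕ} {f : ℝ → ℝ} (hf : MemSobolev m f) :
    ∃ G : ℕ → ℝ → ℝ, (∀ n ≤ m, MemLp (G n) 2 (volume.restrict (Ioo (0 : ℝ) 1))) ∧
      (∀ n ≤ m, IsWeakDeriv n f (G n)) ∧ f =ᵐ[volume.restrict (Ioo (0 : ℝ) 1)] G 0 ∧
      ∀ n < m, ∃ c, ∀ x ∈ Icc (0 : ℝ) 1, G n x = c + ∫ t in (0 : ℝ)..x, G (n + 1) t := by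
  have h0 : ∀ n, ∃ g : ℝ → ℝ, n ≤ m → (n = 0 → g = f) ∧
      MemLp g 2 (volume.restrict (Ioo (0 : ℝ) 1)) ∧ IsWeakDeriv n f g := by
    intro n
    rcases Nat.eq_zero_or_pos n with rfl | hn
    · exact ⟨f, fun _ => ⟨fun _ => rfl, hf.1, fun θ _ => by simp⟩⟩
    · by_cases h : n ≤ m
      · obtain ⟨g, h1, h2⟩ := hf.2 n h
        exact ⟨g, fun _ => ⟨fun h => by omega, h1, h2⟩⟩
      · exact ⟨f, fun h' => absurd h' h⟩
  choose g hg using h0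
  have h1 : ∀ n, ∃ c : ℝ, n < m → ∀ᵐ x ∂volume.restrict (Ioo (0 : ℝ) 1),
      g n x = c + ∫ t in (0 : ℝ)..x, g (n + 1) t := by
    intro n
    by_cases h : n < m
    · obtain ⟨c, hc⟩ := exists_eq_const_add_integral
        (intervalIntegrable_of_memLp (hg n h.le).2.1)
        (intervalIntegrable_of_memLp (hg (n + 1) h).2.1)
        (IsWeakDeriv.succ (hg n h.le).2.2 (hg (n + 1) h).2.2)
      exact ⟨c, fun _ => hc⟩
    · exact ⟨0, fun h' => absurd h' h⟩
  choose c hc using h1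
  -- Below the top order, `g n` is replaced by the primitive of `g (n + 1)`, to which it is equal
  -- almost everywhere. The primitive does not see the change of `g (n + 1)` into `G (n + 1)`, so
  -- the new representatives are linked at every point of `[0,1]`.
  let G : ℕ → ℝ → ℝ := fun n => if n < m then fun x => c n + ∫ t in (0 : ℝ)..x, g (n + 1) t else g n
  have hG : ∀ n ≤ m, g n =ᵐ[volume.restrict (Ioo (0 : ℝ) 1)] G n := by
    intro n hn
    by_cases h : n < m
    · simp only [G, if_pos h]
      exact hc n h
    · simp only [G, if_neg h]; rfl
  refine ⟨G, fun n hn => (memLp_congr_ae (hG n hn)).1 (hg n hn).2.1, fun n hn θ hθ => ?_, ?_, ?_⟩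
  · rw [(hg n hn).2.2 θ hθ]
    congr 1
    refine integral_congr_ae ?_
    filter_upwards [hG n hn] with x hx
    rw [hx]
  · have := hG 0 (Nat.zero_le _)
    rwa [(hg 0 (Nat.zero_le _)).1 rfl] at this
  · intro n hn
    refine ⟨c n, fun x hx => ?_⟩
    rw [← integral_congr_of_ae_Ioo (hG (n + 1) hn) hx]
    simp only [G, if_pos hn]

theorem continuousOn_of_eq_const_add_integral {G G' : ℝ → ℝ}
    (hG' : MemLp G' 2 (volume.restrict (Ioo (0 : ℝ) 1))) {c : ℝ}
    (h : ∀ x ∈ Icc (0 : ℝ) 1, G x = c + ∫ t in (0 : ℝ)..x, G' t) : ContinuousOn G (Icc 0 1) := by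
  have := ((intervalIntegrable_of_memLp hG').absolutelyContinuousOnInterval_intervalIntegral
    (c := 0) left_mem_uIcc).continuousOn
  rw [uIcc_of_le zero_le_one] at this
  exact (continuousOn_const.add this).congr h

/-- Both functions integrate equally against test functions, so they agree almost everywhere on
`(0,1)`, and by continuity up to the ends. This transfers the vanishing of the odd derivatives of
`μ` at `0` and `1` to the representatives given by primitives. -/
theorem IsWeakDeriv.eqOn {n : ℕ} {f g h : ℝ → ℝ} (hg : IsWeakDeriv n f g) (hh : IsWeakDeriv n f h)
    (hgc : ContinuousOn g (Icc 0 1)) (hhc : ContinuousOn h (Icc 0 1)) : EqOn g h (Icc 0 1) := by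
  have hi : ∀ g : ℝ → ℝ, ContinuousOn g (Icc 0 1) → IntegrableOn g (Ioo 0 1) volume := fun g hgc =>
    (hgc.integrableOn_Icc).mono_set Ioo_subset_Icc_self
  have h3 := isOpen_Ioo.ae_eq_zero_of_integral_contDiff_smul_eq_zero (μ := volume)
    (f := fun x => g x - h x) (U := Ioo (0 : ℝ) 1)
    ((hi g hgc).sub (hi h hhc)).locallyIntegrableOn (by
    intro η h4 h5 h6
    have hη : IsTestFun 0 1 η := ⟨h4, h5, h6⟩
    have e1 := (hg η hη).symm.trans (hh η hη)
    have e2 : ∫ x in Ioo (0 : ℝ) 1, g x * η x = ∫ x in Ioo (0 : ℝ) 1, h x * η x :=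
      mul_left_cancel₀ (pow_ne_zero _ (by norm_num)) e1
    rw [IsTestFun.setIntegral_mul_eq, IsTestFun.setIntegral_mul_eq] at e2
    have hii : ∀ g : ℝ → ℝ, ContinuousOn g (Icc 0 1) →
        IntervalIntegrable (fun x => g x * η x) volume 0 1 := fun g hgc => by
      refine ContinuousOn.intervalIntegrable ?_
      rw [uIcc_of_le zero_le_one]
      exact hgc.mul h4.continuous.continuousOn
    have e3 : ∫ x in (0 : ℝ)..1, (g x - h x) * η x = 0 := by
      simp only [sub_mul]
      rw [intervalIntegral.integral_sub (hii g hgc) (hii h hhc), e2, sub_self]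
    rw [← e3, ← IsTestFun.setIntegral_mul_eq]
    symm
    simp only [smul_eq_mul, mul_comm (η _)]
    refine setIntegral_eq_integral_of_forall_compl_eq_zero fun x hx => ?_
    rw [hη.eq_zero hx, mul_zero])
  refine Measure.eqOn_Icc_of_ae_eq volume zero_ne_one ?_ hgc hhc
  rw [← Measure.restrict_congr_set Ioo_ae_eq_Icc]
  refine (ae_restrict_iff' measurableSet_Ioo).2 ?_
  filter_upwards [h3] with x hx hx1
  exact sub_eq_zero.1 (hx hx1)

/-! ### Cosine coefficients of Sobolev functions -/

/-- `∫₀¹ f(x) cos(kπx) dx`. -/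
noncomputable def cosCoef (f : ℝ → ℝ) (k : ℤ) : ℝ :=
  ∫ x in (0 : ℝ)..1, f x * Real.cos (k * Real.pi * x)

/-- `∫₀¹ f(x) sin(kπx) dx`. -/
noncomputable def sinCoef (f : ℝ → ℝ) (k : ℤ) : ℝ :=
  ∫ x in (0 : ℝ)..1, f x * Real.sin (k * Real.pi * x)

/-- Integration by parts against `sin(kπx)`, which vanishes at both ends: even orders of derivation
contribute no boundary term. -/
theorem mul_cosCoef {G G' : ℝ → ℝ} {c : ℝ}
    (hG' : MemLp G' 2 (volume.restrict (Ioo (0 : ℝ) 1)))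
    (h : ∀ x ∈ Icc (0 : ℝ) 1, G x = c + ∫ t in (0 : ℝ)..x, G' t) (k : ℤ) :
    k * Real.pi * cosCoef G k = -sinCoef G' k := by
  have h1 := integral_primitive_mul_deriv (h := fun x => Real.sin (k * Real.pi * x))
    (h' := fun x => Real.cos (k * Real.pi * x) * (k * Real.pi)) c
    (intervalIntegrable_of_memLp hG') (fun x => by
      simpa using ((hasDerivAt_id x).const_mul (k * Real.pi)).sin) (by fun_prop)
  have h2 : cosCoef G k = ∫ x in (0 : ℝ)..1, (c + ∫ t in (0 : ℝ)..x, G' t)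
      * Real.cos (k * Real.pi * x) := by
    refine intervalIntegral.integral_congr fun x hx => ?_
    rw [uIcc_of_le zero_le_one] at hx
    simp only [h x hx]
  simp only [← mul_assoc, mul_one, mul_zero, Real.sin_int_mul_pi, Real.sin_zero,
    zero_sub, sub_zero] at h1
  rw [h2, sinCoef, ← h1, ← intervalIntegral.integral_const_mul]
  refine intervalIntegral.integral_congr fun x _ => ?_
  ring

/-- Integration by parts against `cos(kπx)`, which is `1` and `(-1)^k` at the ends: in the
alternation of the two rules, boundary values appear only at odd orders of derivation. -/
theorem mul_sinCoef {G G' : ℝ → ℝ} {c : ℝ}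
    (hG' : MemLp G' 2 (volume.restrict (Ioo (0 : ℝ) 1)))
    (h : ∀ x ∈ Icc (0 : ℝ) 1, G x = c + ∫ t in (0 : ℝ)..x, G' t) (k : ℤ) :
    k * Real.pi * sinCoef G k = G 0 - (-1) ^ k * G 1 + cosCoef G' k := by
  have h1 := integral_primitive_mul_deriv (h := fun x => Real.cos (k * Real.pi * x))
    (h' := fun x => -Real.sin (k * Real.pi * x) * (k * Real.pi)) c
    (intervalIntegrable_of_memLp hG') (fun x => by
      simpa using ((hasDerivAt_id x).const_mul (k * Real.pi)).cos) (by fun_prop)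
  have h2 : sinCoef G k = ∫ x in (0 : ℝ)..1, (c + ∫ t in (0 : ℝ)..x, G' t)
      * Real.sin (k * Real.pi * x) := by
    refine intervalIntegral.integral_congr fun x hx => ?_
    rw [uIcc_of_le zero_le_one] at hx
    simp only [h x hx]
  have h3 : k * Real.pi * sinCoef G k = -∫ x in (0 : ℝ)..1, (c + ∫ t in (0 : ℝ)..x, G' t)
      * (-Real.sin (k * Real.pi * x) * (k * Real.pi)) := by
    rw [h2, ← intervalIntegral.integral_const_mul, ← intervalIntegral.integral_neg]
    refine intervalIntegral.integral_congr fun x _ => ?_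
    ring
  rw [h3, h1, h 0 (by simp), h 1 (by simp), cosCoef]
  simp only [mul_one, mul_zero, Real.cos_zero, Real.cos_int_mul_pi, intervalIntegral.integral_same]
  ring

theorem sinCoef_const_mul (a : ℝ) (f : ℝ → ℝ) (k : ℤ) :
    sinCoef (fun x => a * f x) k = a * sinCoef f k := by
  rw [sinCoef, sinCoef, ← intervalIntegral.integral_const_mul]
  exact intervalIntegral.integral_congr fun x _ => by ring

/-- Integrating by parts `2p+3` times, only the odd derivatives of `μ` leave boundary values. Those
of order below `2p+1` vanish by assumption, order `2p+1` leaves `k (α + (-1)^k β)`, and the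
derivative of order `2p+3` is merely in `L²`, which suffices for its sine coefficients. Multiplying
by `k` rather than dividing keeps the formula valid at `k = 0`. -/
theorem exists_cosCoef_expansion {p : ℕ} {μ : ℝ → ℝ} (hμ : MemSobolev (2 * p + 3) μ)
    (hμ' : ∀ n < p, DerivVanishesAtEnds (2 * n + 1) μ) :
    ∃ α β : ℝ, ∃ g : ℝ → ℝ, MemLp g 2 (volume.restrict (Ioo (0 : ℝ) 1)) ∧ ∀ k : ℤ,
      (k : ℝ) ^ (2 * p + 3) * cosCoef μ k = k * (α + (-1) ^ k * β) + sinCoef g k := by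
  obtain ⟨G, hG1, hG2, hG3, hG4⟩ := hμ.exists_jet
  have hends : ∀ n < p, G (2 * n + 1) 0 = 0 ∧ G (2 * n + 1) 1 = 0 := by
    intro n hn
    obtain ⟨g, h1, h2, h3, h4⟩ := hμ' n hn
    obtain ⟨c, hc⟩ := hG4 (2 * n + 1) (by omega)
    have := (hG2 (2 * n + 1) (by omega)).eqOn h2
      (continuousOn_of_eq_const_add_integral (hG1 _ (by omega)) hc) h1
    exact ⟨(this (by simp)).trans h3, (this (by simp)).trans h4⟩
  have hC : ∀ n < 2 * p + 3, ∀ k : ℤ, k * Real.pi * cosCoef (G n) k = -sinCoef (G (n + 1)) k := by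
    intro n hn k
    obtain ⟨c, hc⟩ := hG4 n hn
    exact mul_cosCoef (hG1 _ hn) hc k
  have hS : ∀ n < 2 * p + 3, ∀ k : ℤ, k * Real.pi * sinCoef (G n) k
      = G n 0 - (-1) ^ k * G n 1 + cosCoef (G (n + 1)) k := by
    intro n hn k
    obtain ⟨c, hc⟩ := hG4 n hn
    exact mul_sinCoef (hG1 _ hn) hc k
  have hp : ∀ n ≤ p, ∀ k : ℤ, (k * Real.pi) ^ (2 * n) * cosCoef (G 0) k
      = (-1) ^ n * cosCoef (G (2 * n)) k := by
    intro n
    induction n with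
    | zero => intro _ k; simp
    | succ n ih =>
      intro hn k
      have h1 := hC (2 * n) (by omega) k
      have h2 := hS (2 * n + 1) (by omega) k
      obtain ⟨h3, h4⟩ := hends n hn
      rw [h3, h4] at h2
      have h5 := ih (by omega) k
      rw [show 2 * (n + 1) = 2 * n + 1 + 1 by ring, pow_succ, pow_succ, pow_succ]
      linear_combination (k * Real.pi) ^ 2 * h5 + (-1) ^ n * (k * Real.pi) * h1 - (-1) ^ n * h2
  have hM : ∀ k, cosCoef μ k = cosCoef (G 0) k := fun k => by
    have := integral_congr_of_ae_Ioo (f := fun x => μ x * Real.cos (k * Real.pi * x))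
      (g := fun x => G 0 x * Real.cos (k * Real.pi * x)) (by
        filter_upwards [hG3] with x hx
        rw [hx]) (right_mem_Icc.2 zero_le_one)
    exact this
  -- The witnesses are read off from the identity `h5` below, divided by `π^{2p+3}`.
  refine ⟨(-1) ^ (p + 1) / Real.pi ^ (2 * p + 2) * G (2 * p + 1) 0,
    -((-1) ^ (p + 1) / Real.pi ^ (2 * p + 2) * G (2 * p + 1) 1),
    fun x => -((-1) ^ (p + 1) / Real.pi ^ (2 * p + 3)) * G (2 * p + 3) x,
    (hG1 _ le_rfl).const_mul _, fun k => ?_⟩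
  have h1 := hp p le_rfl k
  have h2 := hC (2 * p) (by omega) k
  have h3 := hS (2 * p + 1) (by omega) k
  have h4 := hC (2 * p + 2) (by omega) k
  rw [sinCoef_const_mul, hM]
  have hpi := Real.pi_ne_zero
  have h5 : Real.pi ^ (2 * p + 3) * ((k : ℝ) ^ (2 * p + 3) * cosCoef (G 0) k)
      = (-1) ^ (p + 1) * (Real.pi * k * (G (2 * p + 1) 0 - (-1) ^ k * G (2 * p + 1) 1)
        - sinCoef (G (2 * p + 3)) k) := by
    rw [← mul_assoc, ← mul_pow, mul_comm Real.pi]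
    linear_combination (k * Real.pi) ^ 3 * h1 + (-1) ^ p * (k * Real.pi) ^ 2 * h2
      - (-1) ^ p * (k * Real.pi) * h3 - (-1) ^ p * h4
  rw [← mul_right_inj' (pow_ne_zero (2 * p + 3) hpi), h5]
  field_simp
  ring

theorem summable_int_of_pnat {f : ℤ → ℝ} (h1 : Summable fun j : ℕ+ => f (j : ℕ))
    (h2 : Summable fun j : ℕ+ => f (-((j : ℕ) : ℤ))) : Summable f := by
  refine Summable.of_nat_of_neg ?_ ?_
  · exact (summable_pnat_iff_summable_nat (f := fun n : ℕ => f n)).1 h1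
  · exact (summable_pnat_iff_summable_nat (f := fun n : ℕ => f (-(n : ℤ)))).1 h2

/-- Bessel's inequality for the eigenfunctions gives the positive indices, and oddness in `k` the
negative ones. -/
theorem summable_sinCoef_sq {g : ℝ → ℝ} (hg : MemLp g 2 (volume.restrict (Ioo (0 : ℝ) 1))) :
    Summable fun k : ℤ => sinCoef g k ^ 2 := by
  have hneg : ∀ k, sinCoef g (-k) = -sinCoef g k := fun k => by
    rw [sinCoef, sinCoef, ← intervalIntegral.integral_neg]
    refine intervalIntegral.integral_congr fun x _ => ?_
    rw [← mul_neg, ← Real.sin_neg]; congr 2; push_cast; ring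
  have hgc : MemLp (fun x => (g x : ℂ)) 2 (volume.restrict (Ioo (0 : ℝ) 1)) := hg.ofReal
  have h1 : ∀ j : ℕ+, ‖inner ℂ (eigenfun j) (hgc.toLp : L2)‖ ^ 2
      = 2 * sinCoef g (j : ℕ) ^ 2 := by
    intro j
    have e : inner ℂ (eigenfun j) (hgc.toLp : L2) = ((√2 * sinCoef g (j : ℕ) : ℝ) : ℂ) := by
      rw [inner_eigenfun, sinCoef, intervalIntegral.integral_of_le zero_le_one,
        integral_Ioc_eq_integral_Ioo, ← integral_const_mul, ← integral_complex_ofReal]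
      refine integral_congr_ae ?_
      filter_upwards [hgc.coeFn_toLp] with x hx
      rw [hx]
      push_cast
      ring
    rw [e, Complex.norm_real, Real.norm_eq_abs, sq_abs, mul_pow, Real.sq_sqrt zero_le_two]
  have h2 : Summable fun j : ℕ+ => sinCoef g (j : ℕ) ^ 2 := by
    have := summable_of_sum_le (fun _ => by positivity)
      (L2.sum_inner_sq_le (hgc.toLp : L2))
    simp only [h1] at this
    exact (summable_mul_left_iff two_ne_zero).1 this
  refine summable_int_of_pnat h2 ?_
  simpa only [hneg, neg_sq] using h2

theorem MemSobolev.exists_bound {m : ℕ} {μ : ℝ → ℝ} (hμ : MemSobolev (m + 1) μ) :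
    ∃ B : ℝ, ∀ᵐ x ∂volume.restrict (Ioo (0 : ℝ) 1), ‖μ x‖ ≤ B := by
  obtain ⟨G, hG1, -, hG3, hG4⟩ := hμ.exists_jet
  obtain ⟨c, hc⟩ := hG4 0 (by omega)
  obtain ⟨B, hB⟩ := (isCompact_Icc (a := (0 : ℝ)) (b := 1)).exists_bound_of_continuousOn
    (continuousOn_of_eq_const_add_integral (hG1 1 (by omega)) hc)
  refine ⟨B, ?_⟩
  filter_upwards [hG3, ae_restrict_mem measurableSet_Ioo] with x hx hx1
  rw [hx]
  exact hB x (Ioo_subset_Icc_self hx1)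

/-! ### Matrix elements of multiplication operators: a bound away from the boundary terms -/

/-- The weight `1 / (1 + k²)`. -/
noncomputable def quadWeight (k : ℤ) : ℝ := 1 / (1 + (k : ℝ) ^ 2)

theorem quadWeight_pos (k : ℤ) : 0 < quadWeight k := by unfold quadWeight; positivity

theorem summable_inv_sq_pnat : Summable fun j : ℕ+ => ((((j : ℕ) : ℝ)) ^ 2)⁻¹ :=
  (summable_pnat_iff_summable_nat (f := fun n : ℕ => ((n : ℝ) ^ 2)⁻¹)).2
    (Real.summable_nat_pow_inv.2 one_lt_two)

theorem summable_quadWeight : Summable quadWeight := by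
  have h : Summable fun j : ℕ+ => 1 / (1 + (((j : ℕ) : ℝ)) ^ 2) := by
    refine Summable.of_nonneg_of_le (fun _ => by positivity) (fun j => ?_) summable_inv_sq_pnat
    rw [one_div]
    have : (0 : ℝ) < (j : ℕ) := by exact_mod_cast j.pos
    gcongr
    linarith
  refine summable_int_of_pnat ?_ ?_ <;> simpa [quadWeight] using h

theorem one_le_abs_int {k : ℤ} (hk : k ≠ 0) : (1 : ℝ) ≤ |(k : ℝ)| := by
  rw [← Int.cast_abs]; exact_mod_cast Int.one_le_abs hk

theorem inv_sq_le_quadWeight {k : ℤ} (hk : k ≠ 0) : (|(k : ℝ)| ^ 2)⁻¹ ≤ 2 * quadWeight k := by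
  have h1 := one_le_abs_int hk
  have h2 : (1 : ℝ) ≤ |(k : ℝ)| ^ 2 := one_le_pow₀ h1
  rw [quadWeight, ← sq_abs (k : ℝ), inv_eq_one_div, mul_one_div, div_le_div_iff₀ (by positivity)
    (by positivity)]
  linarith

theorem abs_zpow_neg_one (k : ℤ) : |(-1 : ℝ) ^ k| = 1 := by
  rcases Int.even_or_odd k with h | h
  · rw [h.neg_one_zpow, abs_one]
  · rw [h.neg_one_zpow, abs_neg, abs_one]

section Kernel

variable {t : ℕ} {M e : ℤ → ℝ} {α β : ℝ}

/-- For `k ≠ 0`, division by `k` gives `k^{t+2} M_k = α + (-1)^k β + e_k / k`, a bounded sequence.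
Lower powers gain factors `1/|k|`: one makes the sequence square summable, two make it summable. The
index `k = 0` is absorbed by the term `|M 0|` of the constant. -/
theorem exists_power_bounds (he : Summable fun k => e k ^ 2)
    (hM : ∀ k : ℤ, (k : ℝ) ^ (t + 3) * M k = k * (α + (-1) ^ k * β) + e k) :
    ∃ D : ℝ, 1 ≤ D ∧ (∀ i ≤ t, ∀ k : ℤ, |(k : ℝ) ^ i * M k| ≤ D * quadWeight k) ∧
      (∀ k : ℤ, |(k : ℝ) ^ (t + 1) * M k| ≤ D * (√(quadWeight k) + |e k|)) ∧
      ∀ k : ℤ, |(k : ℝ) ^ (t + 2) * M k - (α + (-1) ^ k * β)| ≤ D * (√(quadWeight k) + |e k|) := by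
  obtain ⟨E, hE0, hE⟩ : ∃ E : ℝ, 0 ≤ E ∧ ∀ k, |e k| ≤ E := by
    refine ⟨√(∑' k, e k ^ 2), Real.sqrt_nonneg _, fun k => ?_⟩
    rw [← Real.sqrt_sq_eq_abs]
    exact Real.sqrt_le_sqrt (he.le_tsum k fun _ _ => sq_nonneg _)
  have hB : ∀ k : ℤ, |α + (-1) ^ k * β| ≤ |α| + |β| := fun k => by
    refine (abs_add_le _ _).trans ?_
    rw [abs_mul, abs_zpow_neg_one, one_mul]
  set D₀ := |α| + |β| + E with hD₀
  have hD₀0 : 0 ≤ D₀ := by positivity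
  have hd : ∀ k : ℤ, k ≠ 0 → (k : ℝ) ^ (t + 2) * M k = (α + (-1) ^ k * β) + e k / k := by
    intro k hk
    have hk' : (k : ℝ) ≠ 0 := by exact_mod_cast hk
    have := hM k
    field_simp
    linear_combination this
  have hdk : ∀ k : ℤ, k ≠ 0 → |e k / k| ≤ |e k| := by
    intro k hk
    rw [abs_div]
    exact div_le_self (abs_nonneg _) (one_le_abs_int hk)
  have h1 : ∀ k : ℤ, k ≠ 0 → |(k : ℝ) ^ (t + 2) * M k| ≤ D₀ := by
    intro k hk
    rw [hd k hk]
    exact (abs_add_le _ _).trans (add_le_add (hB k) ((hdk k hk).trans (hE k)))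
  have hsq : ∀ k : ℤ, k ≠ 0 → |(k : ℝ)|⁻¹ ≤ 2 * √(quadWeight k) := by
    intro k hk
    have h2 := Real.sqrt_le_sqrt (inv_sq_le_quadWeight hk)
    rw [← inv_pow, Real.sqrt_sq (by positivity), Real.sqrt_mul (by norm_num)] at h2
    refine h2.trans ?_
    gcongr
    rw [Real.sqrt_le_left (by norm_num)]; norm_num
  refine ⟨2 * D₀ + |M 0| + 1, by linarith [abs_nonneg (M 0)], fun i hi k => ?_, fun k => ?_,
    fun k => ?_⟩
  · by_cases hk : k = 0
    · subst hk
      have : quadWeight 0 = 1 := by simp [quadWeight]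
      rw [this, mul_one, abs_mul]
      have h2 : |((0 : ℤ) : ℝ) ^ i| ≤ 1 := by
        rw [Int.cast_zero, abs_pow, abs_zero]
        exact pow_le_one₀ le_rfl zero_le_one
      nlinarith [abs_nonneg (M 0)]
    · have hk1 := one_le_abs_int hk
      have e1 : |(k : ℝ) ^ i * M k| * |(k : ℝ)| ^ (t - i) = |(k : ℝ) ^ (t + 2) * M k|
          * (|(k : ℝ)| ^ 2)⁻¹ := by
        rw [abs_mul, abs_mul, abs_pow, abs_pow, show t + 2 = i + (t - i) + 2 by omega, pow_add,
          pow_add]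
        field_simp
      calc |(k : ℝ) ^ i * M k| ≤ |(k : ℝ) ^ i * M k| * |(k : ℝ)| ^ (t - i) :=
            le_mul_of_one_le_right (abs_nonneg _) (one_le_pow₀ hk1)
        _ ≤ D₀ * (2 * quadWeight k) := by
            rw [e1]
            exact mul_le_mul (h1 k hk) (inv_sq_le_quadWeight hk) (by positivity) hD₀0
        _ ≤ _ := by nlinarith [quadWeight_pos k, abs_nonneg (M 0)]
  · by_cases hk : k = 0
    · subst hk
      simp only [Int.cast_zero, ne_eq, Nat.add_eq_zero_iff, one_ne_zero, and_false,
        not_false_eq_true, zero_pow, zero_mul, abs_zero]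
      positivity
    · have hk1 := one_le_abs_int hk
      have e1 : |(k : ℝ) ^ (t + 1) * M k| = |(k : ℝ) ^ (t + 2) * M k| * |(k : ℝ)|⁻¹ := by
        rw [abs_mul, abs_mul, abs_pow, abs_pow, pow_succ _ (t + 1)]
        field_simp
      rw [e1]
      calc _ ≤ D₀ * (2 * √(quadWeight k)) :=
            mul_le_mul (h1 k hk) (hsq k hk) (by positivity) hD₀0
        _ ≤ _ := by
          have := Real.sqrt_nonneg (quadWeight k)
          have h3 : 0 ≤ (2 * D₀ + |M 0| + 1) * |e k| := by positivity
          nlinarith [abs_nonneg (M 0), mul_nonneg (abs_nonneg (M 0)) this]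
  · by_cases hk : k = 0
    · subst hk
      have h2 : quadWeight 0 = 1 := by simp [quadWeight]
      rw [h2, Real.sqrt_one]
      have h3 : |((0 : ℤ) : ℝ) ^ (t + 2) * M 0 - (α + (-1) ^ (0 : ℤ) * β)| ≤ |α| + |β| := by
        rw [Int.cast_zero, zero_pow (by omega), zero_mul, zero_sub, abs_neg]
        exact hB 0
      refine h3.trans ?_
      have h4 : 0 ≤ (2 * D₀ + |M 0| + 1) * |e 0| := by positivity
      nlinarith [abs_nonneg (M 0), abs_nonneg α, abs_nonneg β]
    · rw [hd k hk, add_sub_cancel_left]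
      refine (hdk k hk).trans ?_
      have h5 : 0 ≤ (2 * D₀ + |M 0| + 1) * √(quadWeight k) := by positivity
      nlinarith [abs_nonneg (M 0), abs_nonneg (e k)]

/-- Expand `(k+σ)^{t+3}` by the binomial formula. The two highest powers of `k` produce the
subtracted main term, with remainders controlled by `|e_k|`. The power `t+1` is square summable in
`k` with weight `σ²`, and the powers up to `t` are summable in `k` with weight at most `|σ|^{t+3}`.
As `σ ≠ 0`, powers of `|σ|` increase with the exponent. -/
theorem exists_shifted_bound (he : Summable fun k => e k ^ 2)
    (hM : ∀ k : ℤ, (k : ℝ) ^ (t + 3) * M k = k * (α + (-1) ^ k * β) + e k) :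
    ∃ C : ℝ, 0 ≤ C ∧ ∀ k σ : ℤ, σ ≠ 0 →
      |((k + σ : ℤ) : ℝ) ^ (t + 3) * M k - (k + (t + 3 : ℕ) * σ) * (α + (-1) ^ k * β)|
        ≤ C * (|(σ : ℝ)| ^ (t + 3) * quadWeight k
          + |(σ : ℝ)| ^ 2 * (√(quadWeight k) + |e k|)) := by
  obtain ⟨D, hD, h1, h2, h3⟩ := exists_power_bounds he hM
  have hD0 : 0 ≤ D := zero_le_one.trans hD
  -- Here `2^{t+3}` dominates the binomial coefficients, their partial sum and the factor `t+3`; the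
  -- `3` counts the remainders bounded by `b2`, `b3` and `b4`.
  refine ⟨2 ^ (t + 3) * D * 3, by positivity, fun k σ hσ => ?_⟩
  have hσ1 := one_le_abs_int hσ
  set q := √(quadWeight k) + |e k| with hq
  have hq0 : 0 ≤ q := by positivity
  have hh := (quadWeight_pos k).le
  set B := α + (-1) ^ k * β with hBdef
  have hch : ∀ i, ((t + 3).choose i : ℝ) ≤ 2 ^ (t + 3) := fun i => by
    exact_mod_cast Nat.choose_le_two_pow (t + 3) i
  have e1 : ((k + σ : ℤ) : ℝ) ^ (t + 3) * M k - (k + (t + 3 : ℕ) * σ) * B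
      = ∑ i ∈ Finset.range (t + 1), ((t + 3).choose i : ℝ) * ((k : ℝ) ^ i * M k * σ ^ (t + 3 - i))
        + ((t + 3).choose (t + 1) : ℝ) * ((k : ℝ) ^ (t + 1) * M k * σ ^ 2)
        + ((t + 3 : ℕ) : ℝ) * (((k : ℝ) ^ (t + 2) * M k - B) * σ) + e k := by
    push_cast
    rw [add_pow, Finset.sum_range_succ, Finset.sum_range_succ, Finset.sum_range_succ]
    rw [add_mul, add_mul, add_mul, Finset.sum_mul]
    have c1 : (t + 3).choose (t + 2) = t + 3 := Nat.choose_succ_self_right (t + 2)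
    rw [c1, Nat.choose_self, show t + 3 - (t + 1) = 2 by omega, show t + 3 - (t + 2) = 1 by omega,
      Nat.sub_self]
    have c2 : ∀ i, (k : ℝ) ^ i * (σ : ℝ) ^ (t + 3 - i) * ((t + 3).choose i : ℝ) * M k
        = ((t + 3).choose i : ℝ) * ((k : ℝ) ^ i * M k * σ ^ (t + 3 - i)) := fun i => by ring
    simp only [c2]
    push_cast
    linear_combination hM k
  have b1 : |∑ i ∈ Finset.range (t + 1),
      ((t + 3).choose i : ℝ) * ((k : ℝ) ^ i * M k * σ ^ (t + 3 - i))|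
      ≤ 2 ^ (t + 3) * D * (|(σ : ℝ)| ^ (t + 3) * quadWeight k) := by
    refine (Finset.abs_sum_le_sum_abs _ _).trans ?_
    have : ∀ i ∈ Finset.range (t + 1),
        |((t + 3).choose i : ℝ) * ((k : ℝ) ^ i * M k * σ ^ (t + 3 - i))|
        ≤ ((t + 3).choose i : ℝ) * (D * (|(σ : ℝ)| ^ (t + 3) * quadWeight k)) := by
      intro i hi
      rw [abs_mul, Nat.abs_cast, abs_mul _ ((σ : ℝ) ^ _), abs_pow (σ : ℝ)]
      refine mul_le_mul_of_nonneg_left ?_ (Nat.cast_nonneg _)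
      have h4 := h1 i (Nat.lt_succ_iff.1 (Finset.mem_range.1 hi)) k
      have h5 : |(σ : ℝ)| ^ (t + 3 - i) ≤ |(σ : ℝ)| ^ (t + 3) :=
        pow_le_pow_right₀ hσ1 (by omega)
      calc _ ≤ (D * quadWeight k) * |(σ : ℝ)| ^ (t + 3) := by gcongr
        _ = _ := by ring
    refine (Finset.sum_le_sum this).trans ?_
    rw [← Finset.sum_mul, mul_assoc (2 ^ (t + 3))]
    refine mul_le_mul_of_nonneg_right ?_ (by positivity)
    have h6 : ∑ i ∈ Finset.range (t + 1), (t + 3).choose i ≤ 2 ^ (t + 3) := by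
      rw [← Nat.sum_range_choose (t + 3)]
      exact Finset.sum_le_sum_of_subset (Finset.range_mono (by omega))
    exact_mod_cast h6
  have b2 : |((t + 3).choose (t + 1) : ℝ) * ((k : ℝ) ^ (t + 1) * M k * σ ^ 2)|
      ≤ 2 ^ (t + 3) * D * (|(σ : ℝ)| ^ 2 * q) := by
    rw [abs_mul, Nat.abs_cast, abs_mul _ ((σ : ℝ) ^ _), abs_pow (σ : ℝ)]
    calc _ ≤ (2 : ℝ) ^ (t + 3) * (D * q * |(σ : ℝ)| ^ 2) :=
          mul_le_mul (hch _) (mul_le_mul_of_nonneg_right (h2 k) (by positivity)) (by positivity)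
            (by positivity)
      _ = _ := by ring
  have hσ2 : |(σ : ℝ)| ≤ |(σ : ℝ)| ^ 2 := by nlinarith
  have b3 : |((t + 3 : ℕ) : ℝ) * (((k : ℝ) ^ (t + 2) * M k - B) * σ)|
      ≤ 2 ^ (t + 3) * D * (|(σ : ℝ)| ^ 2 * q) := by
    rw [abs_mul, Nat.abs_cast, abs_mul]
    have h7 : ((t + 3 : ℕ) : ℝ) ≤ 2 ^ (t + 3) := by exact_mod_cast Nat.lt_two_pow_self.le
    calc _ ≤ (2 : ℝ) ^ (t + 3) * (D * q * |(σ : ℝ)| ^ 2) :=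
          mul_le_mul h7 (mul_le_mul (h3 k) hσ2 (abs_nonneg _) (by positivity)) (by positivity)
            (by positivity)
      _ = _ := by ring
  have b4 : |e k| ≤ 2 ^ (t + 3) * D * (|(σ : ℝ)| ^ 2 * q) := by
    have h8 : |e k| ≤ q := le_add_of_nonneg_left (Real.sqrt_nonneg _)
    have h9 : (1 : ℝ) ≤ 2 ^ (t + 3) * D := one_le_mul_of_one_le_of_one_le
      (one_le_pow₀ one_le_two) hD
    have h10 : q ≤ |(σ : ℝ)| ^ 2 * q := le_mul_of_one_le_left hq0 (one_le_pow₀ hσ1)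
    exact (h8.trans h10).trans (le_mul_of_one_le_left (by positivity) h9)
  rw [e1]
  have tri : ∀ a b c d : ℝ, |a + b + c + d| ≤ |a| + |b| + |c| + |d| := fun a b c d =>
    (abs_add_le _ _).trans (add_le_add ((abs_add_le _ _).trans
      (add_le_add (abs_add_le _ _) le_rfl)) le_rfl)
  refine (tri _ _ _ _).trans ?_
  have h11 : 0 ≤ 2 ^ (t + 3) * D * (|(σ : ℝ)| ^ (t + 3) * quadWeight k) := by positivity
  linarith

/-- The matrix elements `j^s ⟨μ φ_m, φ_j⟩` without their boundary terms. -/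
noncomputable def remKernel (t : ℕ) (M : ℤ → ℝ) (α β : ℝ) (j m : ℕ+) : ℝ :=
  ((j : ℕ) : ℝ) ^ (t + 3) * (M ((j : ℕ) - (m : ℕ)) - M ((j : ℕ) + (m : ℕ)))
    - 2 * (t + 2) * (m : ℕ) * (α + (-1) ^ (j : ℕ) * (-1) ^ (m : ℕ) * β)

/-- Take `(k, σ) = (j-m, m)` and `(j+m, -m)`, so that `k + σ = j` both times. The main terms are `(j
+ (t+2)m)` and `(j - (t+2)m)` times the same factor, since `j-m` and `j+m` have the same parity. In
the difference `j` cancels, and the boundary term grows with `m` only. -/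
theorem exists_remKernel_bound (he : Summable fun k => e k ^ 2)
    (hM : ∀ k : ℤ, (k : ℝ) ^ (t + 3) * M k = k * (α + (-1) ^ k * β) + e k) :
    ∃ C : ℝ, 0 ≤ C ∧ ∀ j m : ℕ+, |remKernel t M α β j m|
      ≤ C * (((m : ℕ) : ℝ) ^ (t + 3) * (quadWeight ((j : ℕ) - (m : ℕ))
          + quadWeight ((j : ℕ) + (m : ℕ)))
        + ((m : ℕ) : ℝ) ^ 2 * ((√(quadWeight ((j : ℕ) - (m : ℕ))) + |e ((j : ℕ) - (m : ℕ))|)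
          + (√(quadWeight ((j : ℕ) + (m : ℕ))) + |e ((j : ℕ) + (m : ℕ))|))) := by
  obtain ⟨C, hC, h⟩ := exists_shifted_bound he hM
  refine ⟨C, hC, fun j m => ?_⟩
  have hm : ((m : ℕ) : ℤ) ≠ 0 := by exact_mod_cast m.ne_zero
  have h1 := h ((j : ℕ) - (m : ℕ)) (m : ℕ) hm
  have h2 := h ((j : ℕ) + (m : ℕ)) (-(m : ℕ)) (neg_ne_zero.2 hm)
  have z1 : (-1 : ℝ) ^ (((j : ℕ) : ℤ) + ((m : ℕ) : ℤ)) = (-1) ^ (j : ℕ) * (-1) ^ (m : ℕ) := by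
    rw [zpow_add₀ (by norm_num), zpow_natCast, zpow_natCast]
  have z2 : (-1 : ℝ) ^ (((j : ℕ) : ℤ) - ((m : ℕ) : ℤ)) = (-1) ^ (j : ℕ) * (-1) ^ (m : ℕ) := by
    rw [zpow_sub₀ (by norm_num), zpow_natCast, zpow_natCast, div_eq_iff (by simp), mul_assoc,
      ← mul_pow]
    simp
  rw [z2, sub_add_cancel] at h1
  rw [z1, add_neg_cancel_right] at h2
  push_cast at h1 h2
  rw [abs_neg] at h2
  rw [Nat.abs_cast] at h1 h2
  have e1 : remKernel t M α β j m
      = (((j : ℕ) : ℝ) ^ (t + 3) * M ((j : ℕ) - (m : ℕ))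
          - ((j : ℕ) - (m : ℕ) + (t + 3) * (m : ℕ)) * (α + (-1) ^ (j : ℕ) * (-1) ^ (m : ℕ) * β))
        - (((j : ℕ) : ℝ) ^ (t + 3) * M ((j : ℕ) + (m : ℕ))
          - ((j : ℕ) + (m : ℕ) + (t + 3) * -(m : ℕ))
            * (α + (-1) ^ (j : ℕ) * (-1) ^ (m : ℕ) * β)) := by
    rw [remKernel]; ring
  rw [e1]
  refine (abs_sub _ _).trans ?_
  refine (add_le_add h1 h2).trans (le_of_eq ?_)
  ring

end Kernel

/-! ### Finite Schur and Young estimates -/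

/-- Schur's test: Cauchy–Schwarz after writing `h = √h √h`, then exchange of the sums. -/
theorem sum_sq_le_of_schur {ι κ : Type*} (F : Finset ι) (G : Finset κ) {h : ι → κ → ℝ} {x : κ → ℝ}
    {H : ℝ} (hh : ∀ j m, 0 ≤ h j m) (h1 : ∀ j, ∑ m ∈ G, h j m ≤ H) (h2 : ∀ m, ∑ j ∈ F, h j m ≤ H)
    (hH : 0 ≤ H) :
    ∑ j ∈ F, (∑ m ∈ G, h j m * x m) ^ 2 ≤ H ^ 2 * ∑ m ∈ G, x m ^ 2 := by
  have key : ∀ j, (∑ m ∈ G, h j m * x m) ^ 2 ≤ H * ∑ m ∈ G, h j m * x m ^ 2 := fun j => by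
    have := Finset.sum_mul_sq_le_sq_mul_sq G (fun m => √(h j m)) (fun m => √(h j m) * x m)
    simp only [← mul_assoc, Real.mul_self_sqrt (hh j _), Real.sq_sqrt (hh j _), mul_pow] at this
    refine this.trans (mul_le_mul_of_nonneg_right (h1 j) ?_)
    exact Finset.sum_nonneg fun m _ => mul_nonneg (hh j m) (sq_nonneg _)
  calc _ ≤ ∑ j ∈ F, H * ∑ m ∈ G, h j m * x m ^ 2 := Finset.sum_le_sum fun j _ => key j
    _ = H * ∑ m ∈ G, (∑ j ∈ F, h j m) * x m ^ 2 := by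
        rw [← Finset.mul_sum, Finset.sum_comm]
        simp only [Finset.sum_mul]
    _ ≤ H * ∑ m ∈ G, H * x m ^ 2 := by
        gcongr with m _
        exact h2 m
    _ = _ := by rw [← Finset.mul_sum]; ring

/-- The bound of `ℓ¹` against `ℓ²`: Cauchy–Schwarz for the weight `z`, then exchange of the sums. -/
theorem sum_sq_le_of_young {ι κ : Type*} (F : Finset ι) (G : Finset κ) {q : ι → κ → ℝ} {z : κ → ℝ}
    {Z Q : ℝ} (hz : ∀ m, 0 ≤ z m) (h1 : ∑ m ∈ G, z m ≤ Z) (h2 : ∀ m, ∑ j ∈ F, q j m ^ 2 ≤ Q)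
    (hZ : 0 ≤ Z) (hQ : 0 ≤ Q) :
    ∑ j ∈ F, (∑ m ∈ G, z m * q j m) ^ 2 ≤ Z ^ 2 * Q := by
  have key : ∀ j, (∑ m ∈ G, z m * q j m) ^ 2 ≤ Z * ∑ m ∈ G, z m * q j m ^ 2 := fun j => by
    have := Finset.sum_mul_sq_le_sq_mul_sq G (fun m => √(z m)) (fun m => √(z m) * q j m)
    simp only [← mul_assoc, Real.mul_self_sqrt (hz _), Real.sq_sqrt (hz _), mul_pow] at this
    refine this.trans (mul_le_mul_of_nonneg_right h1 ?_)
    exact Finset.sum_nonneg fun m _ => mul_nonneg (hz m) (sq_nonneg _)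
  calc _ ≤ ∑ j ∈ F, Z * ∑ m ∈ G, z m * q j m ^ 2 := Finset.sum_le_sum fun j _ => key j
    _ = Z * ∑ m ∈ G, z m * ∑ j ∈ F, q j m ^ 2 := by
        rw [← Finset.mul_sum, Finset.sum_comm]
        simp only [Finset.mul_sum]
    _ ≤ Z * ∑ m ∈ G, z m * Q := by
        gcongr with m _
        · exact hz m
        · exact h2 m
    _ = Z * ((∑ m ∈ G, z m) * Q) := by rw [Finset.sum_mul]
    _ ≤ Z * (Z * Q) := by gcongr
    _ = _ := by ring

theorem sum_comp_le_tsum {ι κ : Type*} {f : κ → ℝ} (hf : Summable f) (h0 : ∀ k, 0 ≤ f k)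
    {σ : ι → κ} (hσ : Function.Injective σ) (F : Finset ι) : ∑ j ∈ F, f (σ j) ≤ ∑' k, f k := by
  have h1 := Finset.sum_map F ⟨σ, hσ⟩ f
  exact h1.symm.le.trans (hf.sum_le_tsum _ fun k _ => h0 k)

theorem sub_left_injective_pnat (m : ℕ+) :
    Function.Injective fun j : ℕ+ => ((j : ℕ) : ℤ) - (m : ℕ) := fun a b h => by
  have : ((a : ℕ) : ℤ) = (b : ℕ) := by simpa using h
  exact_mod_cast this

theorem sub_right_injective_pnat (j : ℕ+) :
    Function.Injective fun m : ℕ+ => ((j : ℕ) : ℤ) - (m : ℕ) := fun a b h => by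
  have : ((a : ℕ) : ℤ) = (b : ℕ) := by simpa using h
  exact_mod_cast this

theorem add_left_injective_pnat (m : ℕ+) :
    Function.Injective fun j : ℕ+ => ((j : ℕ) : ℤ) + (m : ℕ) := fun a b h => by
  have : ((a : ℕ) : ℤ) = (b : ℕ) := by simpa using h
  exact_mod_cast this

theorem add_right_injective_pnat (j : ℕ+) :
    Function.Injective fun m : ℕ+ => ((j : ℕ) : ℤ) + (m : ℕ) := fun a b h => by
  have : ((a : ℕ) : ℤ) = (b : ℕ) := by simpa using h
  exact_mod_cast this

namespace HZero

/-- The coefficients of elements of `H^s_(0)`, `s ≥ 3`, are summable with weight `m²`. -/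
theorem exists_sum_sq_mul_coef_le (t : ℕ) : ∃ Z : ℝ, 0 ≤ Z ∧ ∀ (φ : HZero (t + 3)) (G : Finset ℕ+),
    ∑ m ∈ G, ((m : ℕ) : ℝ) ^ 2 * ‖coef (t + 3) m φ‖ ≤ Z * ‖φ‖ := by
  refine ⟨√(∑' j : ℕ+, ((((j : ℕ) : ℝ)) ^ 2)⁻¹), Real.sqrt_nonneg _, fun φ G => ?_⟩
  refine le_of_sq_le_sq ?_ (by positivity)
  rw [mul_pow, Real.sq_sqrt (tsum_nonneg fun _ => by positivity)]
  have h1 : ∑ m ∈ G, ((m : ℕ) : ℝ) ^ 2 * ‖coef (t + 3) m φ‖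
      ≤ ∑ m ∈ G, (((m : ℕ) : ℝ))⁻¹ * (((m : ℕ) : ℝ) ^ (t + 3) * ‖coef (t + 3) m φ‖) := by
    refine Finset.sum_le_sum fun m _ => ?_
    rw [← mul_assoc]
    refine mul_le_mul_of_nonneg_right ?_ (norm_nonneg _)
    have hm : (1 : ℝ) ≤ (m : ℕ) := by exact_mod_cast m.pos
    rw [pow_succ _ (t + 2), mul_comm _ ((m : ℕ) : ℝ), inv_mul_cancel_left₀ (by positivity)]
    exact pow_le_pow_right₀ hm (by omega)
  have h2 := Finset.sum_mul_sq_le_sq_mul_sq G (fun m : ℕ+ => (((m : ℕ) : ℝ))⁻¹)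
    (fun m => ((m : ℕ) : ℝ) ^ (t + 3) * ‖coef (t + 3) m φ‖)
  refine (pow_le_pow_left₀ (Finset.sum_nonneg fun _ _ => by positivity) h1 2).trans (h2.trans ?_)
  refine mul_le_mul ?_ (sum_coef_sq_le φ G) (Finset.sum_nonneg fun _ _ => by positivity)
    (tsum_nonneg fun _ => by positivity)
  simp only [inv_pow]
  exact summable_inv_sq_pnat.sum_le_tsum _ fun _ _ => by positivity

/-- For `ε = 1` and `ε_m = (-1)^m` these functionals are multiples of `φ'(0)` and `φ'(1)`, the
traces through which the boundary terms depend on `φ`. -/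
theorem exists_functional (t : ℕ) (ε : ℕ+ → ℂ) (hε : ∀ m, ‖ε m‖ ≤ 1) :
    ∃ L : HZero (t + 3) →L[ℂ] ℂ, ∀ φ,
      HasSum (fun m : ℕ+ => ((m : ℕ) : ℂ) * ε m * coef (t + 3) m φ) (L φ) := by
  obtain ⟨Z, hZ, h⟩ := exists_sum_sq_mul_coef_le t
  have h1 : ∀ (φ : HZero (t + 3)) (m : ℕ+), ‖((m : ℕ) : ℂ) * ε m * coef (t + 3) m φ‖
      ≤ ((m : ℕ) : ℝ) ^ 2 * ‖coef (t + 3) m φ‖ := fun φ m => by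
    rw [norm_mul, norm_mul, Complex.norm_natCast]
    refine mul_le_mul_of_nonneg_right ?_ (norm_nonneg _)
    have hm : (1 : ℝ) ≤ (m : ℕ) := by exact_mod_cast m.pos
    nlinarith [hε m, norm_nonneg (ε m)]
  have h2 : ∀ φ : HZero (t + 3), Summable fun m : ℕ+ => ((m : ℕ) : ℝ) ^ 2 * ‖coef (t + 3) m φ‖ :=
    fun φ => summable_of_sum_le (fun _ => by positivity) (h φ)
  have h3 : ∀ φ : HZero (t + 3), Summable fun m : ℕ+ =>
      ((m : ℕ) : ℂ) * ε m * coef (t + 3) m φ := fun φ => Summable.of_norm_bounded (h2 φ) (h1 φ)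
  refine ⟨LinearMap.mkContinuous
    { toFun := fun φ => ∑' m : ℕ+, ((m : ℕ) : ℂ) * ε m * coef (t + 3) m φ
      map_add' := fun φ ψ => by
        simp only [map_add, mul_add]
        exact (h3 φ).tsum_add (h3 ψ)
      map_smul' := fun c φ => by
        simp only [map_smul, smul_eq_mul, RingHom.id_apply, ← tsum_mul_left]
        exact tsum_congr fun m => by ring } Z fun φ => ?_, fun φ => (h3 φ).hasSum⟩
  refine (tsum_of_norm_bounded (h2 φ).hasSum (h1 φ)).trans ?_
  exact (h2 φ).tsum_le_of_sum_le (h φ)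

/-- In the kernel bound, the part with weight `m^{t+3}` is a summable convolution kernel acting on a
square summable sequence (Schur); the part with weight `m²` is a square summable kernel acting on
the summable sequence `m² |⟨φ, φ_m⟩|` (Young). The bound is uniform in the two finite sets, so that
they can be enlarged independently. -/
theorem exists_sum_remKernel_le {t : ℕ} {M e : ℤ → ℝ} {α β : ℝ} (he : Summable fun k => e k ^ 2)
    (hM : ∀ k : ℤ, (k : ℝ) ^ (t + 3) * M k = k * (α + (-1) ^ k * β) + e k) :
    ∃ C : ℝ, 0 ≤ C ∧ ∀ (φ : HZero (t + 3)) (F G : Finset ℕ+),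
      ∑ j ∈ F, (∑ m ∈ G, |remKernel t M α β j m| * ‖coef (t + 3) m φ‖) ^ 2 ≤ (C * ‖φ‖) ^ 2 := by
  obtain ⟨C, hC, hK⟩ := exists_remKernel_bound he hM
  obtain ⟨Z, hZ, hz⟩ := exists_sum_sq_mul_coef_le t
  set H := ∑' k, quadWeight k with hH
  have hH0 : 0 ≤ H := tsum_nonneg fun k => (quadWeight_pos k).le
  have hQs : Summable fun k => (√(quadWeight k) + |e k|) ^ 2 := by
    refine Summable.of_nonneg_of_le (fun _ => sq_nonneg _) (fun k => ?_)
      ((summable_quadWeight.mul_left 2).add (he.mul_left 2))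
    have h1 := Real.sq_sqrt (quadWeight_pos k).le
    nlinarith [sq_nonneg (√(quadWeight k) - |e k|), sq_abs (e k)]
  set Q := ∑' k, (√(quadWeight k) + |e k|) ^ 2 with hQ
  have hQ0 : 0 ≤ Q := tsum_nonneg fun k => sq_nonneg _
  -- The `4` comes from the square of a sum of four terms; each of the two estimates is used twice,
  -- for `j - m` and for `j + m`.
  refine ⟨C * √(4 * H ^ 2 * 2 + 4 * Z ^ 2 * Q * 2), by positivity, fun φ F G => ?_⟩
  set x : ℕ+ → ℝ := fun m => ((m : ℕ) : ℝ) ^ (t + 3) * ‖coef (t + 3) m φ‖ with hx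
  set z : ℕ+ → ℝ := fun m => ((m : ℕ) : ℝ) ^ 2 * ‖coef (t + 3) m φ‖ with hzdef
  have hz0 : ∀ m, 0 ≤ z m := fun m => by positivity
  have hX : ∑ m ∈ G, x m ^ 2 ≤ ‖φ‖ ^ 2 := sum_coef_sq_le φ G
  have s1 := sum_sq_le_of_schur F G (h := fun j m => quadWeight (((j : ℕ) : ℤ) - (m : ℕ))) (x := x)
    (fun _ _ => (quadWeight_pos _).le)
    (fun j => sum_comp_le_tsum summable_quadWeight (fun k => (quadWeight_pos k).le)
      (sub_right_injective_pnat j) G)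
    (fun m => sum_comp_le_tsum summable_quadWeight (fun k => (quadWeight_pos k).le)
      (sub_left_injective_pnat m) F) hH0
  have s2 := sum_sq_le_of_schur F G (h := fun j m => quadWeight (((j : ℕ) : ℤ) + (m : ℕ))) (x := x)
    (fun _ _ => (quadWeight_pos _).le)
    (fun j => sum_comp_le_tsum summable_quadWeight (fun k => (quadWeight_pos k).le)
      (add_right_injective_pnat j) G)
    (fun m => sum_comp_le_tsum summable_quadWeight (fun k => (quadWeight_pos k).le)
      (add_left_injective_pnat m) F) hH0
  have s3 := sum_sq_le_of_young F G (z := z)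
    (q := fun j m => √(quadWeight (((j : ℕ) : ℤ) - (m : ℕ))) + |e (((j : ℕ) : ℤ) - (m : ℕ))|)
    hz0 (hz φ G) (fun m => sum_comp_le_tsum hQs (fun _ => sq_nonneg _)
      (sub_left_injective_pnat m) F) (by positivity) hQ0
  have s4 := sum_sq_le_of_young F G (z := z)
    (q := fun j m => √(quadWeight (((j : ℕ) : ℤ) + (m : ℕ))) + |e (((j : ℕ) : ℤ) + (m : ℕ))|)
    hz0 (hz φ G) (fun m => sum_comp_le_tsum hQs (fun _ => sq_nonneg _)
      (add_left_injective_pnat m) F) (by positivity) hQ0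
  set A : ℕ+ → ℝ := fun j => ∑ m ∈ G, quadWeight (((j : ℕ) : ℤ) - (m : ℕ)) * x m with hA
  set B : ℕ+ → ℝ := fun j => ∑ m ∈ G, quadWeight (((j : ℕ) : ℤ) + (m : ℕ)) * x m with hB
  set U : ℕ+ → ℝ := fun j => ∑ m ∈ G, z m *
    (√(quadWeight (((j : ℕ) : ℤ) - (m : ℕ))) + |e (((j : ℕ) : ℤ) - (m : ℕ))|) with hU
  set V : ℕ+ → ℝ := fun j => ∑ m ∈ G, z m *
    (√(quadWeight (((j : ℕ) : ℤ) + (m : ℕ))) + |e (((j : ℕ) : ℤ) + (m : ℕ))|) with hV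
  have h1 : ∀ j, ∑ m ∈ G, |remKernel t M α β j m| * ‖coef (t + 3) m φ‖
      ≤ C * (A j + B j + U j + V j) := by
    intro j
    rw [hA, hB, hU, hV]
    simp only [← Finset.sum_add_distrib, Finset.mul_sum]
    refine Finset.sum_le_sum fun m _ => ?_
    refine (mul_le_mul_of_nonneg_right (hK j m) (norm_nonneg _)).trans (le_of_eq ?_)
    simp only [hx, hzdef]
    ring
  have four : ∀ a b c d : ℝ, (a + b + c + d) ^ 2 ≤ 4 * a ^ 2 + 4 * b ^ 2 + 4 * c ^ 2 + 4 * d ^ 2 :=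
    fun a b c d => by
      nlinarith [sq_nonneg (a - b), sq_nonneg (a - c), sq_nonneg (a - d), sq_nonneg (b - c),
        sq_nonneg (b - d), sq_nonneg (c - d)]
  have h2 : ∀ j, (∑ m ∈ G, |remKernel t M α β j m| * ‖coef (t + 3) m φ‖) ^ 2
      ≤ C ^ 2 * (4 * A j ^ 2 + 4 * B j ^ 2 + 4 * U j ^ 2 + 4 * V j ^ 2) := by
    intro j
    refine (pow_le_pow_left₀ (Finset.sum_nonneg fun _ _ => by positivity) (h1 j) 2).trans ?_
    rw [mul_pow]
    exact mul_le_mul_of_nonneg_left (four _ _ _ _) (sq_nonneg C)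
  refine (Finset.sum_le_sum fun j _ => h2 j).trans ?_
  rw [← Finset.mul_sum, Finset.sum_add_distrib, Finset.sum_add_distrib, Finset.sum_add_distrib,
    ← Finset.mul_sum, ← Finset.mul_sum, ← Finset.mul_sum, ← Finset.mul_sum, mul_pow, mul_pow,
    Real.sq_sqrt (by positivity), mul_assoc]
  refine mul_le_mul_of_nonneg_left ?_ (sq_nonneg C)
  have hX' := mul_le_mul_of_nonneg_left hX (sq_nonneg H)
  rw [mul_pow] at s3 s4
  linarith

end HZero

/-! ### Multiplication by the dipolar moment -/

section Multiplication

variable {m : ℕ} {μ : ℝ → ℝ}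

theorem MemSobolev.memLp_mul (hμ : MemSobolev (m + 1) μ) (φ : L2) :
    MemLp (fun x => (μ x : ℂ) * φ x) 2 (volume.restrict (Ioo (0 : ℝ) 1)) := by
  obtain ⟨B, hB⟩ := hμ.exists_bound
  refine (Lp.memLp φ).of_le_mul (c := B)
    (hμ.1.ofReal.aestronglyMeasurable.mul (Lp.aestronglyMeasurable φ)) ?_
  filter_upwards [hB] with x hx
  rw [norm_mul, Complex.norm_real]
  gcongr

theorem MemSobolev.coeFn_mulL2 (hμ : MemSobolev (m + 1) μ) (φ : L2) :
    mulL2 μ φ =ᵐ[volume.restrict (Ioo (0 : ℝ) 1)] fun x => (μ x : ℂ) * φ x := by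
  rw [mulL2, dif_pos (hμ.memLp_mul φ)]
  exact (hμ.memLp_mul φ).coeFn_toLp

theorem MemSobolev.exists_mulL (hμ : MemSobolev (m + 1) μ) :
    ∃ L : L2 →L[ℂ] L2, ∀ φ, L φ = mulL2 μ φ := by
  obtain ⟨B, hB⟩ := hμ.exists_bound
  refine ⟨LinearMap.mkContinuous
    { toFun := mulL2 μ
      map_add' := fun φ ψ => ?_
      map_smul' := fun c φ => ?_ } (max B 0) fun φ => ?_, fun φ => rfl⟩
  · refine Lp.ext ?_
    filter_upwards [hμ.coeFn_mulL2 (φ + ψ), hμ.coeFn_mulL2 φ, hμ.coeFn_mulL2 ψ,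
      Lp.coeFn_add φ ψ, Lp.coeFn_add (mulL2 μ φ) (mulL2 μ ψ)] with x h1 h2 h3 h4 h5
    rw [h1, h5, Pi.add_apply, h2, h3, h4, Pi.add_apply, mul_add]
  · refine Lp.ext ?_
    filter_upwards [hμ.coeFn_mulL2 (c • φ), hμ.coeFn_mulL2 φ,
      Lp.coeFn_smul c φ, Lp.coeFn_smul c (mulL2 μ φ)] with x h1 h2 h3 h4
    rw [RingHom.id_apply, h1, h4, Pi.smul_apply, h2, h3, Pi.smul_apply, smul_eq_mul, smul_eq_mul,
      mul_left_comm]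
  · refine Lp.norm_le_mul_norm_of_ae_le_mul ?_
    filter_upwards [hB, hμ.coeFn_mulL2 φ] with x hx h1
    change ‖(mulL2 μ φ : ℝ → ℂ) x‖ ≤ _
    rw [h1, norm_mul, Complex.norm_real]
    gcongr
    exact hx.trans (le_max_left _ _)

theorem MemSobolev.inner_mulL2_eigenfun (hμ : MemSobolev (m + 1) μ) (i j : ℕ+) :
    inner ℂ (eigenfun j) (mulL2 μ (eigenfun i))
      = ((cosCoef μ ((j : ℕ) - (i : ℕ)) - cosCoef μ ((j : ℕ) + (i : ℕ)) : ℝ) : ℂ) := by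
  rw [inner_eigenfun]
  have h1 : ∫ x in Ioo (0 : ℝ) 1,
      ((√2 * Real.sin ((j : ℕ) * Real.pi * x) : ℝ) : ℂ) * (mulL2 μ (eigenfun i) : ℝ → ℂ) x
      = ∫ x in Ioo (0 : ℝ) 1, ((μ x * Real.cos ((((j : ℕ) : ℤ) - (i : ℕ) : ℤ) * Real.pi * x)
        - μ x * Real.cos ((((j : ℕ) : ℤ) + (i : ℕ) : ℤ) * Real.pi * x) : ℝ) : ℂ) := by
    refine integral_congr_ae ?_
    filter_upwards [(sinFun_memLp i).coeFn_toLp, hμ.coeFn_mulL2 (eigenfun i)] with x hx h2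
    have hx' : (eigenfun i : ℝ → ℂ) x = sinFun i x := hx
    rw [h2, hx', sinFun, ← Complex.ofReal_mul, ← Complex.ofReal_mul]
    congr 1
    have e1 : ((((j : ℕ) : ℤ) - (i : ℕ) : ℤ) : ℝ) * Real.pi * x
        = (j : ℕ) * Real.pi * x - (i : ℕ) * Real.pi * x := by push_cast; ring
    have e2 : ((((j : ℕ) : ℤ) + (i : ℕ) : ℤ) : ℝ) * Real.pi * x
        = (j : ℕ) * Real.pi * x + (i : ℕ) * Real.pi * x := by push_cast; ring
    rw [e1, e2, Real.cos_sub, Real.cos_add]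
    have := Real.mul_self_sqrt (show (0 : ℝ) ≤ 2 by norm_num)
    linear_combination (μ x * Real.sin ((i : ℕ) * Real.pi * x)
      * Real.sin ((j : ℕ) * Real.pi * x)) * this
  have hi : ∀ k : ℤ, IntervalIntegrable (fun x => μ x * Real.cos (k * Real.pi * x)) volume 0 1 :=
    fun k => (intervalIntegrable_of_memLp hμ.1).mul_continuousOn (by fun_prop)
  rw [h1, integral_complex_ofReal, ← integral_Ioc_eq_integral_Ioo,
    ← intervalIntegral.integral_of_le zero_le_one,
    intervalIntegral.integral_sub (hi _) (hi _)]
  rfl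

theorem MemSobolev.hasSum_inner_mulL2 (hμ : MemSobolev (m + 1) μ) (φ : L2) (j : ℕ+) :
    HasSum (fun i : ℕ+ => ((cosCoef μ ((j : ℕ) - (i : ℕ)) - cosCoef μ ((j : ℕ) + (i : ℕ)) : ℝ) : ℂ)
      * inner ℂ (eigenfun i) φ) (inner ℂ (eigenfun j) (mulL2 μ φ)) := by
  obtain ⟨L, hL⟩ := hμ.exists_mulL
  have h1 := ((innerSL ℂ (eigenfun j)).comp L).hasSum (eigenbasis.hasSum_repr φ)
  simp only [eigenbasis_repr_apply, coe_eigenbasis, ContinuousLinearMap.comp_apply, map_smul, hL,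
    innerSL_apply_apply, hμ.inner_mulL2_eigenfun, smul_eq_mul] at h1
  simpa only [mul_comm] using h1

end Multiplication

open HZero in
/-- Multiplication by `μ` on `H^{2p+3}_(0)`: up to two boundary terms, its coefficients are those
of an element of `H^{2p+3}_(0)`. -/
theorem exists_mul_decomposition {p : ℕ} {μ : ℝ → ℝ} (hμ : MemSobolev (2 * p + 3) μ)
    (hμ' : ∀ n < p, DerivVanishesAtEnds (2 * n + 1) μ) :
    ∃ (a : HZero (2 * p + 3) →L[ℂ] HZero (2 * p + 3)) (b c : HZero (2 * p + 3) →L[ℂ] ℂ),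
      ∀ (φ : HZero (2 * p + 3)) (j : ℕ+),
        ((j : ℕ) : ℂ) ^ (2 * p + 3) * inner ℂ (eigenfun j) (mulL2 μ φ)
          = ((j : ℕ) : ℂ) ^ (2 * p + 3) * coef (2 * p + 3) j (a φ) + b φ
            + (-1) ^ (j : ℕ) * c φ := by
  obtain ⟨α, β, g, hg, hM⟩ := exists_cosCoef_expansion hμ hμ'
  obtain ⟨C, hC, hK⟩ := exists_sum_remKernel_le (t := 2 * p) (summable_sinCoef_sq hg) hM
  obtain ⟨L₁, hL₁⟩ := exists_functional (2 * p) (fun _ => 1) (by simp)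
  obtain ⟨L₂, hL₂⟩ := exists_functional (2 * p) (fun m => (-1) ^ (m : ℕ)) (by simp)
  set b : HZero (2 * p + 3) →L[ℂ] ℂ := ((2 * (2 * p + 2) * α : ℝ) : ℂ) • L₁ with hb
  set c : HZero (2 * p + 3) →L[ℂ] ℂ := ((2 * (2 * p + 2) * β : ℝ) : ℂ) • L₂ with hc
  have hs : ∀ (φ : HZero (2 * p + 3)) (j : ℕ+),
      HasSum (fun m : ℕ+ => ((remKernel (2 * p) (cosCoef μ) α β j m : ℝ) : ℂ)
        * coef (2 * p + 3) m φ)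
        (((j : ℕ) : ℂ) ^ (2 * p + 3) * inner ℂ (eigenfun j) (mulL2 μ φ) - b φ
          - (-1) ^ (j : ℕ) * c φ) := by
    intro φ j
    have h1 := (MemSobolev.hasSum_inner_mulL2 (m := 2 * p + 2) hμ (φ : L2) j).mul_left
      (((j : ℕ) : ℂ) ^ (2 * p + 3))
    have h2 := (hL₁ φ).mul_left ((2 * (2 * p + 2) * α : ℝ) : ℂ)
    have h3 := ((hL₂ φ).mul_left ((2 * (2 * p + 2) * β : ℝ) : ℂ)).mul_left ((-1 : ℂ) ^ (j : ℕ))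
    refine ((h1.sub h2).sub h3).congr_fun ?_
    intro m
    simp only [coef_apply, remKernel]
    push_cast
    ring
  have key : ∀ φ : HZero (2 * p + 3), ∃ ψ : HZero (2 * p + 3),
      (∀ j : ℕ+, coef (2 * p + 3) j ψ = (((j : ℕ) : ℂ) ^ (2 * p + 3))⁻¹
        * (((j : ℕ) : ℂ) ^ (2 * p + 3) * inner ℂ (eigenfun j) (mulL2 μ φ) - b φ
          - (-1) ^ (j : ℕ) * c φ)) ∧ ‖ψ‖ ≤ C * ‖φ‖ := by
    intro φ
    refine exists_of_sum_le (by positivity) fun F => ?_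
    have hw : ∀ j : ℕ+, (((j : ℕ) : ℂ) ^ (2 * p + 3)) ≠ 0 := fun j =>
      pow_ne_zero _ (by exact_mod_cast j.ne_zero)
    simp only [← norm_weight, mul_inv_cancel_left₀ (hw _)]
    -- With `F` fixed, the series over `m` are replaced by their partial sums over `G`, for which
    -- the bound is uniform.
    refine le_of_tendsto (tendsto_finsetSum F fun j _ => ((hs φ j).norm.pow 2))
      (Filter.Eventually.of_forall fun G => ?_)
    refine le_trans (Finset.sum_le_sum fun j _ => ?_) (hK φ F G)
    refine pow_le_pow_left₀ (norm_nonneg _) ((norm_sum_le _ _).trans (le_of_eq ?_)) 2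
    refine Finset.sum_congr rfl fun m _ => ?_
    rw [norm_mul, Complex.norm_real, Real.norm_eq_abs]
  have hw : ∀ j : ℕ+, (((j : ℕ) : ℂ) ^ (2 * p + 3)) ≠ 0 := fun j =>
    pow_ne_zero _ (by exact_mod_cast j.ne_zero)
  obtain ⟨Lμ, hLμ⟩ := MemSobolev.exists_mulL (m := 2 * p + 2) hμ
  choose a ha1 ha2 using key
  refine ⟨LinearMap.mkContinuous
    { toFun := a
      map_add' := fun φ ψ => ext_coef fun j => ?_
      map_smul' := fun z φ => ext_coef fun j => ?_ } C ha2, b, c, fun φ j => ?_⟩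
  · simp only [map_add, ha1, ← hLμ, inner_add_right]
    ring
  · simp only [map_smul, ha1, ← hLμ, inner_smul_right, RingHom.id_apply, smul_eq_mul]
    ring
  · change _ = ((j : ℕ) : ℂ) ^ (2 * p + 3) * coef (2 * p + 3) j (a φ) + _ + _
    rw [ha1, mul_inv_cancel_left₀ (hw j)]
    ring

/-! ### A Bessel inequality for the phases -/

theorem phase_neg_mul (j k : ℕ+) (t : ℝ) : phase (-t) j * phase t k
    = Complex.exp ((Complex.I * ((eigenval j - eigenval k : ℝ) : ℂ)) * t) := by
  rw [phase, phase, ← Complex.exp_add]; congr 1; push_cast; ring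

theorem conj_phase (t : ℝ) (j : ℕ+) : (starRingEnd ℂ) (phase t j) = phase (-t) j := by
  rw [phase, phase, ← Complex.exp_conj]
  simp

theorem eigenval_injective {j k : ℕ+} (h : eigenval j = eigenval k) : j = k := by
  unfold eigenval at h
  have h1 := (pow_left_inj₀ (by positivity) (by positivity) two_ne_zero).1 h
  have h2 := mul_right_cancel₀ Real.pi_ne_zero h1
  exact_mod_cast h2

/-- The gaps `λ_j - λ_k` are integer multiples of `π²`, so the products of phases have period `2/π`
and integrate to zero over whole numbers of periods unless `j = k`. -/
theorem integral_phase_neg_mul (N : ℕ) (j k : ℕ+) :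
    ∫ τ in (0 : ℝ)..(N * (2 / Real.pi)), phase (-τ) j * phase τ k
      = if j = k then ((N * (2 / Real.pi) : ℝ) : ℂ) else 0 := by
  simp only [phase_neg_mul]
  split_ifs with h
  · subst h
    simp
  · have hne : Complex.I * ((eigenval j - eigenval k : ℝ) : ℂ) ≠ 0 := by
      refine mul_ne_zero Complex.I_ne_zero ?_
      rw [Complex.ofReal_ne_zero, sub_ne_zero]
      exact fun h' => h (eigenval_injective h')
    rw [integral_exp_mul_complex hne]
    have e : Complex.I * ((eigenval j - eigenval k : ℝ) : ℂ) * ((N * (2 / Real.pi) : ℝ) : ℂ)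
        = ((N * (((j : ℕ) : ℤ) ^ 2 - ((k : ℕ) : ℤ) ^ 2) : ℤ) : ℂ) * (2 * Real.pi * Complex.I) := by
      have hpi : (Real.pi : ℂ) ≠ 0 := by exact_mod_cast Real.pi_ne_zero
      unfold eigenval
      push_cast
      field_simp
    rw [e, Complex.exp_int_mul_two_pi_mul_I]
    simp

/-- On an interval `(0, L)` containing `(0, T)`, with `L` a multiple of `2/π`, the phases divided by
`√L` are orthonormal. Bessel's inequality for `h` extended by zero gives the bound with constant
`L`, for every subinterval at once. -/
theorem exists_bessel_phase (T : ℝ) : ∃ C : ℝ, 0 ≤ C ∧ ∀ a b : ℝ, 0 ≤ a → a ≤ b → b ≤ T →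
    ∀ h : ℝ → ℂ, MemLp h 2 (volume.restrict (Ioc a b)) → ∀ F : Finset ℕ+,
      ∑ j ∈ F, ‖∫ τ in a..b, phase (-τ) j * h τ‖ ^ 2 ≤ C * ∫ τ in a..b, ‖h τ‖ ^ 2 := by
  -- The added `1` keeps `L` positive when `T = 0`; for `T < 0` there is no admissible interval.
  obtain ⟨N, hN⟩ := exists_nat_ge (T / (2 / Real.pi) + 1)
  set L : ℝ := N * (2 / Real.pi) with hL
  have hpi : 0 < 2 / Real.pi := by have := Real.pi_pos; positivity
  have hTL : T ≤ L := by
    have : T / (2 / Real.pi) ≤ N := by linarith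
    rwa [div_le_iff₀ hpi] at this
  by_cases hT0 : T < 0
  · exact ⟨0, le_rfl, fun a b ha hab hb => absurd (ha.trans (hab.trans hb)) (not_le.2 hT0)⟩
  have hL0 : 0 < L := by
    have h1 : (0 : ℝ) ≤ T / (2 / Real.pi) := div_nonneg (not_lt.1 hT0) hpi.le
    have : (0 : ℝ) < N := by linarith
    positivity
  set ν := volume.restrict (Ioc (0 : ℝ) L) with hν
  have hmem : ∀ j, MemLp (fun τ => phase τ j) 2 ν := fun j =>
    MemLp.of_bound (continuous_phase j).aestronglyMeasurable 1
      (Filter.Eventually.of_forall fun τ => (norm_phase τ j).le)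
  set v : ℕ+ → Lp ℂ 2 ν := fun j => ((√L : ℝ) : ℂ)⁻¹ • (hmem j).toLp with hv
  have hsq : ((√L : ℝ) : ℂ) * ((√L : ℝ) : ℂ) = (L : ℂ) := by
    rw [← Complex.ofReal_mul, Real.mul_self_sqrt hL0.le]
  have hsq0 : ((√L : ℝ) : ℂ) ≠ 0 := by
    rw [Complex.ofReal_ne_zero]; exact (Real.sqrt_pos.2 hL0).ne'
  have hinner : ∀ j (f : Lp ℂ 2 ν), inner ℂ (v j) f
      = ((√L : ℝ) : ℂ)⁻¹ * ∫ τ, phase (-τ) j * f τ ∂ν := by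
    intro j f
    rw [hv, inner_smul_left, L2.inner_def, map_inv₀, Complex.conj_ofReal]
    congr 1
    refine integral_congr_ae ?_
    filter_upwards [(hmem j).coeFn_toLp] with τ hτ
    rw [hτ, RCLike.inner_apply, conj_phase, mul_comm]
  have hon : Orthonormal ℂ v := by
    rw [orthonormal_iff_ite]
    intro j k
    have e : ∫ τ, phase (-τ) j * ((hmem k).toLp : ℝ → ℂ) τ ∂ν
        = if j = k then (L : ℂ) else 0 := by
      rw [← integral_phase_neg_mul N j k, intervalIntegral.integral_of_le hL0.le]
      refine integral_congr_ae ?_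
      filter_upwards [(hmem k).coeFn_toLp] with τ hτ
      rw [hτ]
    rw [hv]
    change inner ℂ (v j) (((√L : ℝ) : ℂ)⁻¹ • (hmem k).toLp) = _
    rw [inner_smul_right, hinner, e]
    split_ifs
    · rw [← hsq]; field_simp
    · simp
  refine ⟨L, hL0.le, fun a b ha hab hb h hh F => ?_⟩
  have hsub : Ioc a b ⊆ Ioc 0 L := Ioc_subset_Ioc ha (hb.trans hTL)
  have hres : (ν.restrict (Ioc a b)) = volume.restrict (Ioc a b) := by
    rw [hν, Measure.restrict_restrict measurableSet_Ioc, inter_eq_left.2 hsub]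
  have hind : MemLp ((Ioc a b).indicator h) 2 ν := by
    rw [memLp_indicator_iff_restrict measurableSet_Ioc, hres]
    exact hh
  have h1 := hon.sum_inner_products_le (s := F) (hind.toLp : Lp ℂ 2 ν)
  have h2 : ∀ j, inner ℂ (v j) (hind.toLp : Lp ℂ 2 ν)
      = ((√L : ℝ) : ℂ)⁻¹ * ∫ τ in a..b, phase (-τ) j * h τ := by
    intro j
    have e := integral_indicator (μ := ν) (f := fun τ => phase (-τ) j * h τ)
      (measurableSet_Ioc (a := a) (b := b))
    rw [hinner, intervalIntegral.integral_of_le hab, ← hres, ← e]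
    congr 1
    refine integral_congr_ae ?_
    filter_upwards [hind.coeFn_toLp] with τ hτ
    rw [hτ]
    by_cases hm : τ ∈ Ioc a b
    · rw [indicator_of_mem hm, indicator_of_mem hm]
    · rw [indicator_of_notMem hm, indicator_of_notMem hm, mul_zero]
  have h3 : ‖(hind.toLp : Lp ℂ 2 ν)‖ ^ 2 = ∫ τ in a..b, ‖h τ‖ ^ 2 := by
    have e := integral_indicator (μ := ν) (f := fun τ => ‖h τ‖ ^ 2)
      (measurableSet_Ioc (a := a) (b := b))
    rw [← inner_self_eq_norm_sq (𝕜 := ℂ), L2.inner_def, intervalIntegral.integral_of_le hab, ← hres,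
      ← e]
    have : ∫ τ, inner ℂ ((hind.toLp : Lp ℂ 2 ν) τ) ((hind.toLp : Lp ℂ 2 ν) τ) ∂ν
        = ∫ τ, (((Ioc a b).indicator (fun τ => ‖h τ‖ ^ 2) τ : ℝ) : ℂ) ∂ν := by
      refine integral_congr_ae ?_
      filter_upwards [hind.coeFn_toLp] with τ hτ
      rw [hτ, inner_self_eq_norm_sq_to_K]
      by_cases hm : τ ∈ Ioc a b
      · rw [indicator_of_mem hm, indicator_of_mem hm]; simp
      · rw [indicator_of_notMem hm, indicator_of_notMem hm]; simp
    rw [this, integral_complex_ofReal]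
    rfl
  rw [h3] at h1
  simp only [h2, norm_mul, mul_pow, ← Finset.mul_sum] at h1
  have h4 : ‖((√L : ℝ) : ℂ)⁻¹‖ ^ 2 = L⁻¹ := by
    rw [norm_inv, Complex.norm_real, Real.norm_of_nonneg (Real.sqrt_nonneg _), inv_pow,
      Real.sq_sqrt hL0.le]
  rw [h4, inv_mul_le_iff₀ hL0] at h1
  exact h1

/-! ### Smoothing effect of the Duhamel integral -/

/-- Nonnegativity of the variance of `f` on `[a,b]`. -/
theorem sq_integral_le {f : ℝ → ℝ} {a b : ℝ} (hab : a ≤ b) (hf : IntervalIntegrable f volume a b)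
    (hf2 : IntervalIntegrable (fun x => f x ^ 2) volume a b) :
    (∫ x in a..b, f x) ^ 2 ≤ (b - a) * ∫ x in a..b, f x ^ 2 := by
  rcases hab.eq_or_lt with rfl | h
  · simp
  set I := ∫ x in a..b, f x with hI
  have h0 : 0 ≤ ∫ x in a..b, (f x - I / (b - a)) ^ 2 :=
    intervalIntegral.integral_nonneg hab fun _ _ => sq_nonneg _
  have e : ∀ x, (f x - I / (b - a)) ^ 2 = f x ^ 2 - (2 * (I / (b - a))) * f x + (I / (b - a)) ^ 2 :=
    fun x => by ring
  simp only [e] at h0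
  rw [intervalIntegral.integral_add (hf2.sub (hf.const_mul _)) intervalIntegrable_const,
    intervalIntegral.integral_sub hf2 (hf.const_mul _), intervalIntegral.integral_const_mul,
    intervalIntegral.integral_const, ← hI, smul_eq_mul] at h0
  have hba : 0 < b - a := sub_pos.2 h
  have h1 := mul_nonneg hba.le h0
  have e2 : (b - a) * ((∫ x in a..b, f x ^ 2) - 2 * (I / (b - a)) * I
      + (b - a) * (I / (b - a)) ^ 2) = (b - a) * (∫ x in a..b, f x ^ 2) - I ^ 2 := by
    field_simp
    ring
  rw [e2] at h1
  linarith

/-- The functionals `β_j` on `H^s_(0)` are the coefficients of an operator with values in `H^s_(0)`,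
up to two boundary terms. -/
def IsSmoothing {s : ℕ} (β : ℕ+ → HZero s →L[ℂ] ℂ) : Prop :=
  ∃ (a : HZero s →L[ℂ] HZero s) (b c : HZero s →L[ℂ] ℂ), ∀ (φ : HZero s) (j : ℕ+),
    ((j : ℕ) : ℂ) ^ s * β j φ
      = ((j : ℕ) : ℂ) ^ s * HZero.coef s j (a φ) + b φ + (-1) ^ (j : ℕ) * c φ

theorem memLp_restrict_Ioc {T : ℝ} {u : ℝ → ℝ} (hu : MemLp u 2 (volume.restrict (Ioo (0 : ℝ) T)))
    {a b : ℝ} (ha : 0 ≤ a) (hb : b ≤ T) : MemLp u 2 (volume.restrict (Ioc a b)) := by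
  rw [← Measure.restrict_congr_set (Ioo_ae_eq_Ioc (a := a) (b := b))]
  exact hu.mono_measure (Measure.restrict_mono (Ioo_subset_Ioo ha hb) le_rfl)

theorem intervalIntegrable_of_memLp_Ioo {T : ℝ} {u : ℝ → ℝ}
    (hu : MemLp u 2 (volume.restrict (Ioo (0 : ℝ) T)))
    {a b : ℝ} (ha : 0 ≤ a) (hab : a ≤ b) (hb : b ≤ T) : IntervalIntegrable u volume a b :=
  (intervalIntegrable_iff_integrableOn_Ioc_of_le hab).2
    ((memLp_restrict_Ioc hu ha hb).integrable (by norm_num))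

theorem intervalIntegrable_sq_of_memLp_Ioo {T : ℝ} {u : ℝ → ℝ}
    (hu : MemLp u 2 (volume.restrict (Ioo (0 : ℝ) T)))
    {a b : ℝ} (ha : 0 ≤ a) (hab : a ≤ b) (hb : b ≤ T) :
    IntervalIntegrable (fun x => u x ^ 2) volume a b :=
  (intervalIntegrable_iff_integrableOn_Ioc_of_le hab).2
    ((memLp_restrict_Ioc hu ha hb).integrable_sq)

open HZero in
-- The part with values in `H^s_(0)` is handled by Cauchy–Schwarz in time. The boundary parts,
-- independent of `j` up to sign, are not square summable at any fixed time; their time integrals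
-- against the phases are, by the Bessel inequality. The right side is an integral over `[a,b]`
-- only, which gives both continuity in time and the Volterra property.
theorem IsSmoothing.exists_estimate {s : ℕ} {β : ℕ+ → HZero s →L[ℂ] ℂ} (hβ : IsSmoothing β)
    (T : ℝ) : ∃ C : ℝ, 0 ≤ C ∧ ∀ u : ℝ → ℝ, MemLp u 2 (volume.restrict (Ioo (0 : ℝ) T)) →
      ∀ y : ℝ → HZero s, Continuous y → ∀ a b : ℝ, 0 ≤ a → a ≤ b → b ≤ T → ∀ F : Finset ℕ+,
        ∑ j ∈ F, (((j : ℕ) : ℝ) ^ s * ‖∫ τ in a..b, phase (-τ) j * ((u τ : ℂ) * β j (y τ))‖) ^ 2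
          ≤ C * ∫ τ in a..b, u τ ^ 2 * ‖y τ‖ ^ 2 := by
  obtain ⟨A, B, D, hABD⟩ := hβ
  obtain ⟨C, hC, hbes⟩ := exists_bessel_phase T
  -- The `3` comes from `(x + y + z)² ≤ 3 (x² + y² + z²)`.
  refine ⟨3 * (|T| * ‖A‖ ^ 2) + 3 * (C * ‖B‖ ^ 2) + 3 * (C * ‖D‖ ^ 2), by positivity,
    fun u hu y hy a b ha hab hb F => ?_⟩
  have hui := intervalIntegrable_of_memLp_Ioo hu ha hab hb
  have hui2 := intervalIntegrable_sq_of_memLp_Ioo hu ha hab hb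
  have huc : IntervalIntegrable (fun τ => (u τ : ℂ)) volume a b := ⟨hui.1.ofReal, hui.2.ofReal⟩
  set W := ∫ τ in a..b, u τ ^ 2 * ‖y τ‖ ^ 2 with hW
  have hWi : ∀ f : ℝ → ℝ, Continuous f → IntervalIntegrable (fun τ => u τ ^ 2 * f τ) volume a b :=
    fun f hf => hui2.mul_continuousOn hf.continuousOn
  have hbd : ∀ (L : HZero s →L[ℂ] ℂ),
      ∑ j ∈ F, ‖∫ τ in a..b, phase (-τ) j * ((u τ : ℂ) * L (y τ))‖ ^ 2
      ≤ C * ‖L‖ ^ 2 * W := by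
    intro L
    have hm : MemLp (fun τ => (u τ : ℂ) * L (y τ)) 2 (volume.restrict (Ioc a b)) := by
      obtain ⟨R, hR⟩ := (isCompact_Icc (a := a) (b := b)).exists_bound_of_continuousOn
        (L.continuous.comp hy).continuousOn
      have hm1 := (memLp_restrict_Ioc hu ha hb)
      refine hm1.of_le_mul (c := R) (hm1.ofReal.aestronglyMeasurable.mul
        (L.continuous.comp hy).aestronglyMeasurable) ?_
      filter_upwards [ae_restrict_mem measurableSet_Ioc] with τ hτ
      rw [norm_mul, Complex.norm_real, mul_comm]
      exact mul_le_mul_of_nonneg_right (hR τ (Ioc_subset_Icc_self hτ)) (norm_nonneg _)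
    refine (hbes a b ha hab hb _ hm F).trans ?_
    rw [mul_assoc]
    refine mul_le_mul_of_nonneg_left ?_ hC
    rw [hW, ← intervalIntegral.integral_const_mul]
    have e : ∀ τ, ‖(u τ : ℂ) * L (y τ)‖ ^ 2 = u τ ^ 2 * ‖L (y τ)‖ ^ 2 := fun τ => by
      rw [norm_mul, Complex.norm_real, mul_pow, Real.norm_eq_abs, sq_abs]
    simp only [e]
    refine intervalIntegral.integral_mono_on hab
      (hWi _ ((L.continuous.comp hy).norm.pow 2)) ((hWi _ (hy.norm.pow 2)).const_mul _) ?_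
    intro τ _
    have := pow_le_pow_left₀ (norm_nonneg _) (L.le_opNorm (y τ)) 2
    rw [mul_pow] at this
    nlinarith [mul_le_mul_of_nonneg_left this (sq_nonneg (u τ))]
  have hA : ∑ j ∈ F, ‖∫ τ in a..b, phase (-τ) j
      * ((u τ : ℂ) * (((j : ℕ) : ℂ) ^ s * coef s j (A (y τ))))‖ ^ 2 ≤ |T| * ‖A‖ ^ 2 * W := by
    have hc : ∀ j : ℕ+, Continuous fun τ => ((j : ℕ) : ℝ) ^ s * ‖coef s j (A (y τ))‖ := fun j =>
      continuous_const.mul ((coef s j).continuous.comp (A.continuous.comp hy)).norm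
    have hc2 : ∀ j : ℕ+, Continuous fun τ => (((j : ℕ) : ℝ) ^ s * ‖coef s j (A (y τ))‖) ^ 2 :=
      fun j => (hc j).pow 2
    have h1 : ∀ j : ℕ+, ‖∫ τ in a..b, phase (-τ) j
        * ((u τ : ℂ) * (((j : ℕ) : ℂ) ^ s * coef s j (A (y τ))))‖ ^ 2
        ≤ |T| * ∫ τ in a..b, u τ ^ 2 * (((j : ℕ) : ℝ) ^ s * ‖coef s j (A (y τ))‖) ^ 2 := by
      intro j
      have e : ∀ τ, ‖phase (-τ) j * ((u τ : ℂ) * (((j : ℕ) : ℂ) ^ s * coef s j (A (y τ))))‖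
          = |u τ| * (((j : ℕ) : ℝ) ^ s * ‖coef s j (A (y τ))‖) := fun τ => by
        rw [norm_mul, norm_phase, one_mul, norm_mul, norm_weight, Complex.norm_real,
          Real.norm_eq_abs]
      have h2 := intervalIntegral.norm_integral_le_integral_norm (μ := volume) (f := fun τ =>
        phase (-τ) j * ((u τ : ℂ) * (((j : ℕ) : ℂ) ^ s * coef s j (A (y τ))))) hab
      simp only [e] at h2
      have e2 : ∀ τ, (|u τ| * (((j : ℕ) : ℝ) ^ s * ‖coef s j (A (y τ))‖)) ^ 2
          = u τ ^ 2 * (((j : ℕ) : ℝ) ^ s * ‖coef s j (A (y τ))‖) ^ 2 := fun τ => by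
        rw [mul_pow, sq_abs]
      have h3 := sq_integral_le hab (hui.abs.mul_continuousOn (hc j).continuousOn) (by
        simp only [e2]
        exact hWi _ (hc2 j))
      simp only [e2] at h3
      refine (pow_le_pow_left₀ (norm_nonneg _) h2 2).trans (h3.trans ?_)
      refine mul_le_mul_of_nonneg_right ?_
        (intervalIntegral.integral_nonneg hab fun _ _ => by positivity)
      linarith [le_abs_self T]
    refine (Finset.sum_le_sum fun j _ => h1 j).trans ?_
    rw [← Finset.mul_sum, mul_assoc]
    refine mul_le_mul_of_nonneg_left ?_ (abs_nonneg T)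
    rw [← intervalIntegral.integral_finsetSum fun j _ => hWi _ (hc2 j), hW,
      ← intervalIntegral.integral_const_mul]
    refine intervalIntegral.integral_mono_on hab ?_ ((hWi _ (hy.norm.pow 2)).const_mul _) ?_
    · simp only [← Finset.mul_sum]
      exact hWi _ (continuous_finsetSum _ fun j _ => hc2 j)
    · intro τ _
      rw [← Finset.mul_sum]
      have h4 := sum_coef_sq_le (A (y τ)) F
      have h5 := pow_le_pow_left₀ (norm_nonneg _) (A.le_opNorm (y τ)) 2
      rw [mul_pow] at h5
      nlinarith [mul_le_mul_of_nonneg_left (h4.trans h5) (sq_nonneg (u τ))]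
  have hB := hbd B
  have hD := hbd D
  have hint : ∀ (j : ℕ+) (f : ℝ → ℂ), Continuous f →
      IntervalIntegrable (fun τ => phase (-τ) j * ((u τ : ℂ) * f τ)) volume a b := by
    intro j f hf
    have h6 := (huc.mul_continuousOn hf.continuousOn).continuousOn_mul
      (((continuous_phase j).comp continuous_neg).continuousOn (s := uIcc a b))
    exact h6
  have hsplit : ∀ j : ℕ+, (((j : ℕ) : ℝ) ^ s
      * ‖∫ τ in a..b, phase (-τ) j * ((u τ : ℂ) * β j (y τ))‖) ^ 2
      ≤ 3 * ‖∫ τ in a..b, phase (-τ) j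
          * ((u τ : ℂ) * (((j : ℕ) : ℂ) ^ s * coef s j (A (y τ))))‖ ^ 2
        + 3 * ‖∫ τ in a..b, phase (-τ) j * ((u τ : ℂ) * B (y τ))‖ ^ 2
        + 3 * ‖∫ τ in a..b, phase (-τ) j * ((u τ : ℂ) * D (y τ))‖ ^ 2 := by
    intro j
    rw [← norm_weight, ← intervalIntegral.integral_const_mul]
    have e : ∀ τ, ((j : ℕ) : ℂ) ^ s * (phase (-τ) j * ((u τ : ℂ) * β j (y τ)))
        = phase (-τ) j * ((u τ : ℂ) * (((j : ℕ) : ℂ) ^ s * coef s j (A (y τ))))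
          + phase (-τ) j * ((u τ : ℂ) * B (y τ))
          + (-1) ^ (j : ℕ) * (phase (-τ) j * ((u τ : ℂ) * D (y τ))) := fun τ => by
      linear_combination (phase (-τ) j * (u τ : ℂ)) * hABD (y τ) j
    simp only [e]
    have i1 := hint j (fun τ => ((j : ℕ) : ℂ) ^ s * coef s j (A (y τ)))
      (continuous_const.mul ((coef s j).continuous.comp (A.continuous.comp hy)))
    have i2 := hint j _ (B.continuous.comp hy)
    have i3 := hint j _ (D.continuous.comp hy)
    have i4 := intervalIntegral.integral_add (i1.add i2) (i3.const_mul ((-1 : ℂ) ^ (j : ℕ)))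
    have i5 := intervalIntegral.integral_add i1 i2
    simp only [Function.comp_apply] at i4 i5
    rw [i4, i5, intervalIntegral.integral_const_mul]
    set x := ∫ τ in a..b, phase (-τ) j * ((u τ : ℂ) * (((j : ℕ) : ℂ) ^ s * coef s j (A (y τ))))
    set z := ∫ τ in a..b, phase (-τ) j * ((u τ : ℂ) * B (y τ))
    set w := ∫ τ in a..b, phase (-τ) j * ((u τ : ℂ) * D (y τ))
    have h7 : ‖x + z + (-1) ^ (j : ℕ) * w‖ ≤ ‖x‖ + ‖z‖ + ‖w‖ := by
      refine (norm_add₃_le).trans (le_of_eq ?_)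
      rw [norm_mul, norm_pow, norm_neg, norm_one, one_pow, one_mul]
    have h8 := pow_le_pow_left₀ (norm_nonneg _) h7 2
    nlinarith [sq_nonneg (‖x‖ - ‖z‖), sq_nonneg (‖x‖ - ‖w‖), sq_nonneg (‖z‖ - ‖w‖)]
  refine (Finset.sum_le_sum fun j _ => hsplit j).trans ?_
  rw [Finset.sum_add_distrib, Finset.sum_add_distrib, ← Finset.mul_sum, ← Finset.mul_sum,
    ← Finset.mul_sum]
  linarith

/-! ### The Duhamel operator -/

/-- Continuous functions on `[0,T]` with values in `H^s_(0)`. -/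
abbrev Path (T : ℝ) (s : ℕ) : Type := C(Icc (0 : ℝ) T, HZero s)

theorem continuous_IccExtend_path {T : ℝ} {s : ℕ} (hT : 0 ≤ T) (y : Path T s) :
    Continuous (IccExtend hT y) := y.continuous.Icc_extend'

theorem norm_IccExtend_path_le {T : ℝ} {s : ℕ} (hT : 0 ≤ T) (y : Path T s) (τ : ℝ) :
    ‖IccExtend hT y τ‖ ≤ ‖y‖ := y.norm_coe_le_norm _

theorem IccExtend_path_add {T : ℝ} {s : ℕ} (hT : 0 ≤ T) (y z : Path T s) (τ : ℝ) :
    IccExtend hT (y + z : Path T s) τ = IccExtend hT y τ + IccExtend hT z τ := rfl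

theorem IccExtend_path_smul {T : ℝ} {s : ℕ} (hT : 0 ≤ T) (c : ℝ) (y : Path T s) (τ : ℝ) :
    IccExtend hT (c • y : Path T s) τ = c • IccExtend hT y τ := rfl

theorem map_real_smul {s : ℕ} (L : HZero s →L[ℂ] ℂ) (c : ℝ) (φ : HZero s) :
    L (c • φ) = (c : ℂ) * L φ := by
  rw [show c • φ = (c : ℂ) • φ from rfl, map_smul, smul_eq_mul]

theorem Lp_norm_sq_eq {T : ℝ} (u : Lp ℝ 2 (volume.restrict (Ioo (0 : ℝ) T))) :
    ‖u‖ ^ 2 = ∫ τ in Ioo (0 : ℝ) T, u τ ^ 2 := by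
  rw [← real_inner_self_eq_norm_sq, L2.inner_def]
  refine integral_congr_ae (Filter.Eventually.of_forall fun τ => ?_)
  simp [sq]

section Duhamel

variable {T : ℝ} {s : ℕ} {β : ℕ+ → HZero s →L[ℂ] ℂ}

theorem intervalIntegrable_source {u : ℝ → ℝ} (hu : MemLp u 2 (volume.restrict (Ioo (0 : ℝ) T)))
    {y : ℝ → HZero s} (hy : Continuous y) (L : HZero s →L[ℂ] ℂ) {g : ℝ → ℂ} (hg : Continuous g)
    {a b : ℝ} (ha : 0 ≤ a) (hab : a ≤ b) (hb : b ≤ T) :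
    IntervalIntegrable (fun τ => g τ * ((u τ : ℂ) * L (y τ))) volume a b := by
  have hui := intervalIntegrable_of_memLp_Ioo hu ha hab hb
  have huc : IntervalIntegrable (fun τ => (u τ : ℂ)) volume a b := ⟨hui.1.ofReal, hui.2.ofReal⟩
  exact (huc.mul_continuousOn (L.continuous.comp hy).continuousOn).continuousOn_mul hg.continuousOn

theorem phase_sub_integral (t : ℝ) (j : ℕ+) (f : ℝ → ℂ) (a b : ℝ) :
    ∫ τ in a..b, phase (t - τ) j * f τ = phase t j * ∫ τ in a..b, phase (-τ) j * f τ := by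
  rw [← intervalIntegral.integral_const_mul]
  simp only [sub_eq_add_neg, phase_add, mul_assoc]

/-- The group is pulled out of the integral: `Z(t) = ∫₀ᵗ e^{iAτ} …` has increments over `[t', t]`
bounded by those of the continuous function `W`, hence is continuous in `H^s_(0)`. Then `i e^{-iAt}
Z(t)` is the required path. The integrand itself need not take values in `H^s_(0)`, so everything is
defined through coefficients. -/
theorem IsSmoothing.exists_duhamel_path (hβ : IsSmoothing β) (hT : 0 ≤ T) :
    ∃ C : ℝ, 0 ≤ C ∧ ∀ u : ℝ → ℝ, MemLp u 2 (volume.restrict (Ioo (0 : ℝ) T)) →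
      ∀ y : ℝ → HZero s, Continuous y → ∃ k : Path T s,
        (∀ (t : Icc (0 : ℝ) T) (j : ℕ+), HZero.coef s j (k t)
          = Complex.I * ∫ τ in (0 : ℝ)..t, phase (t - τ) j * ((u τ : ℂ) * β j (y τ))) ∧
        ∀ t : Icc (0 : ℝ) T, ‖k t‖ ^ 2 ≤ C * ∫ τ in (0 : ℝ)..t, u τ ^ 2 * ‖y τ‖ ^ 2 := by
  obtain ⟨C, hC, hest⟩ := hβ.exists_estimate T
  refine ⟨C, hC, fun u hu y hy => ?_⟩
  set w : ℝ → ℝ := fun τ => u τ ^ 2 * ‖y τ‖ ^ 2 with hw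
  have hw0 : ∀ τ, 0 ≤ w τ := fun τ => by positivity
  have hwi : ∀ a b : ℝ, 0 ≤ a → a ≤ b → b ≤ T → IntervalIntegrable w volume a b :=
    fun a b ha hab hb => (intervalIntegrable_sq_of_memLp_Ioo hu ha hab hb).mul_continuousOn
      (hy.norm.pow 2).continuousOn
  have hfi : ∀ (j : ℕ+) (a b : ℝ), 0 ≤ a → a ≤ b → b ≤ T →
      IntervalIntegrable (fun τ => phase (-τ) j * ((u τ : ℂ) * β j (y τ))) volume a b :=
    fun j a b ha hab hb => intervalIntegrable_source hu hy (β j)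
      ((continuous_phase j).comp continuous_neg) ha hab hb
  have hZ : ∀ t : Icc (0 : ℝ) T, ∃ z : HZero s,
      (∀ j, HZero.coef s j z = ∫ τ in (0 : ℝ)..t, phase (-τ) j * ((u τ : ℂ) * β j (y τ))) ∧
      ‖z‖ ≤ √(C * ∫ τ in (0 : ℝ)..t, w τ) := by
    intro t
    refine HZero.exists_of_sum_le (Real.sqrt_nonneg _) fun F => ?_
    rw [Real.sq_sqrt (mul_nonneg hC (intervalIntegral.integral_nonneg t.2.1 fun τ _ => hw0 τ))]
    exact hest u hu y hy 0 t le_rfl t.2.1 t.2.2 F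
  choose Z hZ1 hZ2 using hZ
  set W : Icc (0 : ℝ) T → ℝ := fun t => ∫ τ in (0 : ℝ)..t, w τ with hW
  have hWc : Continuous W := by
    have := intervalIntegral.continuousOn_primitive_interval' (hwi 0 T le_rfl hT le_rfl)
      left_mem_uIcc
    rw [uIcc_of_le hT] at this
    exact this.comp_continuous continuous_subtype_val fun t => t.2
  have hdiff : ∀ t' t : Icc (0 : ℝ) T, t' ≤ t → ‖Z t - Z t'‖ ≤ √(C * |W t - W t'|) := by
    intro t' t htt
    have hle : (t' : ℝ) ≤ t := htt
    have hWd : W t - W t' = ∫ τ in (t' : ℝ)..t, w τ :=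
      intervalIntegral.integral_interval_sub_left (hwi 0 t le_rfl t.2.1 t.2.2)
        (hwi 0 t' le_rfl t'.2.1 t'.2.2)
    have hWd0 : 0 ≤ ∫ τ in (t' : ℝ)..t, w τ :=
      intervalIntegral.integral_nonneg hle fun τ _ => hw0 τ
    rw [hWd, abs_of_nonneg hWd0]
    refine HZero.norm_le_of_sum_le (Real.sqrt_nonneg _) fun F => ?_
    rw [Real.sq_sqrt (mul_nonneg hC hWd0)]
    have h1 : ∀ j, HZero.coef s j (Z t - Z t')
        = ∫ τ in (t' : ℝ)..t, phase (-τ) j * ((u τ : ℂ) * β j (y τ)) := fun j => by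
      rw [map_sub, hZ1, hZ1]
      exact intervalIntegral.integral_interval_sub_left (hfi j 0 t le_rfl t.2.1 t.2.2)
        (hfi j 0 t' le_rfl t'.2.1 t'.2.2)
    simp only [h1]
    exact hest u hu y hy t' t t'.2.1 hle t.2.2 F
  have hdiff' : ∀ t t' : Icc (0 : ℝ) T, ‖Z t - Z t'‖ ≤ √(C * |W t - W t'|) := by
    intro t t'
    rcases le_total t' t with h | h
    · exact hdiff t' t h
    · rw [norm_sub_rev, abs_sub_comm]
      exact hdiff t t' h
  have hZc : Continuous Z := by
    refine continuous_iff_continuousAt.2 fun t₀ => tendsto_iff_norm_sub_tendsto_zero.2 ?_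
    have h1 : Filter.Tendsto (fun t => √(C * |W t - W t₀|)) (𝓝 t₀) (𝓝 0) := by
      have : Continuous fun t => √(C * |W t - W t₀|) := by fun_prop
      simpa using this.tendsto t₀
    exact squeeze_zero (fun _ => norm_nonneg _) (fun t => hdiff' t t₀) h1
  have hkc : Continuous fun t : Icc (0 : ℝ) T => Complex.I • HZero.free s t (Z t) := by
    have h1 := (HZero.continuous_free (hZc.Icc_extend' (h := hT)) (fun t => t)
      continuous_id).comp (continuous_subtype_val (p := (· ∈ Icc (0 : ℝ) T)))
    refine (h1.congr fun t => ?_).const_smul Complex.I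
    simp only [Function.comp_apply, IccExtend_val]
  refine ⟨⟨_, hkc⟩, fun t j => ?_, fun t => ?_⟩
  · change HZero.coef s j (Complex.I • HZero.free s t (Z t)) = _
    rw [map_smul, HZero.coef_free, hZ1, phase_sub_integral, smul_eq_mul]
  · change ‖Complex.I • HZero.free s t (Z t)‖ ^ 2 ≤ _
    rw [norm_smul, Complex.norm_I, one_mul]
    have h2 := pow_le_pow_left₀ (norm_nonneg _) ((HZero.norm_free_le (t : ℝ) (Z t)).trans (hZ2 t)) 2
    rwa [Real.sq_sqrt (mul_nonneg hC (intervalIntegral.integral_nonneg t.2.1 fun τ _ => hw0 τ))]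
      at h2

/-- The Duhamel operator `(u, y) ↦ i ∫₀ᵗ e^{-iA(t-τ)} u(τ) (μ y(τ)) dτ`, together with its Volterra
estimate. -/
theorem IsSmoothing.exists_duhamel (hβ : IsSmoothing β) (hT : 0 ≤ T) :
    ∃ K : Lp ℝ 2 (volume.restrict (Ioo (0 : ℝ) T)) →L[ℝ] Path T s →L[ℝ] Path T s,
      (∀ u y (t : Icc (0 : ℝ) T) (j : ℕ+), HZero.coef s j (K u y t)
        = Complex.I * ∫ τ in (0 : ℝ)..t, phase (t - τ) j
          * ((u τ : ℂ) * β j (IccExtend hT y τ))) ∧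
      ∃ C : ℝ, 0 ≤ C ∧ ∀ u y (t : Icc (0 : ℝ) T),
        ‖K u y t‖ ^ 2 ≤ C * ∫ τ in (0 : ℝ)..t, u τ ^ 2 * ‖IccExtend hT y τ‖ ^ 2 := by
  obtain ⟨C, hC, h⟩ := hβ.exists_duhamel_path hT
  have h' : ∀ (u : Lp ℝ 2 (volume.restrict (Ioo (0 : ℝ) T))) (y : Path T s), _ := fun u y =>
    h u (Lp.memLp u) (IccExtend hT y) (continuous_IccExtend_path hT y)
  choose k hk1 hk2 using h'
  have hint : ∀ (u : Lp ℝ 2 (volume.restrict (Ioo (0 : ℝ) T))) (y : Path T s) (t : Icc (0 : ℝ) T)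
      (j : ℕ+), IntervalIntegrable (fun τ => phase (t - τ) j * ((u τ : ℂ)
        * β j (IccExtend hT y τ))) volume 0 t := fun u y t j =>
    intervalIntegrable_source (Lp.memLp u) (continuous_IccExtend_path hT y) (β j)
      ((continuous_phase j).comp (continuous_const.sub continuous_id)) le_rfl t.2.1 t.2.2
  let K := LinearMap.mk₂ ℝ k
    (fun u v y => ContinuousMap.ext fun t => HZero.ext_coef fun j => by
      rw [ContinuousMap.add_apply, map_add, hk1, hk1, hk1, ← mul_add,
        ← intervalIntegral.integral_add (hint u y t j) (hint v y t j)]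
      congr 1
      refine integral_congr_of_ae_Ioo ?_ t.2
      filter_upwards [Lp.coeFn_add u v] with τ hτ
      rw [hτ, Pi.add_apply]
      push_cast
      ring)
    (fun c u y => ContinuousMap.ext fun t => HZero.ext_coef fun j => by
      rw [ContinuousMap.smul_apply, map_real_smul, hk1, hk1, mul_left_comm,
        ← intervalIntegral.integral_const_mul (c : ℂ)]
      congr 1
      refine integral_congr_of_ae_Ioo ?_ t.2
      filter_upwards [Lp.coeFn_smul c u] with τ hτ
      rw [hτ, Pi.smul_apply, smul_eq_mul]
      push_cast
      ring)
    (fun u y z => ContinuousMap.ext fun t => HZero.ext_coef fun j => by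
      rw [ContinuousMap.add_apply, map_add, hk1, hk1, hk1, ← mul_add,
        ← intervalIntegral.integral_add (hint u y t j) (hint u z t j)]
      congr 1
      refine intervalIntegral.integral_congr fun τ _ => ?_
      simp only [IccExtend_path_add, map_add]
      ring)
    (fun c u y => ContinuousMap.ext fun t => HZero.ext_coef fun j => by
      rw [ContinuousMap.smul_apply, map_real_smul, hk1, hk1, mul_left_comm,
        ← intervalIntegral.integral_const_mul (c : ℂ)]
      congr 1
      refine intervalIntegral.integral_congr fun τ _ => ?_
      simp only [IccExtend_path_smul, map_real_smul]
      ring)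
  refine ⟨K.mkContinuous₂ √C fun u y => ?_, fun u y t j => hk1 u y t j, C, hC,
    fun u y t => hk2 u y t⟩
  change ‖k u y‖ ≤ _
  refine (ContinuousMap.norm_le _ (by positivity)).2 fun t => ?_
  refine le_of_sq_le_sq ?_ (by positivity)
  refine (hk2 u y t).trans ?_
  rw [mul_pow, mul_pow, Real.sq_sqrt hC, mul_assoc]
  refine mul_le_mul_of_nonneg_left ?_ hC
  have hu2 := intervalIntegrable_sq_of_memLp_Ioo (Lp.memLp u) le_rfl t.2.1 t.2.2
  calc ∫ τ in (0 : ℝ)..t, u τ ^ 2 * ‖IccExtend hT y τ‖ ^ 2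
      ≤ ∫ τ in (0 : ℝ)..t, u τ ^ 2 * ‖y‖ ^ 2 := by
        refine intervalIntegral.integral_mono_on t.2.1 (hu2.mul_continuousOn
          ((continuous_IccExtend_path hT y).norm.pow 2).continuousOn) (hu2.mul_const _) ?_
        intro τ _
        have := norm_IccExtend_path_le hT y τ
        gcongr
    _ = (∫ τ in (0 : ℝ)..t, u τ ^ 2) * ‖y‖ ^ 2 := intervalIntegral.integral_mul_const _ _
    _ ≤ ‖u‖ ^ 2 * ‖y‖ ^ 2 := by
        refine mul_le_mul_of_nonneg_right ?_ (sq_nonneg _)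
        rw [Lp_norm_sq_eq, intervalIntegral.integral_of_le t.2.1, integral_Ioc_eq_integral_Ioo]
        exact setIntegral_mono_set (Lp.memLp u).integrable_sq
          (Filter.Eventually.of_forall fun _ => sq_nonneg _)
          (Ioo_subset_Ioo le_rfl t.2.2).eventuallyLE

end Duhamel

/-! ### Volterra operators on jets of paths -/

/-- The fundamental theorem for `W^{N+1}`, which is absolutely continuous although `w` is only
integrable. Repeated use produces the factorials in the Volterra iteration. -/
theorem integral_mul_primitive_pow {w : ℝ → ℝ} {t : ℝ} (hw : IntervalIntegrable w volume 0 t)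
    (N : ℕ) : ∫ τ in (0 : ℝ)..t, w τ * (∫ σ in (0 : ℝ)..τ, w σ) ^ N
      = (∫ τ in (0 : ℝ)..t, w τ) ^ (N + 1) / (N + 1) := by
  set W : ℝ → ℝ := fun τ => ∫ σ in (0 : ℝ)..τ, w σ with hW
  have hWac : AbsolutelyContinuousOnInterval W 0 t :=
    hw.absolutelyContinuousOnInterval_intervalIntegral left_mem_uIcc
  have hpow : ∀ n : ℕ, AbsolutelyContinuousOnInterval (fun τ => W τ ^ (n + 1)) 0 t := by
    intro n
    induction n with
    | zero => simpa using hWac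
    | succ n ih =>
      simp only [pow_succ _ (n + 1)]
      exact ih.fun_mul hWac
  have h1 := (hpow N).integral_deriv_eq_sub
  have h2 : ∫ τ in (0 : ℝ)..t, deriv (fun τ => W τ ^ (N + 1)) τ
      = ∫ τ in (0 : ℝ)..t, (N + 1) * (w τ * W τ ^ N) := by
    refine intervalIntegral.integral_congr_ae ?_
    filter_upwards [hw.ae_hasDerivAt_integral] with τ hτ hτ1
    have h3 := (hτ (uIoc_subset_uIcc hτ1) 0 left_mem_uIcc).pow (N + 1)
    rw [show deriv (fun τ => W τ ^ (N + 1)) τ = _ from h3.deriv]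
    simp only [hW, Nat.add_sub_cancel]
    push_cast
    ring
  have hW0 : W 0 = 0 := intervalIntegral.integral_same
  rw [h2, intervalIntegral.integral_const_mul, hW0, zero_pow (Nat.succ_ne_zero N), sub_zero] at h1
  have hN : (N + 1 : ℝ) ≠ 0 := by positivity
  rw [eq_div_iff hN, mul_comm]
  exact h1

/-- `1 - a^N` is a unit and is the product of `1 - a` with a geometric sum that commutes with it. -/
theorem isUnit_one_sub_of_norm_pow_lt_one {R : Type*} [NormedRing R] [HasSummableGeomSeries R]
    {a : R} {N : ℕ} (h : ‖a ^ N‖ < 1) : IsUnit (1 - a) := by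
  have h1 : IsUnit (1 - a ^ N) := isUnit_one_sub_of_norm_lt_one h
  rw [← mul_neg_geom_sum] at h1
  refine ((Commute.isUnit_mul_iff ?_).1 h1).1
  refine Commute.sum_right _ _ _ fun i _ => ?_
  exact ((Commute.one_left a).sub_left (Commute.refl a)).pow_right i

/-- Iterating the equation writes `y` as an element of `S` plus `A^n y`, and the remainder tends to
zero. This places the fixed point in `S` without inverting the restriction of `1 - A` to `S`. -/
theorem mem_of_fixedPoint {E : Type*} [NormedAddCommGroup E] [NormedSpace ℝ E] (A : E →L[ℝ] E)
    (S : Submodule ℝ E) (hS : IsClosed (S : Set E)) (hAS : ∀ x ∈ S, A x ∈ S) {f y : E} (hf : f ∈ S)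
    (hy : y = f + A y) (hlim : Filter.Tendsto (fun n => (A ^ n) y) Filter.atTop (𝓝 0)) : y ∈ S := by
  have h1 : ∀ n : ℕ, ∃ x ∈ S, y = x + (A ^ n) y := by
    intro n
    induction n with
    | zero => exact ⟨0, S.zero_mem, by simp⟩
    | succ n ih =>
      obtain ⟨x, hx, hxy⟩ := ih
      refine ⟨f + A x, S.add_mem hf (hAS x hx), ?_⟩
      conv_lhs => rw [hy, hxy, map_add]
      rw [pow_succ', mul_apply_eq_comp, add_assoc]
  choose x hx hxy using h1
  have h2 : Filter.Tendsto x Filter.atTop (𝓝 y) := by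
    have h3 : x = fun n => y - (A ^ n) y := funext fun n => eq_sub_of_add_eq (hxy n).symm
    rw [h3]
    simpa using tendsto_const_nhds.sub hlim
  exact hS.mem_of_tendsto h2 (Filter.Eventually.of_forall hx)

/-- Jets `(y_0, …, y_k)` of paths. -/
abbrev PathJet (T : ℝ) (s k : ℕ) : Type := Fin (k + 1) → Path T s

section Volterra

variable {T : ℝ} {s k : ℕ}

/-- The density `∑_m |u^{(m)}|²`. -/
noncomputable def jetDensity (U : JetL2 T k) (τ : ℝ) : ℝ := ∑ m : Fin (k + 1), (U m : ℝ → ℝ) τ ^ 2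

theorem jetDensity_nonneg (U : JetL2 T k) (τ : ℝ) : 0 ≤ jetDensity U τ :=
  Finset.sum_nonneg fun _ _ => sq_nonneg _

theorem intervalIntegrable_jetDensity (U : JetL2 T k) {t : ℝ} (h0 : 0 ≤ t) (h1 : t ≤ T) :
    IntervalIntegrable (jetDensity U) volume 0 t := by
  have := IntervalIntegrable.sum (Finset.univ : Finset (Fin (k + 1)))
    (f := fun m τ => (U m : ℝ → ℝ) τ ^ 2) fun m _ =>
      intervalIntegrable_sq_of_memLp_Ioo (Lp.memLp (U m)) le_rfl h0 h1
  refine this.congr (fun τ _ => ?_)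
  simp [jetDensity]

/-- The lower index `n - m`. -/
def subIdx (n m : Fin (k + 1)) : Fin (k + 1) := ⟨n - m, by omega⟩

/-- The operator `(𝕂_U y)_n = ∑_m C(n,m) K(U_m) y_{n-m}`, which differentiates `K(u) y`. -/
theorem exists_jetOperator
    (K : Lp ℝ 2 (volume.restrict (Ioo (0 : ℝ) T)) →L[ℝ] Path T s →L[ℝ] Path T s) (k : ℕ) :
    ∃ A : JetL2 T k →L[ℝ] PathJet T s k →L[ℝ] PathJet T s k, ∀ U y n,
      A U y n = ∑ m : Fin (k + 1), (((n : ℕ).choose m : ℕ) : ℝ) • K (U m) (y (subIdx n m)) := by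
  -- Assembled from continuous linear pieces, so that boundedness in `U` and in `y` is automatic.
  -- For `m > n` the truncated index in `subIdx` is harmless, since the binomial coefficient
  -- vanishes.
  refine ⟨∑ n : Fin (k + 1), ∑ m : Fin (k + 1), (((n : ℕ).choose m : ℕ) : ℝ) •
    ((ContinuousLinearMap.compL ℝ (PathJet T s k) (Path T s) (PathJet T s k)
      (ContinuousLinearMap.single ℝ (fun _ : Fin (k + 1) => Path T s) n)).comp
    (((ContinuousLinearMap.compL ℝ (PathJet T s k) (Path T s) (Path T s)).flip
      (ContinuousLinearMap.proj (R := ℝ) (φ := fun _ : Fin (k + 1) => Path T s)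
        (subIdx n m))).comp
    (K.comp (PiLp.proj (𝕜 := ℝ) 2 (fun _ : Fin (k + 1) =>
      Lp ℝ 2 (volume.restrict (Ioo (0 : ℝ) T))) m)))), fun U y n => ?_⟩
  simp only [sum_apply, smul_apply, Finset.sum_apply,
    Pi.smul_apply, ContinuousLinearMap.comp_apply, ContinuousLinearMap.compL_apply,
    ContinuousLinearMap.flip_apply, ContinuousLinearMap.proj_apply, PiLp.proj_apply,
    ContinuousLinearMap.single_apply]
  rw [Finset.sum_eq_single n]
  · simp
  · intro n' _ hn'
    refine Finset.sum_eq_zero fun m _ => ?_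
    rw [Pi.single_eq_of_ne hn'.symm, smul_zero]
  · simp

variable {K : Lp ℝ 2 (volume.restrict (Ioo (0 : ℝ) T)) →L[ℝ] Path T s →L[ℝ] Path T s}
  {A : JetL2 T k →L[ℝ] PathJet T s k →L[ℝ] PathJet T s k} {C : ℝ}

/-- The majorant `g` is an arbitrary continuous function of time, so that the estimate can be fed
into itself. In the constant, `k + 1` comes from the square of a sum of `k + 1` terms and `2^k`
bounds the binomial coefficients. -/
theorem jetOperator_estimate (hT : 0 ≤ T)
    (hK : ∀ u y (t : Icc (0 : ℝ) T),
      ‖K u y t‖ ^ 2 ≤ C * ∫ τ in (0 : ℝ)..t, u τ ^ 2 * ‖IccExtend hT y τ‖ ^ 2) (hC : 0 ≤ C)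
    (hA : ∀ U y n, A U y n
      = ∑ m : Fin (k + 1), (((n : ℕ).choose m : ℕ) : ℝ) • K (U m) (y (subIdx n m)))
    (U : JetL2 T k) (y : PathJet T s k) {g : ℝ → ℝ} (hg : ContinuousOn g (Icc 0 T))
    (hyg : ∀ n, ∀ t : Icc (0 : ℝ) T, ‖y n t‖ ^ 2 ≤ g t) (n : Fin (k + 1)) (t : Icc (0 : ℝ) T) :
    ‖A U y n t‖ ^ 2 ≤ ((k + 1) * (2 ^ k) ^ 2 * C) * ∫ τ in (0 : ℝ)..t, jetDensity U τ * g τ := by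
  have hgi : ∀ m : Fin (k + 1),
      IntervalIntegrable (fun τ => (U m : ℝ → ℝ) τ ^ 2 * g τ) volume 0 t :=
    fun m => by
      refine (intervalIntegrable_sq_of_memLp_Ioo (Lp.memLp (U m)) le_rfl t.2.1 t.2.2
        ).mul_continuousOn (hg.mono ?_)
      rw [uIcc_of_le t.2.1]
      exact Icc_subset_Icc le_rfl t.2.2
  have h1 : ∀ m : Fin (k + 1), ‖(((n : ℕ).choose m : ℕ) : ℝ) • K (U m) (y (subIdx n m)) t‖ ^ 2
      ≤ (2 ^ k) ^ 2 * (C * ∫ τ in (0 : ℝ)..t, (U m : ℝ → ℝ) τ ^ 2 * g τ) := by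
    intro m
    rw [norm_smul, mul_pow]
    have hc : ‖(((n : ℕ).choose m : ℕ) : ℝ)‖ ≤ 2 ^ k := by
      rw [Real.norm_natCast]
      have h2 : (n : ℕ).choose m ≤ 2 ^ k := (Nat.choose_le_two_pow _ _).trans
        (Nat.pow_le_pow_right two_pos (Nat.lt_succ_iff.1 n.2))
      exact_mod_cast h2
    refine mul_le_mul (pow_le_pow_left₀ (norm_nonneg _) hc 2) ((hK _ _ t).trans ?_)
      (sq_nonneg _) (by positivity)
    refine mul_le_mul_of_nonneg_left ?_ hC
    refine intervalIntegral.integral_mono_on t.2.1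
      ((intervalIntegrable_sq_of_memLp_Ioo (Lp.memLp (U m)) le_rfl t.2.1 t.2.2).mul_continuousOn
        ((continuous_IccExtend_path hT _).norm.pow 2).continuousOn) (hgi m) ?_
    intro τ hτ
    have hτ' : τ ∈ Icc (0 : ℝ) T := ⟨hτ.1, hτ.2.trans t.2.2⟩
    rw [IccExtend_of_mem hT _ hτ']
    exact mul_le_mul_of_nonneg_left (hyg _ ⟨τ, hτ'⟩) (sq_nonneg _)
  have e1 : A U y n t = ∑ m : Fin (k + 1),
      (((n : ℕ).choose m : ℕ) : ℝ) • K (U m) (y (subIdx n m)) t := by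
    rw [hA, ContinuousMap.sum_apply]
    rfl
  have e2 : ∫ τ in (0 : ℝ)..t, jetDensity U τ * g τ
      = ∑ m : Fin (k + 1), ∫ τ in (0 : ℝ)..t, (U m : ℝ → ℝ) τ ^ 2 * g τ := by
    rw [← intervalIntegral.integral_finsetSum fun m _ => hgi m]
    refine intervalIntegral.integral_congr fun τ _ => ?_
    simp only [jetDensity, Finset.sum_mul]
  rw [e1, e2]
  refine (pow_le_pow_left₀ (norm_nonneg _) (norm_sum_le _ _) 2).trans ?_
  refine (sq_sum_le_card_mul_sum_sq).trans ?_
  rw [Finset.card_univ, Fintype.card_fin, Finset.mul_sum, Finset.mul_sum]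
  refine Finset.sum_le_sum fun m _ => ?_
  refine (mul_le_mul_of_nonneg_left (h1 m) (Nat.cast_nonneg _)).trans (le_of_eq ?_)
  push_cast
  ring

/-- Induction on `N` with the bound of the previous power as majorant; integrating the density
against the `N`-th power of its primitive supplies the factor `1/(N+1)`. -/
theorem jetOperator_pow_estimate (hT : 0 ≤ T)
    (hK : ∀ u y (t : Icc (0 : ℝ) T),
      ‖K u y t‖ ^ 2 ≤ C * ∫ τ in (0 : ℝ)..t, u τ ^ 2 * ‖IccExtend hT y τ‖ ^ 2) (hC : 0 ≤ C)
    (hA : ∀ U y n, A U y n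
      = ∑ m : Fin (k + 1), (((n : ℕ).choose m : ℕ) : ℝ) • K (U m) (y (subIdx n m)))
    (U : JetL2 T k) (y : PathJet T s k) (N : ℕ) (n : Fin (k + 1)) (t : Icc (0 : ℝ) T) :
    ‖((A U) ^ N) y n t‖ ^ 2 ≤ ((k + 1) * (2 ^ k) ^ 2 * C) ^ N
      * ((∫ τ in (0 : ℝ)..t, jetDensity U τ) ^ N / N.factorial) * ‖y‖ ^ 2 := by
  set D := (k + 1) * (2 ^ k) ^ 2 * C with hD
  induction N generalizing n t with
  | zero =>
    simp only [pow_zero, Nat.factorial_zero, Nat.cast_one, div_one, one_mul,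
      one_apply_eq_self]
    exact pow_le_pow_left₀ (norm_nonneg _)
      (((y n).norm_coe_le_norm t).trans (norm_le_pi_norm y n)) 2
  | succ N ih =>
    rw [pow_succ' (A U), mul_apply_eq_comp]
    have hWc : ContinuousOn (fun τ => ∫ σ in (0 : ℝ)..τ, jetDensity U σ) (Icc 0 T) := by
      have := intervalIntegral.continuousOn_primitive_interval'
        (intervalIntegrable_jetDensity U hT le_rfl) left_mem_uIcc
      rwa [uIcc_of_le hT] at this
    have h1 := jetOperator_estimate hT hK hC hA U (((A U) ^ N) y)
      (g := fun τ => D ^ N * ((∫ σ in (0 : ℝ)..τ, jetDensity U σ) ^ N / N.factorial) * ‖y‖ ^ 2)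
      (((hWc.pow N).div_const _).const_mul _ |>.mul_const _) (fun n t => ih n t) n t
    refine h1.trans (le_of_eq ?_)
    have e : ∀ τ, jetDensity U τ
        * (D ^ N * ((∫ σ in (0 : ℝ)..τ, jetDensity U σ) ^ N / N.factorial) * ‖y‖ ^ 2)
        = (D ^ N / N.factorial * ‖y‖ ^ 2)
          * (jetDensity U τ * (∫ σ in (0 : ℝ)..τ, jetDensity U σ) ^ N) := fun τ => by ring
    simp only [e]
    rw [intervalIntegral.integral_const_mul,
      integral_mul_primitive_pow (intervalIntegrable_jetDensity U t.2.1 t.2.2) N,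
      Nat.factorial_succ, ← hD]
    have hN : (N + 1 : ℝ) ≠ 0 := by positivity
    have hf : (N.factorial : ℝ) ≠ 0 := by positivity
    push_cast
    field_simp
    ring

theorem jetOperator_pow_norm_le (hT : 0 ≤ T)
    (hK : ∀ u y (t : Icc (0 : ℝ) T),
      ‖K u y t‖ ^ 2 ≤ C * ∫ τ in (0 : ℝ)..t, u τ ^ 2 * ‖IccExtend hT y τ‖ ^ 2) (hC : 0 ≤ C)
    (hA : ∀ U y n, A U y n
      = ∑ m : Fin (k + 1), (((n : ℕ).choose m : ℕ) : ℝ) • K (U m) (y (subIdx n m)))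
    (U : JetL2 T k) : ∃ R : ℝ, ∀ N : ℕ, ‖(A U) ^ N‖ ≤ √(R ^ N / N.factorial) := by
  set W := ∫ τ in (0 : ℝ)..T, jetDensity U τ with hW
  have hW0 : 0 ≤ W := intervalIntegral.integral_nonneg hT fun τ _ => jetDensity_nonneg U τ
  refine ⟨((k + 1) * (2 ^ k) ^ 2 * C) * W, fun N => ?_⟩
  refine ContinuousLinearMap.opNorm_le_bound _ (Real.sqrt_nonneg _) fun y => ?_
  refine (pi_norm_le_iff_of_nonneg (by positivity)).2 fun n => ?_
  refine (ContinuousMap.norm_le _ (by positivity)).2 fun t => ?_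
  refine le_of_sq_le_sq ?_ (by positivity)
  rw [mul_pow, Real.sq_sqrt (by positivity)]
  refine (jetOperator_pow_estimate hT hK hC hA U y N n t).trans ?_
  refine mul_le_mul_of_nonneg_right ?_ (sq_nonneg _)
  rw [mul_pow _ W, mul_div_assoc]
  refine mul_le_mul_of_nonneg_left ?_ (by positivity)
  have h1 : ∫ τ in (0 : ℝ)..t, jetDensity U τ ≤ W := by
    rw [hW]
    exact intervalIntegral.integral_mono_interval le_rfl t.2.1 t.2.2
      (Filter.Eventually.of_forall fun τ => jetDensity_nonneg U τ)
      (intervalIntegrable_jetDensity U hT le_rfl)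
  have h2 : 0 ≤ ∫ τ in (0 : ℝ)..t, jetDensity U τ :=
    intervalIntegral.integral_nonneg t.2.1 fun τ _ => jetDensity_nonneg U τ
  gcongr

theorem jetOperator_tendsto (hT : 0 ≤ T)
    (hK : ∀ u y (t : Icc (0 : ℝ) T),
      ‖K u y t‖ ^ 2 ≤ C * ∫ τ in (0 : ℝ)..t, u τ ^ 2 * ‖IccExtend hT y τ‖ ^ 2) (hC : 0 ≤ C)
    (hA : ∀ U y n, A U y n
      = ∑ m : Fin (k + 1), (((n : ℕ).choose m : ℕ) : ℝ) • K (U m) (y (subIdx n m)))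
    (U : JetL2 T k) : Filter.Tendsto (fun N => ‖(A U) ^ N‖) Filter.atTop (𝓝 0) := by
  obtain ⟨R, hR⟩ := jetOperator_pow_norm_le hT hK hC hA U
  have h1 := (FloorSemiring.tendsto_pow_div_factorial_atTop R).sqrt
  rw [Real.sqrt_zero] at h1
  exact squeeze_zero (fun _ => ContinuousLinearMap.opNorm_nonneg _) hR h1

/-- Some power of `A U` has norm below one, whatever the sizes of `U` and `T`: no smallness or
subdivision of the time interval is needed. -/
theorem jetOperator_isUnit (hT : 0 ≤ T)
    (hK : ∀ u y (t : Icc (0 : ℝ) T),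
      ‖K u y t‖ ^ 2 ≤ C * ∫ τ in (0 : ℝ)..t, u τ ^ 2 * ‖IccExtend hT y τ‖ ^ 2) (hC : 0 ≤ C)
    (hA : ∀ U y n, A U y n
      = ∑ m : Fin (k + 1), (((n : ℕ).choose m : ℕ) : ℝ) • K (U m) (y (subIdx n m)))
    (U : JetL2 T k) : IsUnit (1 - A U) := by
  obtain ⟨N, hN⟩ := ((jetOperator_tendsto hT hK hC hA U).eventually_lt_const one_pos).exists
  exact isUnit_one_sub_of_norm_pow_lt_one (R := PathJet T s k →L[ℝ] PathJet T s k) (a := A U) hN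

end Volterra

/-! ### Compatible jets -/

section Scalar

/-- Differentiating the Duhamel formula, for one coefficient. -/
theorem duhamel_deriv_eq {T : ℝ} {F G : ℝ → ℂ} (hF : Continuous F) (hG : Continuous G)
    (hFG : ∀ τ ∈ Ioo (0 : ℝ) T, HasDerivAt F (G τ) τ) (hF0 : F 0 = 0) (j : ℕ+) {t : ℝ}
    (ht : t ∈ Icc (0 : ℝ) T) :
    Complex.I * ∫ τ in (0 : ℝ)..t, phase (t - τ) j * G τ
      = Complex.I * F t - Complex.I * eigenval j
        * (Complex.I * ∫ τ in (0 : ℝ)..t, phase (t - τ) j * F τ) := by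
  have hpc : Continuous fun τ => phase (-τ) j := (continuous_phase j).comp continuous_neg
  have hp : ∀ τ, HasDerivAt (fun τ => phase (-τ) j)
      (Complex.I * eigenval j * phase (-τ) j) τ := fun τ => by
    have := (hasDerivAt_phase j (-τ)).scomp τ (hasDerivAt_neg τ)
    exact this.congr_deriv (by simp)
  have h1 := intervalIntegral.integral_eq_sub_of_hasDerivAt_of_le ht.1
    (f := fun τ => phase (-τ) j * F τ)
    (f' := fun τ => Complex.I * eigenval j * phase (-τ) j * F τ + phase (-τ) j * G τ)
    (hpc.mul hF).continuousOn
    (fun τ hτ => (hp τ).mul (hFG τ ⟨hτ.1, hτ.2.trans_le ht.2⟩))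
    (Continuous.intervalIntegrable (by fun_prop) _ _)
  rw [intervalIntegral.integral_add (Continuous.intervalIntegrable (by fun_prop) _ _)
    (Continuous.intervalIntegrable (by fun_prop) _ _), hF0, mul_zero, sub_zero] at h1
  simp only [mul_assoc] at h1
  rw [intervalIntegral.integral_const_mul, intervalIntegral.integral_const_mul] at h1
  rw [phase_sub_integral, phase_sub_integral]
  have h2 : phase t j * phase (-t) j = 1 := by rw [← phase_add, add_neg_cancel, phase_zero]
  linear_combination (Complex.I * phase t j) * h1 + (Complex.I * F t) * h2

/-- The Duhamel integral `Z` of `F` satisfies `Z' = iF - iλ_j Z`, which by `duhamel_deriv_eq` is the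
Duhamel integral of `G = F'`; the condition `F 0 = 0` removes the term at the initial time. The
integrated form is the one used to define compatible jets. -/
theorem integral_duhamel_deriv_eq {T : ℝ} {F G : ℝ → ℂ} (hF : Continuous F) (hG : Continuous G)
    (hFG : ∀ τ ∈ Ioo (0 : ℝ) T, HasDerivAt F (G τ) τ) (hF0 : F 0 = 0) (j : ℕ+) {t : ℝ}
    (ht : t ∈ Icc (0 : ℝ) T) :
    ∫ σ in (0 : ℝ)..t, Complex.I * ∫ τ in (0 : ℝ)..σ, phase (σ - τ) j * G τ
      = Complex.I * ∫ τ in (0 : ℝ)..t, phase (t - τ) j * F τ := by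
  have hpc : Continuous fun τ => phase (-τ) j := (continuous_phase j).comp continuous_neg
  have hpF : Continuous fun τ => phase (-τ) j * F τ := hpc.mul hF
  set Z : ℝ → ℂ := fun t => Complex.I * ∫ τ in (0 : ℝ)..t, phase (t - τ) j * F τ with hZ
  have hZd : ∀ σ, HasDerivAt Z (Complex.I * F σ - Complex.I * eigenval j * Z σ) σ := by
    intro σ
    have h1 : HasDerivAt (fun t => ∫ τ in (0 : ℝ)..t, phase (-τ) j * F τ)
        (phase (-σ) j * F σ) σ :=
      intervalIntegral.integral_hasDerivAt_right (hpF.intervalIntegrable _ _)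
        hpF.stronglyMeasurable.stronglyMeasurableAtFilter hpF.continuousAt
    have h2 := ((hasDerivAt_phase j σ).mul h1).const_mul Complex.I
    have h3 : phase σ j * phase (-σ) j = 1 := by rw [← phase_add, add_neg_cancel, phase_zero]
    have h4 : Z = fun t => Complex.I * (phase t j * ∫ τ in (0 : ℝ)..t, phase (-τ) j * F τ) := by
      funext t
      rw [hZ]
      simp only [phase_sub_integral]
    rw [h4]
    refine h2.congr_deriv ?_
    linear_combination (Complex.I * F σ) * h3
  have hZc : Continuous Z := continuous_iff_continuousAt.2 fun σ => (hZd σ).continuousAt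
  have h5 := intervalIntegral.integral_eq_sub_of_hasDerivAt (a := 0) (b := t) (fun σ _ => hZd σ)
    (Continuous.intervalIntegrable (by fun_prop) _ _)
  have hZ0 : Z 0 = 0 := by simp [hZ]
  rw [hZ0, sub_zero] at h5
  refine Eq.trans ?_ h5
  refine intervalIntegral.integral_congr fun σ hσ => ?_
  rw [uIcc_of_le ht.1] at hσ
  exact duhamel_deriv_eq hF hG hFG hF0 j ⟨hσ.1, hσ.2.trans ht.2⟩

end Scalar

section Compatible

variable {T : ℝ} {s k : ℕ}

/-- The jets `(y, y', …, y^{(k)})` of `C^k` paths whose time derivatives at the final time are given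
by the free equation. -/
noncomputable def compatibleJets (hT : 0 ≤ T) (s k : ℕ) : Submodule ℝ (PathJet T s k) where
  carrier := {y | ∀ n : Fin k,
    (∀ t : Icc (0 : ℝ) T, y n.castSucc t
      = y n.castSucc ⟨0, left_mem_Icc.2 hT⟩ + ∫ τ in (0 : ℝ)..t, IccExtend hT (y n.succ) τ) ∧
    ∀ j, HZero.coef s j (y n.succ ⟨T, right_mem_Icc.2 hT⟩)
      = -(Complex.I * eigenval j) * HZero.coef s j (y n.castSucc ⟨T, right_mem_Icc.2 hT⟩)}
  zero_mem' := fun n => ⟨fun t => by simp [IccExtend], fun j => by simp⟩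
  add_mem' := by
    intro y z hy hz n
    refine ⟨fun t => ?_, fun j => ?_⟩
    · simp only [Pi.add_apply, ContinuousMap.add_apply, IccExtend_path_add]
      rw [intervalIntegral.integral_add
        ((continuous_IccExtend_path hT _).intervalIntegrable _ _)
        ((continuous_IccExtend_path hT _).intervalIntegrable _ _), (hy n).1 t, (hz n).1 t]
      abel
    · simp only [Pi.add_apply, ContinuousMap.add_apply, map_add, (hy n).2 j, (hz n).2 j]
      ring
  smul_mem' := by
    intro c y hy n
    refine ⟨fun t => ?_, fun j => ?_⟩
    · simp only [Pi.smul_apply, ContinuousMap.smul_apply, IccExtend_path_smul]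
      rw [intervalIntegral.integral_smul, (hy n).1 t, smul_add]
    · simp only [Pi.smul_apply, ContinuousMap.smul_apply, map_real_smul, (hy n).2 j]
      ring

/-- The derivative relation is stated through integrals and the relation at the final time through
coefficients, so every condition is an equation between continuous functions of the jet, although
differentiation and `A` are unbounded. -/
theorem isClosed_compatibleJets (hT : 0 ≤ T) :
    IsClosed (compatibleJets hT s k : Set (PathJet T s k)) := by
  have h : (compatibleJets hT s k : Set (PathJet T s k)) = ⋂ n : Fin k,
      (⋂ t : Icc (0 : ℝ) T, {y | y n.castSucc t = y n.castSucc ⟨0, left_mem_Icc.2 hT⟩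
        + ∫ τ in (0 : ℝ)..t, IccExtend hT (y n.succ) τ}) ∩
      ⋂ j, {y | HZero.coef s j (y n.succ ⟨T, right_mem_Icc.2 hT⟩)
        = -(Complex.I * eigenval j)
          * HZero.coef s j (y n.castSucc ⟨T, right_mem_Icc.2 hT⟩)} := by
    ext y
    simp only [mem_iInter, mem_inter_iff, mem_ofPred_eq]
    rfl
  rw [h]
  have hev : ∀ (n : Fin (k + 1)) (t : Icc (0 : ℝ) T),
      Continuous fun y : PathJet T s k => y n t := fun n t => by fun_prop
  refine isClosed_iInter fun n => IsClosed.inter (isClosed_iInter fun t => isClosed_eq (hev _ _)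
    ((hev _ _).add ?_)) (isClosed_iInter fun j => isClosed_eq
      ((HZero.coef s j).continuous.comp (hev _ _))
      (continuous_const.mul ((HZero.coef s j).continuous.comp (hev _ _))))
  refine intervalIntegral.continuous_parametric_intervalIntegral_of_continuous' ?_ _ _
  have h1 : Continuous fun q : PathJet T s k × ℝ => q.1 n.succ (projIcc 0 T hT q.2) := by
    have h2 : Continuous fun q : PathJet T s k × ℝ => q.1 n.succ := by fun_prop
    have h3 : Continuous fun q : PathJet T s k × ℝ => projIcc 0 T hT q.2 :=
      continuous_projIcc.comp continuous_snd
    exact continuous_eval.comp (h2.prodMk h3)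
  exact h1

theorem hasDerivWithinAt_of_compatible (hT : 0 ≤ T) {y : PathJet T s k}
    (hy : y ∈ compatibleJets hT s k) (n : Fin k) {t : ℝ} (ht : t ∈ Icc (0 : ℝ) T) :
    HasDerivWithinAt (IccExtend hT (y n.castSucc)) (IccExtend hT (y n.succ) t) (Icc 0 T) t := by
  have hc := continuous_IccExtend_path hT (y n.succ)
  have h1 : HasDerivAt (fun t => y n.castSucc ⟨0, left_mem_Icc.2 hT⟩
      + ∫ τ in (0 : ℝ)..t, IccExtend hT (y n.succ) τ) (IccExtend hT (y n.succ) t) t :=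
    (intervalIntegral.integral_hasDerivAt_right (hc.intervalIntegrable _ _)
      hc.stronglyMeasurable.stronglyMeasurableAtFilter hc.continuousAt).const_add _
  refine h1.hasDerivWithinAt.congr_of_mem (fun τ hτ => ?_) ht
  rw [IccExtend_of_mem hT _ hτ]
  exact (hy n).1 ⟨τ, hτ⟩

theorem contDiffOn_of_compatible (hT : 0 < T) {y : PathJet T s k}
    (hy : y ∈ compatibleJets hT.le s k) : ContDiffOn ℝ k (IccExtend hT.le (y 0)) (Icc 0 T) := by
  -- Induction on the number `d` of derivatives still available to the component of index `n = k -
  -- d`.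
  have h : ∀ (d n : ℕ) (hn : n + d = k),
      ContDiffOn ℝ d (IccExtend hT.le (y ⟨n, by omega⟩)) (Icc 0 T) := by
    intro d
    induction d with
    | zero =>
      intro n hn
      exact contDiffOn_zero.2 (continuous_IccExtend_path hT.le _).continuousOn
    | succ d ih =>
      intro n hn
      have hd := fun (t : ℝ) (ht : t ∈ Icc (0 : ℝ) T) =>
        hasDerivWithinAt_of_compatible hT.le hy ⟨n, by omega⟩ ht
      have hu := uniqueDiffOn_Icc hT
      rw [show ((d + 1 : ℕ) : WithTop ℕ∞) = (d : WithTop ℕ∞) + 1 by push_cast; rfl,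
        contDiffOn_succ_iff_derivWithin hu]
      refine ⟨fun t ht => (hd t ht).differentiableWithinAt, by simp, ?_⟩
      exact (ih (n + 1) (by omega)).congr fun t ht => (hd t ht).derivWithin (hu t ht)
  exact h k 0 (zero_add k)

end Compatible

/-! ### The jet operator preserves compatible jets -/

section Preserve

variable {T : ℝ} {s k : ℕ} {β : ℕ+ → HZero s →L[ℂ] ℂ}
  {K : Lp ℝ 2 (volume.restrict (Ioo (0 : ℝ) T)) →L[ℝ] Path T s →L[ℝ] Path T s}
  {A : JetL2 T k →L[ℝ] PathJet T s k →L[ℝ] PathJet T s k}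

/-- The Leibniz expansion of the derivatives of `θ β_j(y)`. -/
noncomputable def leibniz (θ : ℝ → ℝ) (f : ℕ → ℝ → ℂ) (n : ℕ) (τ : ℝ) : ℂ :=
  ∑ i ∈ Finset.range (n + 1), (n.choose i : ℂ) * (((iteratedDeriv i θ τ : ℝ) : ℂ) * f (n - i) τ)

/-- The product rule termwise, regrouped by Pascal's identity. -/
theorem hasDerivAt_leibniz {θ : ℝ → ℝ} (hθ : IsTestFun 0 T θ) {f : ℕ → ℝ → ℂ} {n : ℕ} {τ : ℝ}
    (hf : ∀ i ≤ n, HasDerivAt (f i) (f (i + 1) τ) τ) :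
    HasDerivAt (leibniz θ f n) (leibniz θ f (n + 1) τ) τ := by
  have h1 : ∀ i, HasDerivAt (fun τ => ((iteratedDeriv i θ τ : ℝ) : ℂ))
      ((iteratedDeriv (i + 1) θ τ : ℝ) : ℂ) τ := fun i => by
      rw [iteratedDeriv_succ]
      exact ((hθ.iteratedDeriv i).hasDerivAt τ).ofReal_comp
  have h2 : HasDerivAt (leibniz θ f n) (∑ i ∈ Finset.range (n + 1), (n.choose i : ℂ)
      * (((iteratedDeriv (i + 1) θ τ : ℝ) : ℂ) * f (n - i) τ
        + ((iteratedDeriv i θ τ : ℝ) : ℂ) * f (n - i + 1) τ)) τ := by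
    have := HasDerivAt.fun_sum (u := Finset.range (n + 1)) (x := τ)
      (A := fun i τ => (n.choose i : ℂ) * (((iteratedDeriv i θ τ : ℝ) : ℂ) * f (n - i) τ))
      fun i _ => ((h1 i).mul (hf (n - i) (Nat.sub_le _ _))).const_mul (n.choose i : ℂ)
    exact this
  refine h2.congr_deriv ?_
  rw [leibniz, Finset.sum_choose_succ_mul (fun i m => ((iteratedDeriv i θ τ : ℝ) : ℂ) * f m τ) n,
    ← Finset.sum_add_distrib]
  refine Finset.sum_congr rfl fun i hi => ?_
  rw [show n + 1 - i = n - i + 1 by have := Finset.mem_range.1 hi; omega]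
  ring

theorem continuous_leibniz {θ : ℝ → ℝ} (hθ : IsTestFun 0 T θ) {f : ℕ → ℝ → ℂ}
    (hf : ∀ i, Continuous (f i)) (n : ℕ) : Continuous (leibniz θ f n) := by
  unfold leibniz
  refine continuous_finsetSum _ fun i _ => continuous_const.mul ?_
  exact (Complex.continuous_ofReal.comp (hθ.iteratedDeriv i).continuous).mul (hf _)

theorem leibniz_eq_zero {θ : ℝ → ℝ} (hθ : IsTestFun 0 T θ) (f : ℕ → ℝ → ℂ) (n : ℕ) {τ : ℝ}
    (hτ : τ ∉ Ioo (0 : ℝ) T) : leibniz θ f n τ = 0 :=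
  Finset.sum_eq_zero fun i _ => by rw [(hθ.iteratedDeriv i).eq_zero hτ]; simp

/-- The components `β_j(y_n)` of a jet, extended by `0`. -/
noncomputable def jetCoef (hT : 0 ≤ T) (L : HZero s →L[ℂ] ℂ) (y : PathJet T s k) (n : ℕ) (τ : ℝ) :
    ℂ := if h : n < k + 1 then L (IccExtend hT (y ⟨n, h⟩) τ) else 0

theorem continuous_jetCoef (hT : 0 ≤ T) (L : HZero s →L[ℂ] ℂ) (y : PathJet T s k) (n : ℕ) :
    Continuous (jetCoef hT L y n) := by
  unfold jetCoef
  split_ifs with h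
  · exact L.continuous.comp (continuous_IccExtend_path hT _)
  · exact continuous_const

theorem hasDerivAt_jetCoef (hT : 0 ≤ T) (L : HZero s →L[ℂ] ℂ) {y : PathJet T s k}
    (hy : y ∈ compatibleJets hT s k) {n : ℕ} (hn : n < k) {τ : ℝ} (hτ : τ ∈ Ioo (0 : ℝ) T) :
    HasDerivAt (jetCoef hT L y n) (jetCoef hT L y (n + 1) τ) τ := by
  have h1 := (hasDerivWithinAt_of_compatible hT hy ⟨n, hn⟩ (Ioo_subset_Icc_self hτ)).hasDerivAt
    (Icc_mem_nhds hτ.1 hτ.2)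
  have h2 := (L.restrictScalars ℝ).hasFDerivAt.comp_hasDerivAt τ h1
  have e1 : jetCoef hT L y n = fun τ => L (IccExtend hT (y (⟨n, hn⟩ : Fin k).castSucc) τ) := by
    funext τ
    rw [jetCoef, dif_pos (by omega)]
    rfl
  have e2 : jetCoef hT L y (n + 1) τ = L (IccExtend hT (y (⟨n, hn⟩ : Fin k).succ) τ) := by
    rw [jetCoef, dif_pos (by omega)]
    rfl
  rw [e1, e2]
  exact h2

/-- For a test control, the binomial sum of Duhamel terms is a single Duhamel integral whose source
is the `n`-th Leibniz expansion; for `n < k` and a compatible jet, consecutive sources are then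
derivatives of each other. -/
theorem coef_jetOperator_test (hT : 0 ≤ T)
    (hK : ∀ u y (t : Icc (0 : ℝ) T) (j : ℕ+), HZero.coef s j (K u y t)
        = Complex.I * ∫ τ in (0 : ℝ)..t, phase (t - τ) j
          * ((u τ : ℂ) * β j (IccExtend hT y τ)))
    (hA : ∀ U y n, A U y n
      = ∑ m : Fin (k + 1), (((n : ℕ).choose m : ℕ) : ℝ) • K (U m) (y (subIdx n m)))
    {θ : ℝ → ℝ} (hθ : IsTestFun 0 T θ) {U : JetL2 T k}
    (hU : ∀ n : Fin (k + 1), U n =ᵐ[volume.restrict (Ioo (0 : ℝ) T)] iteratedDeriv n θ)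
    (y : PathJet T s k) (n : Fin (k + 1)) (t : Icc (0 : ℝ) T) (j : ℕ+) :
    HZero.coef s j (A U y n t) = Complex.I * ∫ τ in (0 : ℝ)..t, phase (t - τ) j
      * leibniz θ (jetCoef hT (β j) y) n τ := by
  have h1 : ∀ m : Fin (k + 1), HZero.coef s j (K (U m) (y (subIdx n m)) t)
      = Complex.I * ∫ τ in (0 : ℝ)..t, phase (t - τ) j
        * (((iteratedDeriv m θ τ : ℝ) : ℂ) * jetCoef hT (β j) y (n - m) τ) := by
    intro m
    rw [hK]
    congr 1
    refine integral_congr_of_ae_Ioo ?_ t.2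
    filter_upwards [hU m] with τ hτ
    rw [hτ, jetCoef, dif_pos (by omega)]
    rfl
  have h2 : ∀ τ, leibniz θ (jetCoef hT (β j) y) n τ = ∑ m : Fin (k + 1), ((n : ℕ).choose m : ℂ)
      * (((iteratedDeriv m θ τ : ℝ) : ℂ) * jetCoef hT (β j) y (n - m) τ) := by
    intro τ
    rw [Fin.sum_univ_eq_sum_range (fun m => ((n : ℕ).choose m : ℂ)
      * (((iteratedDeriv m θ τ : ℝ) : ℂ) * jetCoef hT (β j) y (n - m) τ)) (k + 1), leibniz]
    refine Finset.sum_subset (Finset.range_mono (by omega)) fun i _ hi => ?_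
    rw [Nat.choose_eq_zero_of_lt (by simpa using hi)]
    simp
  have hint : ∀ m : Fin (k + 1), IntervalIntegrable (fun τ => phase (t - τ) j
      * (((n : ℕ).choose m : ℂ) * (((iteratedDeriv m θ τ : ℝ) : ℂ) * jetCoef hT (β j) y (n - m) τ)))
      volume 0 t := fun m => by
    refine Continuous.intervalIntegrable ?_ _ _
    refine ((continuous_phase j).comp (continuous_const.sub continuous_id)).mul
      (continuous_const.mul ?_)
    exact (Complex.continuous_ofReal.comp (hθ.iteratedDeriv m).continuous).mul
      (continuous_jetCoef hT _ _ _)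
  simp only [h2, Finset.mul_sum]
  rw [intervalIntegral.integral_finsetSum fun m _ => hint m, hA, ContinuousMap.sum_apply, map_sum,
    Finset.mul_sum]
  refine Finset.sum_congr rfl fun m _ => ?_
  rw [ContinuousMap.smul_apply, map_real_smul, h1, mul_left_comm,
    ← intervalIntegral.integral_const_mul]
  congr 1
  refine intervalIntegral.integral_congr fun τ _ => ?_
  push_cast
  ring

/-- The source of index `n` vanishes at `0` and at `T` with the test function. Vanishing at `0`
gives the derivative relation between consecutive components; vanishing at `T` removes the source
term from the differentiated Duhamel formula and leaves the free relation there. -/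
theorem jetOperator_mem_of_test (hT : 0 ≤ T)
    (hK : ∀ u y (t : Icc (0 : ℝ) T) (j : ℕ+), HZero.coef s j (K u y t)
        = Complex.I * ∫ τ in (0 : ℝ)..t, phase (t - τ) j
          * ((u τ : ℂ) * β j (IccExtend hT y τ)))
    (hA : ∀ U y n, A U y n
      = ∑ m : Fin (k + 1), (((n : ℕ).choose m : ℕ) : ℝ) • K (U m) (y (subIdx n m)))
    {U : JetL2 T k} (hU : U ∈ testJets T k) {y : PathJet T s k}
    (hy : y ∈ compatibleJets hT s k) : A U y ∈ compatibleJets hT s k := by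
  obtain ⟨θ, hθ, hUθ⟩ := hU
  have hco := coef_jetOperator_test hT hK hA hθ hUθ y
  intro n
  have hF : ∀ j (i : ℕ), Continuous (leibniz θ (jetCoef hT (β j) y) i) := fun j i =>
    continuous_leibniz hθ (continuous_jetCoef hT (β j) y) i
  have hd : ∀ j, ∀ τ ∈ Ioo (0 : ℝ) T, HasDerivAt (leibniz θ (jetCoef hT (β j) y) n)
      (leibniz θ (jetCoef hT (β j) y) (n + 1) τ) τ := fun j τ hτ =>
    hasDerivAt_leibniz hθ fun i hi => hasDerivAt_jetCoef hT (β j) hy (hi.trans_lt n.2) hτ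
  have h0 : ∀ j, leibniz θ (jetCoef hT (β j) y) n 0 = 0 := fun j =>
    leibniz_eq_zero hθ _ _ (by simp)
  have hT0 : ∀ j, leibniz θ (jetCoef hT (β j) y) n T = 0 := fun j =>
    leibniz_eq_zero hθ _ _ (by simp)
  refine ⟨fun t => HZero.ext_coef fun j => ?_, fun j => ?_⟩
  · have hc := continuous_IccExtend_path hT (A U y n.succ)
    have h1 := ((HZero.coef s j).restrictScalars ℝ).intervalIntegral_comp_comm
      (hc.intervalIntegrable (μ := volume) 0 t)
    simp only [ContinuousLinearMap.coe_restrictScalars'] at h1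
    rw [map_add, ← h1, hco, hco]
    simp only [intervalIntegral.integral_same, mul_zero, zero_add]
    have h2 := integral_duhamel_deriv_eq (hF j n) (hF j (n + 1)) (hd j) (h0 j) j t.2
    refine h2.symm.trans (intervalIntegral.integral_congr fun σ hσ => ?_)
    rw [uIcc_of_le t.2.1] at hσ
    have hσ' : σ ∈ Icc (0 : ℝ) T := ⟨hσ.1, hσ.2.trans t.2.2⟩
    simp only [IccExtend_of_mem hT _ hσ', hco]
    rfl
  · rw [hco, hco]
    have h3 := duhamel_deriv_eq (hF j n) (hF j (n + 1)) (hd j) (h0 j) j (right_mem_Icc.2 hT)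
    rw [hT0, mul_zero, zero_sub] at h3
    refine h3.trans ?_
    rw [neg_mul]
    rfl

/-- For a fixed jet `y`, the controls `U` for which `A U y` is compatible form a closed set. It
contains the test jets, hence their closure. -/
theorem jetOperator_mem (hT : 0 ≤ T)
    (hK : ∀ u y (t : Icc (0 : ℝ) T) (j : ℕ+), HZero.coef s j (K u y t)
        = Complex.I * ∫ τ in (0 : ℝ)..t, phase (t - τ) j
          * ((u τ : ℂ) * β j (IccExtend hT y τ)))
    (hA : ∀ U y n, A U y n
      = ∑ m : Fin (k + 1), (((n : ℕ).choose m : ℕ) : ℝ) • K (U m) (y (subIdx n m)))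
    (U : HkZero T k) {y : PathJet T s k}
    (hy : y ∈ compatibleJets hT s k) : A (U : JetL2 T k) y ∈ compatibleJets hT s k := by
  have hcl : IsClosed {U : JetL2 T k | A U y ∈ compatibleJets hT s k} := by
    refine (isClosed_compatibleJets hT).preimage ?_
    exact (ContinuousLinearMap.apply ℝ (PathJet T s k) y).continuous.comp A.continuous
  have h1 : closure (testJets T k : Set (JetL2 T k))
      ⊆ {U : JetL2 T k | A U y ∈ compatibleJets hT s k} :=
    closure_minimal (fun U hU => jetOperator_mem_of_test hT hK hA hU hy) hcl
  exact h1 U.2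

end Preserve

/-! ### The jets of free evolutions -/

section Free

variable {T : ℝ} {s r k : ℕ}

theorem exists_freeGenerator (hr : s + 2 * k ≤ r) (n : ℕ) (hn : n ≤ k) :
    ∃ D : HZero r →L[ℂ] HZero s, ∀ φ j,
      HZero.coef s j (D φ) = (-(Complex.I * eigenval j)) ^ n * HZero.coef r j φ := by
  obtain ⟨D, hD, -⟩ := HZero.exists_diag r s (fun j => (-(Complex.I * eigenval j)) ^ n)
    (Real.pi ^ (2 * n)) fun j => by
      have hj : (1 : ℝ) ≤ (j : ℕ) := by exact_mod_cast j.pos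
      rw [norm_pow, norm_neg, norm_mul, Complex.norm_I, one_mul, Complex.norm_real, eigenval,
        Real.norm_of_nonneg (sq_nonneg _), ← pow_mul, mul_pow, ← mul_assoc, ← pow_add, mul_comm]
      exact mul_le_mul_of_nonneg_left (pow_le_pow_right₀ hj (by omega)) (by positivity)
  exact ⟨D, hD⟩

/-- The `n`-th time derivative of `e^{-iAt} φ` is `e^{-iAt} (-iA)^n φ`. It costs `2n ≤ 2k` orders of
regularity, which is why the initial datum is taken in `H^{2(p+k)+3}_(0)`. -/
theorem exists_freeJet (hT : 0 ≤ T) (hr : s + 2 * k ≤ r) :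
    ∃ S : HZero r →L[ℝ] PathJet T s k, (∀ φ n (t : Icc (0 : ℝ) T) j, HZero.coef s j (S φ n t)
        = phase t j * ((-(Complex.I * eigenval j)) ^ (n : ℕ) * HZero.coef r j φ)) ∧
      ∀ φ, S φ ∈ compatibleJets hT s k := by
  have h1 : ∀ n : Fin (k + 1), ∃ S : HZero r →L[ℝ] Path T s, ∀ φ (t : Icc (0 : ℝ) T) j,
      HZero.coef s j (S φ t)
        = phase t j * ((-(Complex.I * eigenval j)) ^ (n : ℕ) * HZero.coef r j φ) := by
    intro n
    obtain ⟨D, hD⟩ := exists_freeGenerator hr (n : ℕ) (by omega)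
    let S₀ : HZero r → Path T s := fun φ =>
      ⟨fun t => HZero.free s t (D φ), (HZero.continuous_free_apply (D φ)).comp
        continuous_subtype_val⟩
    have hS₀ : ∀ φ (t : Icc (0 : ℝ) T) j, HZero.coef s j (S₀ φ t)
        = phase t j * ((-(Complex.I * eigenval j)) ^ (n : ℕ) * HZero.coef r j φ) := fun φ t j => by
      change HZero.coef s j (HZero.free s t (D φ)) = _
      rw [HZero.coef_free, hD]
    refine ⟨LinearMap.mkContinuous
      { toFun := S₀
        map_add' := fun φ ψ => ContinuousMap.ext fun t => HZero.ext_coef fun j => by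
          rw [ContinuousMap.add_apply, map_add, hS₀, hS₀, hS₀, map_add]
          ring
        map_smul' := fun c φ => ContinuousMap.ext fun t => HZero.ext_coef fun j => by
          rw [RingHom.id_apply, ContinuousMap.smul_apply, map_real_smul, hS₀, hS₀, map_real_smul]
          ring } ‖D‖ fun φ => ?_, hS₀⟩
    refine (ContinuousMap.norm_le _ (by positivity)).2 fun t => ?_
    exact (HZero.norm_free_le _ _).trans (D.le_opNorm φ)
  choose S hS using h1
  refine ⟨ContinuousLinearMap.pi S, fun φ n t j => hS n φ t j, fun φ n => ⟨fun t =>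
    HZero.ext_coef fun j => ?_, fun j => ?_⟩⟩
  · have hc := continuous_IccExtend_path hT (S n.succ φ)
    have h1 := ((HZero.coef s j).restrictScalars ℝ).intervalIntegral_comp_comm
      (hc.intervalIntegrable (μ := volume) 0 t)
    simp only [ContinuousLinearMap.coe_restrictScalars'] at h1
    simp only [ContinuousLinearMap.coe_pi', map_add]
    rw [← h1, hS, hS]
    have h2 : ∫ τ in (0 : ℝ)..t, HZero.coef s j (IccExtend hT (S n.succ φ) τ)
        = ∫ τ in (0 : ℝ)..t, (-(Complex.I * eigenval j) * phase τ j)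
          * ((-(Complex.I * eigenval j)) ^ (n : ℕ) * HZero.coef r j φ) := by
      refine intervalIntegral.integral_congr fun σ hσ => ?_
      rw [uIcc_of_le t.2.1] at hσ
      have hσ' : σ ∈ Icc (0 : ℝ) T := ⟨hσ.1, hσ.2.trans t.2.2⟩
      simp only [IccExtend_of_mem hT _ hσ', hS, Fin.val_succ]
      ring
    rw [h2, intervalIntegral.integral_mul_const,
      intervalIntegral.integral_eq_sub_of_hasDerivAt (fun τ _ => hasDerivAt_phase j τ)
        ((continuous_const.mul (continuous_phase j)).intervalIntegrable _ _)]
    simp only [phase_zero, Fin.val_castSucc]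
    ring
  · simp only [ContinuousLinearMap.coe_pi', hS, Fin.val_succ, Fin.val_castSucc]
    ring

end Free

/-! ### The weak formulation as a fixed point equation -/

section Weak

variable {T : ℝ} {s r k : ℕ} {μ : ℝ → ℝ} {M : L2 →L[ℂ] L2}
  {K : Lp ℝ 2 (volume.restrict (Ioo (0 : ℝ) T)) →L[ℝ] Path T s →L[ℝ] Path T s}

/-- The coefficient `φ ↦ ⟨M φ, φ_j⟩`. -/
noncomputable def mulCoef (M : L2 →L[ℂ] L2) (s : ℕ) (j : ℕ+) : HZero s →L[ℂ] ℂ :=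
  (innerSL ℂ (eigenfun j)).comp (M.comp (HZero.inclL s))

theorem mulCoef_apply (M : L2 →L[ℂ] L2) (j : ℕ+) (φ : HZero s) :
    mulCoef M s j φ = inner ℂ (eigenfun j) (M (φ : L2)) := rfl

theorem continuous_freeGroup_sub (M : L2 →L[ℂ] L2) {y : ℝ → HZero s} (hy : Continuous y) (t : ℝ) :
    Continuous fun τ => freeGroup (t - τ) (M (y τ : L2)) := by
  have h0 : Continuous fun τ => HZero.inclL s (y τ) := by fun_prop
  have h1 : Continuous fun τ => M (y τ : L2) := M.continuous.comp h0
  have h2 : Continuous fun τ => t - τ := by fun_prop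
  have h3 := continuous_freeGroup_uncurry.comp (h2.prodMk h1)
  exact h3

theorem intervalIntegrable_ofReal_smul {E : Type*} [NormedAddCommGroup E] [NormedSpace ℂ E]
    {u : ℝ → ℝ} (hu : MemLp u 2 (volume.restrict (Ioo (0 : ℝ) T))) {g : ℝ → E} (hg : Continuous g)
    {t : ℝ} (ht : t ∈ Icc (0 : ℝ) T) :
    IntervalIntegrable (fun τ => (u τ : ℂ) • g τ) volume 0 t := by
  have hui := intervalIntegrable_of_memLp_Ioo hu le_rfl ht.1 ht.2
  have huc : IntervalIntegrable (fun τ => (u τ : ℂ)) volume 0 t := ⟨hui.1.ofReal, hui.2.ofReal⟩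
  exact huc.smul_continuousOn hg.continuousOn

/-- The weak formulation with a source `v M z` is the equation
`y = e^{-iAt} ψ₀ + K(v) z + K(u) y`. -/
theorem weak_formula_iff (hT : 0 ≤ T) (hM : ∀ φ, M φ = mulL2 μ φ)
    (hK : ∀ u y (t : Icc (0 : ℝ) T) (j : ℕ+), HZero.coef s j (K u y t)
        = Complex.I * ∫ τ in (0 : ℝ)..t, phase (t - τ) j
          * ((u τ : ℂ) * mulCoef M s j (IccExtend hT y τ)))
    (u v : Lp ℝ 2 (volume.restrict (Ioo (0 : ℝ) T))) {f : ℝ → L2} {z : Path T s}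
    (hf : f =ᵐ[volume.restrict (Ioo (0 : ℝ) T)]
      fun τ => (v τ : ℂ) • M (IccExtend hT z τ : HZero s))
    {ψ : ℝ → HZero s} {y : Path T s} (hψ : ∀ t : Icc (0 : ℝ) T, ψ t = y t)
    {ψ₀ : L2} {y₀ : Path T s}
    (hy₀ : ∀ (t : Icc (0 : ℝ) T) j, HZero.coef s j (y₀ t) = phase t j * inner ℂ (eigenfun j) ψ₀) :
    (∀ t ∈ Icc 0 T, (ψ t : L2) = freeGroup t ψ₀ +
      Complex.I • ∫ τ in (0 : ℝ)..t, freeGroup (t - τ) ((u τ : ℂ) • mulL2 μ (ψ τ) + f τ))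
      ↔ y = y₀ + K v z + K u y := by
  have hcoef : ∀ (t : Icc (0 : ℝ) T) (j : ℕ+), inner ℂ (eigenfun j) (freeGroup t ψ₀ +
      Complex.I • ∫ τ in (0 : ℝ)..t, freeGroup (t - τ) ((u τ : ℂ) • mulL2 μ (ψ τ) + f τ))
      = HZero.coef s j ((y₀ + K v z + K u y) t) := by
    intro t j
    have hu := intervalIntegrable_ofReal_smul (Lp.memLp u)
      (continuous_freeGroup_sub M (continuous_IccExtend_path hT y) t) t.2
    have hv := intervalIntegrable_ofReal_smul (Lp.memLp v)
      (continuous_freeGroup_sub M (continuous_IccExtend_path hT z) t) t.2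
    have h1 : ∫ τ in (0 : ℝ)..t, freeGroup (t - τ) ((u τ : ℂ) • mulL2 μ (ψ τ) + f τ)
        = ∫ τ in (0 : ℝ)..t, ((u τ : ℂ) • freeGroup (t - τ) (M (IccExtend hT y τ : HZero s))
          + (v τ : ℂ) • freeGroup (t - τ) (M (IccExtend hT z τ : HZero s))) := by
      refine integral_congr_of_ae_Ioo ?_ t.2
      filter_upwards [hf, ae_restrict_mem measurableSet_Ioo] with τ hτ hτm
      rw [hτ, freeGroup_add, freeGroup_smul, freeGroup_smul, hM (IccExtend hT y τ : HZero s),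
        IccExtend_of_mem hT y (Ioo_subset_Icc_self hτm), ← hψ]
    have h2 : ∀ (w : Lp ℝ 2 (volume.restrict (Ioo (0 : ℝ) T))) (x : Path T s),
        IntervalIntegrable (fun τ => (w τ : ℂ) • freeGroup (t - τ) (M (IccExtend hT x τ : HZero s)))
          volume 0 t → Complex.I * inner ℂ (eigenfun j)
          (∫ τ in (0 : ℝ)..t, (w τ : ℂ) • freeGroup (t - τ) (M (IccExtend hT x τ : HZero s)))
          = HZero.coef s j (K w x t) := by
      intro w x hi
      rw [hK, ← innerSL_apply_apply ℂ,
        ← ContinuousLinearMap.intervalIntegral_comp_comm (innerSL ℂ (eigenfun j)) hi]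
      congr 1
      refine intervalIntegral.integral_congr fun τ _ => ?_
      simp only [innerSL_apply_apply, inner_smul_right, inner_freeGroup, mulCoef_apply]
      ring
    rw [h1, intervalIntegral.integral_add hu hv, inner_add_right, inner_smul_right, inner_add_right,
      mul_add, h2 u y hu, h2 v z hv, inner_freeGroup, ← hy₀, ContinuousMap.add_apply,
      ContinuousMap.add_apply, map_add, map_add]
    ring
  constructor
  · intro h
    refine ContinuousMap.ext fun t => HZero.ext_coef fun j => ?_
    rw [← hcoef, ← h t t.2, ← hψ]
    rfl
  · intro h t ht
    refine L2.ext_inner fun j => ?_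
    refine Eq.trans ?_ (hcoef ⟨t, ht⟩ j).symm
    rw [← h, ← hψ]
    rfl

/-- For jets of length one the jet operator is `K u` itself, so `1 - K u` is injective by the
invertibility already proved. Uniqueness thus holds among continuous paths. -/
theorem eq_zero_of_duhamel_eq (hT : 0 ≤ T) {C : ℝ} (hC : 0 ≤ C)
    (hK : ∀ u y (t : Icc (0 : ℝ) T),
      ‖K u y t‖ ^ 2 ≤ C * ∫ τ in (0 : ℝ)..t, u τ ^ 2 * ‖IccExtend hT y τ‖ ^ 2)
    (u : Lp ℝ 2 (volume.restrict (Ioo (0 : ℝ) T))) {w : Path T s} (hw : w = K u w) : w = 0 := by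
  obtain ⟨A, hA⟩ := exists_jetOperator K 0
  set U : JetL2 T 0 := WithLp.toLp 2 fun _ => u with hU
  obtain ⟨a, ha⟩ := jetOperator_isUnit hT hK hC hA U
  set y : PathJet T s 0 := fun _ => w with hy
  have h1 : (1 - A U) y = 0 := by
    funext n
    have : A U y n = K u w := by
      rw [hA]
      simp [hU, hy]
    rw [sub_apply, one_apply_eq_self, Pi.sub_apply, this, ← hw, sub_self]
    rfl
  have h2 : y = 0 := by
    have h3 : (↑a⁻¹ * ↑a : PathJet T s 0 →L[ℝ] PathJet T s 0) y = 0 := by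
      rw [ha, mul_apply_eq_comp, h1, map_zero]
    rwa [a.inv_mul, one_apply_eq_self] at h3
  exact congrFun h2 0

/-- The restriction to `[0,T]` of a path that is continuous there. -/
noncomputable def restrictPath {ψ : ℝ → HZero s} (hψ : ContinuousOn ψ (Icc 0 T)) : Path T s :=
  ⟨(Icc 0 T).domRestrict ψ, hψ.domRestrict⟩

/-- Weak solutions are unique. -/
theorem IsWeakSolution.eqOn (hT : 0 ≤ T) (hM : ∀ φ, M φ = mulL2 μ φ)
    (hK : ∀ u y (t : Icc (0 : ℝ) T) (j : ℕ+), HZero.coef s j (K u y t)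
        = Complex.I * ∫ τ in (0 : ℝ)..t, phase (t - τ) j
          * ((u τ : ℂ) * mulCoef M s j (IccExtend hT y τ)))
    {C : ℝ} (hC : 0 ≤ C) (hKC : ∀ u y (t : Icc (0 : ℝ) T),
      ‖K u y t‖ ^ 2 ≤ C * ∫ τ in (0 : ℝ)..t, u τ ^ 2 * ‖IccExtend hT y τ‖ ^ 2)
    (u v : Lp ℝ 2 (volume.restrict (Ioo (0 : ℝ) T))) {f : ℝ → L2} {z : Path T s}
    (hf : f =ᵐ[volume.restrict (Ioo (0 : ℝ) T)]
      fun τ => (v τ : ℂ) • M (IccExtend hT z τ : HZero s))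
    {ψ₀ : L2} {y₀ : Path T s}
    (hy₀ : ∀ (t : Icc (0 : ℝ) T) j, HZero.coef s j (y₀ t) = phase t j * inner ℂ (eigenfun j) ψ₀)
    {ψ ψ' : ℝ → HZero s} (h : IsWeakSolution T k s μ u f ψ₀ ψ)
    (h' : IsWeakSolution T k s μ u f ψ₀ ψ') : EqOn ψ ψ' (Icc 0 T) := by
  set y := restrictPath h.1.continuousOn with hy
  set y' := restrictPath h'.1.continuousOn with hy'
  have e := (weak_formula_iff hT hM hK u v hf (y := y) (fun _ => rfl) hy₀).1 h.2
  have e' := (weak_formula_iff hT hM hK u v hf (y := y') (fun _ => rfl) hy₀).1 h'.2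
  have h0 : y - y' = 0 := eq_zero_of_duhamel_eq hT hC hKC u (by
    conv_lhs => rw [e, e']
    rw [map_sub]
    abel)
  intro t ht
  exact congrArg (fun w : Path T s => w ⟨t, ht⟩) (sub_eq_zero.1 h0)

end Weak

/-! ### Regularity at the final time and the projections -/

theorem eigenval_pos (j : ℕ+) : 0 < eigenval j := by
  have := j.pos
  have := Real.pi_pos
  unfold eigenval
  positivity

theorem neg_I_mul_eigenval_ne_zero (j : ℕ+) : -(Complex.I * eigenval j) ≠ 0 :=
  neg_ne_zero.2 (mul_ne_zero Complex.I_ne_zero (by exact_mod_cast (eigenval_pos j).ne'))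

/-- The operator `(-iA)^{-k}` from `H^s_(0)` to `H^{s+2k}_(0)`. -/
theorem exists_inverseGenerator_pow {s r k : ℕ} (hr : r = s + 2 * k) :
    ∃ L : HZero s →L[ℂ] HZero r, ∀ φ j,
      HZero.coef r j (L φ) = ((-(Complex.I * eigenval j)) ^ k)⁻¹ * HZero.coef s j φ := by
  obtain ⟨L, hL, -⟩ := HZero.exists_diag s r (fun j => ((-(Complex.I * eigenval j)) ^ k)⁻¹) 1
    fun j => by
      have hj : (1 : ℝ) ≤ (j : ℕ) := by exact_mod_cast j.pos
      have h1 : ‖((-(Complex.I * eigenval j)) ^ k)⁻¹‖ = (eigenval j ^ k)⁻¹ := by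
        rw [norm_inv, norm_pow, norm_neg, norm_mul, Complex.norm_I, one_mul, Complex.norm_real,
          Real.norm_of_nonneg (eigenval_pos j).le]
      have h2 : ((j : ℕ) : ℝ) ^ (2 * k) ≤ eigenval j ^ k := by
        rw [pow_mul]
        refine pow_le_pow_left₀ (by positivity) ?_ k
        unfold eigenval
        refine pow_le_pow_left₀ (by positivity) ?_ 2
        exact le_mul_of_one_le_right (by positivity) (by linarith [Real.pi_gt_three])
      rw [h1, ← div_eq_mul_inv, div_le_iff₀ (pow_pos (eigenval_pos j) k), hr, pow_add, one_mul]
      gcongr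
  exact ⟨L, hL⟩

/-- Iterates the relation at the final time. As the last component is in `H^s_(0)`, this is the gain
of `2k` orders for the first component at time `T`. -/
theorem coef_last_of_compatible {T : ℝ} {s k : ℕ} (hT : 0 ≤ T) {y : PathJet T s k}
    (hy : y ∈ compatibleJets hT s k) (j : ℕ+) :
    HZero.coef s j (y (Fin.last k) ⟨T, right_mem_Icc.2 hT⟩)
      = (-(Complex.I * eigenval j)) ^ k * HZero.coef s j (y 0 ⟨T, right_mem_Icc.2 hT⟩) := by
  have h : ∀ (n : ℕ) (hn : n < k + 1), HZero.coef s j (y ⟨n, hn⟩ ⟨T, right_mem_Icc.2 hT⟩)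
      = (-(Complex.I * eigenval j)) ^ n * HZero.coef s j (y 0 ⟨T, right_mem_Icc.2 hT⟩) := by
    intro n
    induction n with
    | zero => intro _; rw [pow_zero, one_mul]; rfl
    | succ n ih =>
      intro hn
      have h1 := (hy ⟨n, by omega⟩).2 j
      rw [pow_succ', mul_assoc, ← ih (by omega)]
      exact h1
  exact h k (Nat.lt_succ_self k)

theorem eigenfun_mem_spanJ {J : Set ℕ+} {j : ℕ+} (hj : j ∈ J) : eigenfun j ∈ spanJ J :=
  Submodule.le_topologicalClosure _ (Submodule.subset_span ⟨j, hj, rfl⟩)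

theorem inner_eigenfun_of_mem_spanJ {J : Set ℕ+} {j : ℕ+} (hj : j ∉ J) {φ : L2}
    (hφ : φ ∈ spanJ J) : inner ℂ (eigenfun j) φ = 0 := by
  have h1 : spanJ J ≤ (innerSL ℂ (eigenfun j)).ker := by
    refine Submodule.topologicalClosure_minimal _ ?_ (innerSL ℂ (eigenfun j)).isClosed_ker
    rw [Submodule.span_le]
    rintro _ ⟨i, hi, rfl⟩
    change inner ℂ (eigenfun j) (eigenfun i) = 0
    rw [inner_eigenfun_eigenfun, if_neg]
    rintro rfl
    exact hj hi
  exact h1 hφ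

open Classical in
-- The projection is diagonal in the eigenfunctions, hence acts on every `H^s_(0)`.
theorem inner_projJ (J : Set ℕ+) (φ : L2) (j : ℕ+) :
    inner ℂ (eigenfun j) (projJ J φ) = (if j ∈ J then 1 else 0) * inner ℂ (eigenfun j) φ := by
  have hm : projJ J φ ∈ spanJ J := Submodule.starProjection_apply_mem _ _
  split_ifs with hj
  · have h1 := Submodule.starProjection_inner_eq_zero (K := spanJ J) φ _ (eigenfun_mem_spanJ hj)
    rw [← inner_conj_symm, map_eq_zero, inner_sub_right, sub_eq_zero] at h1
    rw [one_mul]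
    exact h1.symm
  · rw [zero_mul]
    exact inner_eigenfun_of_mem_spanJ hj hm

theorem norm_groundState (T : ℝ) : ‖groundState T‖ = 1 := by
  change ‖phase T 1 • eigenfun 1‖ = 1
  rw [norm_smul, norm_phase, one_mul]
  exact orthonormal_eigenfun.1 1

theorem inner_eigenfun_groundState (T : ℝ) (j : ℕ+) :
    inner ℂ (eigenfun j) (groundState T) = if j = 1 then phase T 1 else 0 := by
  change inner ℂ (eigenfun j) (phase T 1 • eigenfun 1) = _
  rw [inner_smul_right, inner_eigenfun_eigenfun, mul_ite, mul_one, mul_zero]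

theorem re_inner_tangentProj {χ : L2} (hχ : ‖χ‖ = 1) (φ : L2) :
    (inner ℂ χ (tangentProj χ φ)).re = 0 := by
  rw [tangentProj, inner_sub_right, inner_smul_right, inner_self_eq_norm_sq_to_K, hχ]
  simp

theorem re_inner_groundState_eq_zero {J : Set ℕ+} (hJ : (1 : ℕ+) ∉ J) (T : ℝ) {φ : L2}
    (hφ : φ ∈ spanJ J) : inner ℂ (groundState T) φ = 0 := by
  change inner ℂ (phase T 1 • eigenfun 1) φ = 0
  rw [inner_smul_left, inner_eigenfun_of_mem_spanJ hJ hφ, mul_zero]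

/-- Either `1 ∈ J` and the ground state lies in `H_J`, or `1 ∉ J` and the ground state is orthogonal
to `H_J`, so that nothing is subtracted. -/
theorem tangentProj_projJ_mem_spanJ (T : ℝ) (J : Set ℕ+) (φ : L2) :
    tangentProj (groundState T) (projJ J φ) ∈ spanJ J := by
  have hm : projJ J φ ∈ spanJ J := Submodule.starProjection_apply_mem _ _
  by_cases hJ : (1 : ℕ+) ∈ J
  · exact (spanJ J).sub_mem hm ((spanJ J).smul_mem _ ((spanJ J).smul_mem _ (eigenfun_mem_spanJ hJ)))
  · rw [tangentProj, re_inner_groundState_eq_zero hJ T hm]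
    simpa using hm

/-- The ground state in `H^r_(0)`. -/
theorem exists_groundState_lift (T : ℝ) (r : ℕ) : ∃ g : HZero r, (g : L2) = groundState T := by
  obtain ⟨g, hg, -⟩ := HZero.exists_of_sum_le (s := r)
    (c := fun j => if j = 1 then phase T 1 else 0) zero_le_one fun F => by
      have h1 : ∀ j : ℕ+, (((j : ℕ) : ℝ) ^ r * ‖(if j = 1 then phase T 1 else 0 : ℂ)‖) ^ 2
          = if j = 1 then 1 else 0 := fun j => by
        split_ifs with h
        · simp [h, norm_phase]
        · simp
      simp only [h1, Finset.sum_ite_eq']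
      split_ifs <;> norm_num
  refine ⟨g, L2.ext_inner fun j => ?_⟩
  rw [inner_eigenfun_groundState, ← HZero.coef_apply, hg]

/-- The diagonal operator of the indicator of `J`, minus a rank one operator directed by the ground
state, which belongs to every `H^r_(0)`. The real part makes the result only real linear. -/
theorem exists_targetProj (T : ℝ) (J : Set ℕ+) (r : ℕ) :
    ∃ Q : HZero r →L[ℝ] targetSpace T J r, ∀ w : HZero r,
      ((Q w : HZero r) : L2) = tangentProj (groundState T) (projJ J w) := by
  classical
  obtain ⟨P, hP, -⟩ := HZero.exists_diag r r (fun j => if j ∈ J then 1 else 0) 1 fun j => by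
    split_ifs <;> simp
  obtain ⟨g, hg⟩ := exists_groundState_lift T r
  have hPJ : ∀ w : HZero r, (P w : L2) = projJ J (w : L2) := fun w =>
    L2.ext_inner fun j => by
      rw [inner_projJ, ← HZero.coef_apply, hP]
      rfl
  let ℓ : HZero r →L[ℝ] ℝ := Complex.reCLM.comp
    (((innerSL ℂ (groundState T)).comp ((HZero.inclL r).comp P)).restrictScalars ℝ)
  let Q₀ : HZero r →L[ℝ] HZero r := P.restrictScalars ℝ - ℓ.smulRight g
  have hQ₀ : ∀ w, (Q₀ w : L2) = tangentProj (groundState T) (projJ J (w : L2)) := by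
    intro w
    have h1 : HZero.incl r (ℓ w • g) = ((ℓ w : ℝ) : ℂ) • HZero.incl r g :=
      (HZero.incl r).map_smul ((ℓ w : ℝ) : ℂ) g
    change HZero.incl r (P w - ℓ w • g) = _
    rw [map_sub, h1, hg, hPJ, tangentProj]
    change _ - (((inner ℂ (groundState T) (P w : L2)).re : ℝ) : ℂ) • _ = _
    rw [hPJ]
  refine ⟨Q₀.codRestrict (targetSpace T J r) fun w => ⟨?_, ?_⟩, hQ₀⟩
  · rw [hQ₀]
    exact re_inner_tangentProj (norm_groundState T) _
  · rw [hQ₀]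
    exact tangentProj_projJ_mem_spanJ T J _

/-! ### The solution operator -/

theorem MemSobolev.mono {m n : ℕ} {f : ℝ → ℝ} (hf : MemSobolev n f) (h : m ≤ n) :
    MemSobolev m f := ⟨hf.1, fun i hi => hf.2 i (hi.trans h)⟩

/-! ### Differentiability of fixed points of linear equations depending on a parameter -/

section FixedPoint

variable {X Y : Type*} [NormedAddCommGroup X] [NormedSpace ℝ X] [NormedAddCommGroup Y]
  [NormedSpace ℝ Y]

/-- Inversion is smooth at units of a complete normed algebra, and the operator and the right side
depend linearly on the parameter. -/
theorem contDiff_inverse_one_sub_apply [CompleteSpace Y] (c : X →L[ℝ] Y →L[ℝ] Y) (f : X →L[ℝ] Y)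
    (hc : ∀ x, IsUnit (1 - c x)) : ContDiff ℝ 1 fun x => Ring.inverse (1 - c x) (f x) := by
  refine contDiff_iff_contDiffAt.2 fun x => ?_
  obtain ⟨a, ha⟩ := hc x
  have h1 : ContDiffAt ℝ 1 (fun x => 1 - c x) x := contDiffAt_const.sub c.contDiff.contDiffAt
  have h2 : ContDiffAt ℝ 1 Ring.inverse (1 - c x) := by
    rw [← ha]
    exact contDiffAt_ringInverse ℝ a
  have h3 : ContDiffAt ℝ 1 (fun x => Ring.inverse (1 - c x)) x :=
    ContDiffAt.comp (g := Ring.inverse) (f := fun x => 1 - c x) x h2 h1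
  exact h3.clm_apply f.contDiff.contDiffAt

/-- Once `g` is known to be differentiable, its equation is differentiated by the product rule; the
result is an equation with the same operator `c x` for the differential. -/
theorem fderiv_of_fixedPoint (c : X →L[ℝ] Y →L[ℝ] Y) (f : X →L[ℝ] Y) {g : X → Y} {x : X}
    (hg : DifferentiableAt ℝ g x) (h : ∀ x, g x = f x + c x (g x)) (v : X) :
    fderiv ℝ g x v = f v + c v (g x) + c x (fderiv ℝ g x v) := by
  have h1 := f.hasFDerivAt.add (c.hasFDerivAt.clm_apply hg.hasFDerivAt)
  have h2 := hg.hasFDerivAt.unique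
    (h1.congr_of_eventuallyEq (Filter.Eventually.of_forall h))
  refine (DFunLike.congr_fun h2 v).trans ?_
  simp only [add_apply, ContinuousLinearMap.comp_apply, ContinuousLinearMap.flip_apply]
  abel

variable {X' Z : Type*} [NormedAddCommGroup X'] [NormedSpace ℝ X'] [NormedAddCommGroup Z]
  [NormedSpace ℝ Z]

theorem contDiff_fst_prodMk_comp (R : Y →L[ℝ] Z) {g : X × X' → Y} (hg : ContDiff ℝ 1 g) :
    ContDiff ℝ 1 fun x => (x.1, R (g x)) :=
  contDiff_fst.prodMk (R.contDiff.comp hg)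

theorem fderiv_fst_prodMk_comp (R : Y →L[ℝ] Z) {g : X × X' → Y} {x : X × X'}
    (hg : DifferentiableAt ℝ g x) (v : X × X') :
    fderiv ℝ (fun x => (x.1, R (g x))) x v = (v.1, R (fderiv ℝ g x v)) := by
  have h1 : HasFDerivAt (fun x => (x.1, R (g x))) _ x :=
    hasFDerivAt_fst.prodMk (R.hasFDerivAt.comp x hg.hasFDerivAt)
  rw [h1.fderiv]
  rfl

end FixedPoint

/-- The operators in terms of which the Cauchy problem is a fixed point problem for jets:
multiplication by `μ`, the Duhamel operator `K` and its jet version `A`, the jets `S` of free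
solutions, and the inverse `L` of the `k`-th power of the generator. -/
structure Evolution (T : ℝ) (hT : 0 ≤ T) (p k : ℕ) (μ : ℝ → ℝ) where
  M : L2 →L[ℂ] L2
  M_apply : ∀ φ, M φ = mulL2 μ φ
  K : Lp ℝ 2 (volume.restrict (Ioo (0 : ℝ) T)) →L[ℝ] Path T (2 * p + 3) →L[ℝ] Path T (2 * p + 3)
  coef_K : ∀ u y (t : Icc (0 : ℝ) T) (j : ℕ+), HZero.coef (2 * p + 3) j (K u y t)
    = Complex.I * ∫ τ in (0 : ℝ)..t, phase (t - τ) j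
      * ((u τ : ℂ) * mulCoef M (2 * p + 3) j (IccExtend hT y τ))
  C : ℝ
  C_nonneg : 0 ≤ C
  K_estimate : ∀ u y (t : Icc (0 : ℝ) T),
    ‖K u y t‖ ^ 2 ≤ C * ∫ τ in (0 : ℝ)..t, u τ ^ 2 * ‖IccExtend hT y τ‖ ^ 2
  A : JetL2 T k →L[ℝ] PathJet T (2 * p + 3) k →L[ℝ] PathJet T (2 * p + 3) k
  A_apply : ∀ U y n, A U y n
    = ∑ m : Fin (k + 1), (((n : ℕ).choose m : ℕ) : ℝ) • K (U m) (y (subIdx n m))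
  S : HZero (2 * (p + k) + 3) →L[ℝ] PathJet T (2 * p + 3) k
  coef_S : ∀ φ n (t : Icc (0 : ℝ) T) j, HZero.coef (2 * p + 3) j (S φ n t)
    = phase t j * ((-(Complex.I * eigenval j)) ^ (n : ℕ) * HZero.coef (2 * (p + k) + 3) j φ)
  S_mem : ∀ φ, S φ ∈ compatibleJets hT (2 * p + 3) k
  L : HZero (2 * p + 3) →L[ℂ] HZero (2 * (p + k) + 3)
  coef_L : ∀ φ j, HZero.coef (2 * (p + k) + 3) j (L φ)
    = ((-(Complex.I * eigenval j)) ^ k)⁻¹ * HZero.coef (2 * p + 3) j φ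

theorem nonempty_evolution {T : ℝ} (hT : 0 ≤ T) {p k : ℕ} {μ : ℝ → ℝ}
    (hμ : MemSobolev (2 * (p + k) + 3) μ) (hμ' : ∀ n < p, DerivVanishesAtEnds (2 * n + 1) μ) :
    Nonempty (Evolution T hT p k μ) := by
  have hμs : MemSobolev (2 * p + 3) μ := hμ.mono (by omega)
  obtain ⟨M, hM⟩ := MemSobolev.exists_mulL (m := 2 * p + 2) hμs
  obtain ⟨a, b, c, habc⟩ := exists_mul_decomposition hμs hμ'
  have hβ : IsSmoothing (mulCoef M (2 * p + 3)) := ⟨a, b, c, fun φ j => by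
    rw [mulCoef_apply, hM]
    exact habc φ j⟩
  obtain ⟨K, hK, C, hC, hKC⟩ := hβ.exists_duhamel hT
  obtain ⟨A, hA⟩ := exists_jetOperator K k
  obtain ⟨S, hS, hSm⟩ := exists_freeJet (T := T) (s := 2 * p + 3) (k := k)
    (r := 2 * (p + k) + 3) hT (by omega)
  obtain ⟨L, hL⟩ := exists_inverseGenerator_pow (s := 2 * p + 3) (r := 2 * (p + k) + 3) (k := k)
    (by ring)
  exact ⟨⟨M, hM, K, hK, C, hC, hKC, A, hA, S, hS, hSm, L, hL⟩⟩

/-! ### Solutions of the Cauchy problem and of its linearization as jets -/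

namespace Evolution

variable {T : ℝ} {hT : 0 ≤ T} {p k : ℕ} {μ : ℝ → ℝ} (E : Evolution T hT p k μ)

theorem isUnit (U : JetL2 T k) : IsUnit (1 - E.A U) :=
  jetOperator_isUnit hT E.K_estimate E.C_nonneg E.A_apply U

/-- The solution `y` of `y = f + A(U) y`. -/
noncomputable def jet (U : JetL2 T k) (f : PathJet T (2 * p + 3) k) : PathJet T (2 * p + 3) k :=
  Ring.inverse (1 - E.A U) f

theorem jet_eq (U : JetL2 T k) (f : PathJet T (2 * p + 3) k) :
    E.jet U f = f + E.A U (E.jet U f) := by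
  have h1 : ((1 - E.A U) * Ring.inverse (1 - E.A U)) f = f := by
    rw [Ring.mul_inverse_cancel _ (E.isUnit U), one_apply_eq_self]
  rw [mul_apply_eq_comp, sub_apply, one_apply_eq_self] at h1
  exact sub_eq_iff_eq_add.1 h1

theorem eq_jet {U : JetL2 T k} {f y : PathJet T (2 * p + 3) k} (h : y = f + E.A U y) :
    y = E.jet U f := by
  have h1 : (1 - E.A U) y = f := by
    rw [sub_apply, one_apply_eq_self]
    exact sub_eq_iff_eq_add.2 h
  rw [jet, ← h1, ← mul_apply_eq_comp, Ring.inverse_mul_cancel _ (E.isUnit U), one_apply_eq_self]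

theorem A_mem (U : HkZero T k) {y : PathJet T (2 * p + 3) k}
    (hy : y ∈ compatibleJets hT (2 * p + 3) k) :
    E.A (U : JetL2 T k) y ∈ compatibleJets hT (2 * p + 3) k :=
  jetOperator_mem hT E.coef_K E.A_apply U hy

theorem jet_mem (U : HkZero T k) {f : PathJet T (2 * p + 3) k}
    (hf : f ∈ compatibleJets hT (2 * p + 3) k) :
    E.jet (U : JetL2 T k) f ∈ compatibleJets hT (2 * p + 3) k := by
  refine mem_of_fixedPoint (E.A (U : JetL2 T k)) _ (isClosed_compatibleJets hT)
    (fun y hy => E.A_mem U hy) hf (E.jet_eq U f) ?_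
  have h1 := (jetOperator_tendsto hT E.K_estimate E.C_nonneg E.A_apply U).mul_const
    ‖E.jet (U : JetL2 T k) f‖
  rw [zero_mul] at h1
  exact squeeze_zero_norm (fun n => ContinuousLinearMap.le_opNorm _ _) h1

/-- The row of index `0` of the jet equation is the original Duhamel equation. -/
theorem A_apply_zero (U : JetL2 T k) (y : PathJet T (2 * p + 3) k) :
    E.A U y 0 = E.K (U 0) (y 0) := by
  rw [E.A_apply, Finset.sum_eq_single 0]
  · have : subIdx (0 : Fin (k + 1)) 0 = 0 := rfl
    rw [this]
    simp
  · intro m _ hm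
    have h1 : (0 : ℕ) < (m : ℕ) := Nat.pos_of_ne_zero fun h => hm (Fin.ext h)
    have h2 : (((0 : Fin (k + 1)) : ℕ).choose m : ℕ) = 0 := Nat.choose_eq_zero_of_lt h1
    rw [h2, Nat.cast_zero, zero_smul]
  · intro h
    exact absurd (Finset.mem_univ _) h

theorem coef_S_zero (φ : HZero (2 * (p + k) + 3)) (t : Icc (0 : ℝ) T) (j : ℕ+) :
    HZero.coef (2 * p + 3) j (E.S φ 0 t) = phase t j * inner ℂ (eigenfun j) (φ : L2) := by
  rw [E.coef_S, Fin.val_zero, pow_zero, one_mul]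
  rfl

/-- The value in `H^{2(p+k)+3}_(0)` of a compatible jet at the final time. -/
noncomputable def final : PathJet T (2 * p + 3) k →L[ℝ] HZero (2 * (p + k) + 3) :=
  (E.L.restrictScalars ℝ).comp
    ((ContinuousMap.evalCLM ℝ (⟨T, right_mem_Icc.2 hT⟩ : Icc (0 : ℝ) T)).comp
    (ContinuousLinearMap.proj (R := ℝ) (φ := fun _ : Fin (k + 1) => Path T (2 * p + 3))
      (Fin.last k)))

/-- `final` is `(-iA)^{-k}` applied to the last component at time `T`, which is defined, linear and
bounded on all jets; on compatible ones it is the value at `T` of the path itself. -/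
theorem coe_final {y : PathJet T (2 * p + 3) k} (hy : y ∈ compatibleJets hT (2 * p + 3) k) :
    (E.final y : L2) = (y 0 ⟨T, right_mem_Icc.2 hT⟩ : L2) :=
  L2.ext_inner fun j => by
    have h1 : HZero.coef (2 * (p + k) + 3) j (E.final y)
        = HZero.coef (2 * p + 3) j (y 0 ⟨T, right_mem_Icc.2 hT⟩) := by
      change HZero.coef (2 * (p + k) + 3) j (E.L (y (Fin.last k) ⟨T, right_mem_Icc.2 hT⟩)) = _
      rw [E.coef_L, coef_last_of_compatible hT hy,
        inv_mul_cancel_left₀ (pow_ne_zero k (neg_I_mul_eigenval_ne_zero j))]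
    exact h1

/-- Existence of weak solutions, for a source of the form `v μ z`. -/
theorem isWeakSolution_jet (hT' : 0 < T) (u v : HkZero T k) {f : ℝ → L2}
    {z : PathJet T (2 * p + 3) k} (hz : z ∈ compatibleJets hT (2 * p + 3) k)
    (hf : f =ᵐ[volume.restrict (Ioo (0 : ℝ) T)]
      fun τ => (v.toFun τ : ℂ) • E.M (IccExtend hT (z 0) τ : HZero (2 * p + 3)))
    (ψ₀ : HZero (2 * (p + k) + 3)) :
    IsWeakSolution T k (2 * p + 3) μ u.toFun f ψ₀
      (IccExtend hT (E.jet (u : JetL2 T k) (E.S ψ₀ + E.A (v : JetL2 T k) z) 0)) := by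
  set y := E.jet (u : JetL2 T k) (E.S ψ₀ + E.A (v : JetL2 T k) z) with hy
  have hym : y ∈ compatibleJets hT (2 * p + 3) k :=
    E.jet_mem u (Submodule.add_mem _ (E.S_mem ψ₀) (E.A_mem v hz))
  refine ⟨contDiffOn_of_compatible hT' hym, ?_⟩
  refine (weak_formula_iff hT E.M_apply E.coef_K ((u : JetL2 T k) 0) ((v : JetL2 T k) 0) hf
    (y := y 0) (fun t => IccExtend_val hT _ t) (y₀ := E.S ψ₀ 0) (E.coef_S_zero ψ₀)).2 ?_
  -- The component of index `0` of the fixed point equation is the weak formulation.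
  have h1 := congrFun (E.jet_eq (u : JetL2 T k) (E.S ψ₀ + E.A (v : JetL2 T k) z)) 0
  rw [← hy, Pi.add_apply, Pi.add_apply, E.A_apply_zero, E.A_apply_zero] at h1
  exact h1

theorem eqOn_of_isWeakSolution (E : Evolution T hT p k μ)
    (u v : HkZero T k) {f : ℝ → L2} {z : PathJet T (2 * p + 3) k}
    (hf : f =ᵐ[volume.restrict (Ioo (0 : ℝ) T)]
      fun τ => (v.toFun τ : ℂ) • E.M (IccExtend hT (z 0) τ : HZero (2 * p + 3)))
    (ψ₀ : HZero (2 * (p + k) + 3)) {ψ ψ' : ℝ → HZero (2 * p + 3)}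
    (h : IsWeakSolution T k (2 * p + 3) μ u.toFun f ψ₀ ψ)
    (h' : IsWeakSolution T k (2 * p + 3) μ u.toFun f ψ₀ ψ') : EqOn ψ ψ' (Icc 0 T) :=
  IsWeakSolution.eqOn hT E.M_apply E.coef_K E.C_nonneg E.K_estimate ((u : JetL2 T k) 0)
    ((v : JetL2 T k) 0) hf (E.coef_S_zero ψ₀) h h'

/-- The jet of the solution of the Cauchy problem. -/
noncomputable def sol (x : HZero (2 * (p + k) + 3) × HkZero T k) : PathJet T (2 * p + 3) k :=
  E.jet (x.2 : JetL2 T k) (E.S x.1)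

theorem sol_eq (x : HZero (2 * (p + k) + 3) × HkZero T k) :
    E.sol x = E.S x.1 + E.A (x.2 : JetL2 T k) (E.sol x) := E.jet_eq _ _

theorem sol_mem (x : HZero (2 * (p + k) + 3) × HkZero T k) :
    E.sol x ∈ compatibleJets hT (2 * p + 3) k := E.jet_mem _ (E.S_mem _)

/-- The equation without source is the case `v = 0`, `z = 0` of the equation with source `v μ z`, so
existence and uniqueness are proved once for both. -/
theorem zero_source : (fun _ => 0 : ℝ → L2) =ᵐ[volume.restrict (Ioo (0 : ℝ) T)]
    fun τ => (((0 : HkZero T k).toFun τ : ℝ) : ℂ)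
      • E.M (IccExtend hT ((0 : PathJet T (2 * p + 3) k) 0) τ : HZero (2 * p + 3)) := by
  refine Filter.Eventually.of_forall fun τ => ?_
  change (0 : L2) = (((0 : HkZero T k).toFun τ : ℝ) : ℂ)
    • E.M (HZero.incl (2 * p + 3) (0 : HZero (2 * p + 3)))
  rw [map_zero, map_zero, smul_zero]

theorem isSolution_sol (hT' : 0 < T) (ψ₀ : HZero (2 * (p + k) + 3)) (u : HkZero T k) :
    IsSolution T p k μ ψ₀ u (IccExtend hT (E.sol (ψ₀, u) 0)) := by
  have h1 := E.isWeakSolution_jet hT' u 0 (Submodule.zero_mem _) E.zero_source ψ₀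
  rwa [map_zero, add_zero] at h1

theorem eqOn_of_isSolution (E : Evolution T hT p k μ)
    {ψ₀ : HZero (2 * (p + k) + 3)} {u : HkZero T k}
    {ψ ψ' : ℝ → HZero (2 * p + 3)} (h : IsSolution T p k μ ψ₀ u ψ)
    (h' : IsSolution T p k μ ψ₀ u ψ') : EqOn ψ ψ' (Icc 0 T) :=
  E.eqOn_of_isWeakSolution u 0 E.zero_source ψ₀ h h'

theorem coe_final_sol (hT' : 0 < T) {ψ₀ : HZero (2 * (p + k) + 3)} {u : HkZero T k}
    {ψ : ℝ → HZero (2 * p + 3)} (h : IsSolution T p k μ ψ₀ u ψ) :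
    (E.final (E.sol (ψ₀, u)) : L2) = (ψ T : L2) := by
  rw [E.coe_final (E.sol_mem _), E.eqOn_of_isSolution h (E.isSolution_sol hT' ψ₀ u)
    (right_mem_Icc.2 hT), IccExtend_of_mem hT _ (right_mem_Icc.2 hT)]

theorem isSolution_solution (E : Evolution T hT p k μ)
    (hT' : 0 < T) (ψ₀ : HZero (2 * (p + k) + 3)) (u : HkZero T k) :
    IsSolution T p k μ ψ₀ u (solution T p k μ ψ₀ u) := by
  have h : ∃ ψ, IsSolution T p k μ ψ₀ u ψ := ⟨_, E.isSolution_sol hT' ψ₀ u⟩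
  rw [solution, dif_pos h]
  exact h.choose_spec

theorem linearized_source (hT' : 0 < T) {ψ₀ : HZero (2 * (p + k) + 3)} {u : HkZero T k}
    {ψ : ℝ → HZero (2 * p + 3)} (h : IsSolution T p k μ ψ₀ u ψ) (v : HkZero T k) :
    (fun t => (v.toFun t : ℂ) • mulL2 μ (ψ t)) =ᵐ[volume.restrict (Ioo (0 : ℝ) T)]
      fun τ => (v.toFun τ : ℂ) • E.M (IccExtend hT (E.sol (ψ₀, u) 0) τ : HZero (2 * p + 3)) := by
  filter_upwards [ae_restrict_mem measurableSet_Ioo] with τ hτ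
  rw [E.M_apply, E.eqOn_of_isSolution h (E.isSolution_sol hT' ψ₀ u) (Ioo_subset_Icc_self hτ)]

/-- The map `(ψ₀, u) ↦ A(u)`. -/
noncomputable def controlOp : HZero (2 * (p + k) + 3) × HkZero T k →L[ℝ]
    PathJet T (2 * p + 3) k →L[ℝ] PathJet T (2 * p + 3) k :=
  (E.A.comp (Submodule.subtypeL _)).comp (ContinuousLinearMap.snd ℝ _ _)

/-- The map `(ψ₀, u) ↦ S ψ₀`. -/
noncomputable def freeOp : HZero (2 * (p + k) + 3) × HkZero T k →L[ℝ] PathJet T (2 * p + 3) k :=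
  E.S.comp (ContinuousLinearMap.fst ℝ _ _)

/-- The jet is `(1 - A(U))⁻¹ S ψ₀`, with `A(U)` linear in the control and `S ψ₀` linear in the
datum. -/
theorem contDiff_sol : ContDiff ℝ 1 E.sol :=
  contDiff_inverse_one_sub_apply E.controlOp E.freeOp fun x => E.isUnit (x.2 : JetL2 T k)

/-- The differentiated fixed point equation has the unique solution on the right, which is the jet
of the linearized equation with source `v μ ψ`. -/
theorem fderiv_sol (x h : HZero (2 * (p + k) + 3) × HkZero T k) :
    fderiv ℝ E.sol x h
      = E.jet (x.2 : JetL2 T k) (E.S h.1 + E.A (h.2 : JetL2 T k) (E.sol x)) :=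
  E.eq_jet (fderiv_of_fixedPoint E.controlOp E.freeOp
    (E.contDiff_sol.differentiable one_ne_zero x) E.sol_eq h)

/-- Both arbitrary choices in the definition of the end-point map are harmless: the solution is
unique on `[0,T]`, and an element of the target space is determined by its underlying `L²` function.
-/
theorem endPointMap_eq (E : Evolution T hT p k μ)
    (hT' : 0 < T) {J : Set ℕ+}
    {Q : HZero (2 * (p + k) + 3) →L[ℝ] targetSpace T J (2 * (p + k) + 3)}
    (hQ : ∀ w : HZero (2 * (p + k) + 3), ((Q w : HZero (2 * (p + k) + 3)) : L2)
      = tangentProj (groundState T) (projJ J w)) :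
    endPointMap T p k J μ = fun x => (x.1, Q (E.final (E.sol x))) := by
  funext x
  have h1 : ((Q (E.final (E.sol x)) : HZero (2 * (p + k) + 3)) : L2)
      = tangentProj (groundState T) (projJ J (solution T p k μ x.1 x.2 T)) := by
    rw [hQ, E.coe_final_sol hT' (E.isSolution_solution hT' x.1 x.2)]
  have h : ∃ w : targetSpace T J (2 * (p + k) + 3),
      ((w : HZero (2 * (p + k) + 3)) : L2)
        = tangentProj (groundState T) (projJ J (solution T p k μ x.1 x.2 T)) := ⟨_, h1⟩
  refine Prod.ext rfl ?_
  rw [endPointMap, dif_pos h]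
  exact Subtype.ext (HZero.incl_injective (h.choose_spec.trans h1.symm))

theorem coe_final_fderiv_sol (hT' : 0 < T) {ψ₀ Ψ₀ : HZero (2 * (p + k) + 3)} {u v : HkZero T k}
    {ψ Ψ : ℝ → HZero (2 * p + 3)} (hψ : IsSolution T p k μ ψ₀ u ψ)
    (hΨ : IsLinearizedSolution T p k μ u ψ Ψ₀ v Ψ) :
    (E.final (fderiv ℝ E.sol (ψ₀, u) (Ψ₀, v)) : L2) = (Ψ T : L2) := by
  have hs := E.linearized_source hT' hψ v
  rw [fderiv_sol, E.coe_final (E.jet_mem u (Submodule.add_mem _ (E.S_mem Ψ₀)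
      (E.A_mem v (E.sol_mem (ψ₀, u))))),
    E.eqOn_of_isWeakSolution u v hs Ψ₀ hΨ (E.isWeakSolution_jet hT' u v (E.sol_mem (ψ₀, u)) hs Ψ₀)
      (right_mem_Icc.2 hT), IccExtend_of_mem hT _ (right_mem_Icc.2 hT)]

end Evolution

end BilinearSchrodinger

/-! ### The theorem -/

open BilinearSchrodinger in
theorem proposition4p1 (T : ℝ) (hT : 0 < T) (p k : ℕ) (J : Set ℕ+) (μ : ℝ → ℝ)
    (hμ : MemSobolev (2 * (p + k) + 3) μ)
    (hμ' : ∀ n < p, DerivVanishesAtEnds (2 * n + 1) μ) :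
    -- the Cauchy problem is well posed, and `Θ_T` is the map `(ψ₀, u) ↦ (ψ₀, Π P_J ψ(T))`
    (∀ (ψ₀ : HZero (2 * (p + k) + 3)) (u : HkZero T k),
      (∃ ψ, IsSolution T p k μ ψ₀ u ψ) ∧
      (∀ ψ ψ', IsSolution T p k μ ψ₀ u ψ → IsSolution T p k μ ψ₀ u ψ' →
        Set.EqOn ψ ψ' (Set.Icc 0 T)) ∧
      ∀ ψ, IsSolution T p k μ ψ₀ u ψ →
        (ψ T : L2) ∈ hZeroSubmodule (2 * (p + k) + 3) ∧
        (endPointMap T p k J μ (ψ₀, u)).1 = ψ₀ ∧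
        (((endPointMap T p k J μ (ψ₀, u)).2 : HZero (2 * (p + k) + 3)) : L2)
          = tangentProj (groundState T) (projJ J (ψ T))) ∧
    -- `Θ_T` maps `(S ∩ H) × H^k_0` to `(S ∩ H) × (T_S ψ₁(T) ∩ H_J ∩ H)`
    Set.MapsTo (endPointMap T p k J μ)
      (unitSphere (2 * (p + k) + 3) ×ˢ Set.univ) (unitSphere (2 * (p + k) + 3) ×ˢ Set.univ) ∧
    -- `Θ_T` is `C¹`
    ContDiff ℝ 1 (endPointMap T p k J μ) ∧
    -- its differential is given by the linearized equation
    ∀ (ψ₀ : HZero (2 * (p + k) + 3)) (u : HkZero T k) (ψ : ℝ → HZero (2 * p + 3)),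
      IsSolution T p k μ ψ₀ u ψ →
      ∀ (Ψ₀ : HZero (2 * (p + k) + 3)) (v : HkZero T k),
        (∃ Ψ, IsLinearizedSolution T p k μ u ψ Ψ₀ v Ψ) ∧
        (∀ Ψ Ψ', IsLinearizedSolution T p k μ u ψ Ψ₀ v Ψ →
          IsLinearizedSolution T p k μ u ψ Ψ₀ v Ψ' → Set.EqOn Ψ Ψ' (Set.Icc 0 T)) ∧
        ∀ Ψ, IsLinearizedSolution T p k μ u ψ Ψ₀ v Ψ →
          (fderiv ℝ (endPointMap T p k J μ) (ψ₀, u) (Ψ₀, v)).1 = Ψ₀ ∧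
          (((fderiv ℝ (endPointMap T p k J μ) (ψ₀, u) (Ψ₀, v)).2 :
              HZero (2 * (p + k) + 3)) : L2)
            = tangentProj (groundState T) (projJ J (Ψ T)) := by
  obtain ⟨E⟩ := nonempty_evolution hT.le hμ hμ'
  obtain ⟨Q, hQ⟩ := exists_targetProj T J (2 * (p + k) + 3)
  have hΘ := E.endPointMap_eq hT hQ
  -- The end-point map leaves `ψ₀` unchanged, so its first component and its action on the sphere
  -- need no argument.
  refine ⟨fun ψ₀ u => ⟨⟨_, E.isSolution_sol hT ψ₀ u⟩, fun ψ ψ' h h' => E.eqOn_of_isSolution h h',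
    fun ψ hψ => ⟨?_, rfl, ?_⟩⟩, fun x hx => hx, ?_, fun ψ₀ u ψ hψ Ψ₀ v => ?_⟩
  · rw [← E.coe_final_sol hT hψ]
    exact (E.final (E.sol (ψ₀, u))).2
  · rw [hΘ, hQ, E.coe_final_sol hT hψ]
  · rw [hΘ]
    exact contDiff_fst_prodMk_comp (Q.comp E.final) E.contDiff_sol
  · have hs := E.linearized_source hT hψ v
    refine ⟨⟨_, E.isWeakSolution_jet hT u v (E.sol_mem (ψ₀, u)) hs Ψ₀⟩,
      fun Ψ Ψ' h h' => E.eqOn_of_isWeakSolution u v hs Ψ₀ h h', fun Ψ hΨ => ?_⟩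
    have hd := fderiv_fst_prodMk_comp (Q.comp E.final)
      (E.contDiff_sol.differentiable one_ne_zero (ψ₀, u)) (Ψ₀, v)
    rw [hΘ]
    refine ⟨congrArg Prod.fst hd, ?_⟩
    rw [← E.coe_final_fderiv_sol hT hψ hΨ, ← hQ]
    exact congrArg (fun w : _ × targetSpace T J (2 * (p + k) + 3) =>
      ((w.2 : HZero (2 * (p + k) + 3)) : L2)) hd
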